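/- Write $\hat v = v/\sqrt{1+v^2}$ and consider the one-dimensional relativistic Vlasov–Klein–Gordon system ($t\ge 0$, $x,v\in\mathbb R$) \[ \partial_t f+\hat v\,\partial_x f-\partial_x u\,\partial_v f=0,\qquad \partial_t^2u-\partial_x^2u+u=-\rho,\qquad \rho(t,x)=\int_{\mathbb R} f(t,x,v)\,dv , \] with initial conditions $f(0)=\mathring f$, $u(0)=\mathring u_1$, $\partial_tu(0)=\mathring u_2$. Let $\mathring f\in C^1_c(\mathbb R^2)$, $\mathring u_1\in C^3_b(\mathbb R)$ and $\mathring u_2\in C^2_b(\mathbb R)$, where $C^k_b$ denotes the $C^k$ functions that are bounded together with their derivatives up to order $k$. Then there exists a unique global classical solution \[ f\in C^1([0,\infty[\,\times\mathbb R^2),\qquad u\in C^2([0,\infty[\,\times\mathbb R) \] of this initial value problem, where $f(t,x,\cdot)$ is integrable for all $t\ge0$, $x\in\mathbb R$. If $\mathring f\ge 0$ then $f\ge 0$. Moreover, there is a constant $C>0$, depending only on an upper bound for the norms $\|\mathring f\|_\infty$, $\|\mathring f\|_{1}$, $\|\mathring u_1\|_{C^3_b}$, $\|\mathring u_2\|_{C^2_b}$,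 with the following property. If $\mathring R,\mathring P$ are such that $\mathring f(x,v)\neq0$ implies $|x|\le \mathring R$ and $|v|\le\mathring P$, then the integral equation \[ P(t)=\mathring P+C(1+t)^3+C\int_0^t sP(s)\,ds,\qquad t\ge 0, \] has a unique continuous solution $P$ on $[0,\infty[$, and \[ f(t,x,v)=0\quad\text{whenever } t\ge 0 \text{ and } \bigl(|x|\ge\mathring R+t\ \text{ or }\ |v|\ge P(t)\bigr). \] -/

import Mathlib

open MeasureTheory Set

/-- The relativistic velocity of a particle of unit rest mass with momentum `v`. -/
noncomputable def relVelocity (v : ℝ) : ℝ := v / Real.sqrt (1 + v ^ 2)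

/-- Initial data `(f₀, u₁, u₂)` with `f₀ ∈ C¹_c(ℝ²)`, `u₁ ∈ C³_b(ℝ)`, `u₂ ∈ C²_b(ℝ)` whose norms
`‖f₀‖_∞`, `‖f₀‖_1`, `‖u₁‖_{C³_b}`, `‖u₂‖_{C²_b}` are all at most `M`. -/
structure IsVKGData (M : ℝ) (f₀ : ℝ × ℝ → ℝ) (u₁ u₂ : ℝ → ℝ) : Prop where
  contDiff_f : ContDiff ℝ 1 f₀
  compactSupport_f : HasCompactSupport f₀
  contDiff_u₁ : ContDiff ℝ 3 u₁
  contDiff_u₂ : ContDiff ℝ 2 u₂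
  sup_f_le : ∀ z, |f₀ z| ≤ M
  integral_f_le : ∫ z, |f₀ z| ≤ M
  bound_u₁ : ∀ k ≤ 3, ∀ x, |iteratedDeriv k u₁ x| ≤ M
  bound_u₂ : ∀ k ≤ 2, ∀ x, |iteratedDeriv k u₂ x| ≤ M

/-- `(f, u)` is a global classical solution on `[0, ∞[` of the one-dimensional relativistic
Vlasov–Klein–Gordon system with initial data `(f₀, u₁, u₂)`. The arguments are
`f (t, x, v)` and `u (t, x)`; values at negative times play no role, and time derivatives are
taken within `[0, ∞[` (hence one-sided at `t = 0`). -/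
structure IsGlobalVKGSolution (f₀ : ℝ × ℝ → ℝ) (u₁ u₂ : ℝ → ℝ)
    (f : ℝ × ℝ × ℝ → ℝ) (u : ℝ × ℝ → ℝ) : Prop where
  contDiffOn_f : ContDiffOn ℝ 1 f (Ici (0 : ℝ) ×ˢ univ)
  contDiffOn_u : ContDiffOn ℝ 2 u (Ici (0 : ℝ) ×ˢ univ)
  vlasov : ∀ t ≥ 0, ∀ x v,
    derivWithin (fun s => f (s, x, v)) (Ici 0) t
      + relVelocity v * deriv (fun y => f (t, y, v)) x
      - deriv (fun y => u (t, y)) x * deriv (fun w => f (t, x, w)) v = 0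
  integrable_f : ∀ t ≥ 0, ∀ x, Integrable (fun v => f (t, x, v))
  kleinGordon : ∀ t ≥ 0, ∀ x,
    iteratedDerivWithin 2 (fun s => u (s, x)) (Ici 0) t
      - iteratedDeriv 2 (fun y => u (t, y)) x + u (t, x) = - ∫ v, f (t, x, v)
  init_f : ∀ x v, f (0, x, v) = f₀ (x, v)
  init_u : ∀ x, u (0, x) = u₁ x
  init_dtu : ∀ x, derivWithin (fun s => u (s, x)) (Ici 0) 0 = u₂ x

/-- `P` is a continuous solution on `[0, ∞[` of the integral equation
`P(t) = P₀ + C (1 + t)³ + C ∫₀ᵗ s P(s) ds`. -/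
structure SolvesMomentumEquation (C P₀ : ℝ) (P : ℝ → ℝ) : Prop where
  continuousOn : ContinuousOn P (Ici 0)
  eq : ∀ t ≥ 0, P t = P₀ + C * (1 + t) ^ 3 + C * ∫ s in (0 : ℝ)..t, s * P s

/-! ### Ordinary differential equations -/

section ODE

open Filter Topology

variable {E : Type*} [NormedAddCommGroup E] [NormedSpace ℝ E]

/-! Write `E = ∂ₓu`. The invariants `∂ₜu + σ∂ₓu`, `σ = ±1`, are obtained by integrating the source
`-ρ - u` along light rays `s ↦ x + σ(t - s)`, and `f` is `f₀` carried along the characteristics `x'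
= v̂`, `v' = -E`. A Picard iteration on the pair `(u, E)` alternates these two steps.

Global bound. Let `P` solve the integral equation with `C = 4M + 2`. If `|u|, |E| ≤ P'`, then
momenta that start below `P(0)` stay below `P(t)`, so `|ρ| ≤ 2MP`, and integrating the source bounds
the new invariants by `2M + 2M∫P + P(t) - P(0)`. By `add_le_momentumRate` this is again at most
`P'(t)`, so the bound is inherited by every iterate (`abs_riemann_le`). It also contains the claim
on the momentum support.

Gradient bound. `∂ₓE` involves ray integrals of `∂ₓρ`, an apparent loss of a derivative. Particles
are slower than light, so `σ + v̂` never vanishes, and the Vlasov equation gives `(σ + v̂)∂ₓf = E∂ᵥf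
- (∂ₜ - σ∂ₓ)f`. After division by `σ + v̂`, one term is integrated by parts in `v` and the other is
a total derivative along the ray: no derivative of `f` remains (`moment_vlasov`,
`lineIntegral_moment_deriv`). As the weights are bounded on the momentum support, all iterates share
a Lipschitz constant.

Convergence. With a common Lipschitz constant the step halves exponentially weighted sup norms
(`exists_contraction`). The limit field is at first only Lipschitz, but the gradient formula needs
no more and depends continuously on the field, so the gradients converge too
(`exists_riemannDeriv_sub_le`). Hadamard's lemma for the flow then makes the transported density
`C¹`.

Uniqueness. Any classical solution satisfies the same representation formulas. It comes without
global bounds, but by finite propagation speed the contraction can be run on a compact backward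
light cone (`eq_on_cone`). -/

theorem gronwallBound_le_mul_exp {δ K ε x : ℝ} (hK : 0 ≤ K) (hε : 0 ≤ ε) :
    gronwallBound δ K ε x ≤ (δ + ε * x) * Real.exp (K * x) := by
  rcases hK.eq_or_lt with rfl | hK
  · simp [gronwallBound_K0]
  · rw [gronwallBound_of_K_ne_0 hK.ne', add_mul]
    refine add_le_add le_rfl ?_
    -- Here `e^y - 1 ≤ y e^y` with `y = Kx`, equivalent to `1 - y ≤ e^{-y}`; it removes the quotient
    -- by `K`.
    have h1 : Real.exp (K * x) - 1 ≤ K * x * Real.exp (K * x) := by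
      have h := Real.add_one_le_exp (-(K * x))
      have h2 : Real.exp (-(K * x)) * Real.exp (K * x) = 1 := by
        rw [← Real.exp_add]; simp
      nlinarith [Real.exp_pos (K * x)]
    calc ε / K * (Real.exp (K * x) - 1) ≤ ε / K * (K * x * Real.exp (K * x)) := by gcongr
      _ = ε * x * Real.exp (K * x) := by field_simp

/-- Grönwall's inequality on a compact interval, in both time directions. -/
theorem norm_le_of_norm_deriv_le {γ γ' : ℝ → E} {a b t₀ K ε δ : ℝ} (hK : 0 ≤ K) (hε : 0 ≤ ε)
    (ht₀ : t₀ ∈ Icc a b) (hd : ∀ s ∈ Icc a b, HasDerivAt γ (γ' s) s)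
    (hb : ∀ s ∈ Icc a b, ‖γ' s‖ ≤ K * ‖γ s‖ + ε) (h₀ : ‖γ t₀‖ ≤ δ) {s : ℝ} (hs : s ∈ Icc a b) :
    ‖γ s‖ ≤ (δ + ε * (b - a)) * Real.exp (K * (b - a)) := by
  have hδ : 0 ≤ δ := (norm_nonneg _).trans h₀
  have main : ∃ x, 0 ≤ x ∧ x ≤ b - a ∧ ‖γ s‖ ≤ gronwallBound δ K ε x := by
    rcases le_total t₀ s with h | h
    · refine ⟨s - t₀, by linarith, by linarith [ht₀.1, hs.2], ?_⟩
      refine norm_le_gronwallBound_of_norm_deriv_right_le (f := γ) (f' := γ') (a := t₀) (b := s)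
        ?_ ?_ h₀ ?_ s ⟨h, le_rfl⟩
      · exact fun r hr => (hd r ⟨ht₀.1.trans hr.1, hr.2.trans hs.2⟩).continuousAt.continuousWithinAt
      · exact fun r hr => (hd r ⟨ht₀.1.trans hr.1, hr.2.le.trans hs.2⟩).hasDerivWithinAt
      · exact fun r hr => hb r ⟨ht₀.1.trans hr.1, hr.2.le.trans hs.2⟩
    -- Backward in time: the forward estimate is applied to `r ↦ γ (-r)`.
    · refine ⟨t₀ - s, by linarith, by linarith [ht₀.2, hs.1], ?_⟩
      have hd' : ∀ r ∈ Icc (-t₀) (-s), HasDerivAt (fun r => γ (-r)) (-γ' (-r)) r := by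
        intro r hr
        have h1 := hd (-r) ⟨by linarith [hs.1, hr.2], by linarith [ht₀.2, hr.1]⟩
        simpa [Function.comp_def] using h1.scomp r (hasDerivAt_neg r)
      have := norm_le_gronwallBound_of_norm_deriv_right_le (f := fun r => γ (-r))
        (f' := fun r => -γ' (-r)) (a := -t₀) (b := -s) (δ := δ) (K := K) (ε := ε)
        (fun r hr => (hd' r hr).continuousAt.continuousWithinAt)
        (fun r hr => (hd' r ⟨hr.1, hr.2.le⟩).hasDerivWithinAt) (by simpa using h₀) ?_ (-s)
        ⟨by linarith, le_rfl⟩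
      · simpa [sub_eq_add_neg, add_comm] using this
      · intro r hr
        rw [norm_neg]
        exact hb (-r) ⟨by linarith [hs.1, hr.2], by linarith [ht₀.2, hr.1]⟩
  obtain ⟨x, hx, hxb, h⟩ := main
  refine h.trans ((gronwallBound_le_mul_exp hK hε).trans ?_)
  have : 0 ≤ δ + ε * (b - a) := add_nonneg hδ (mul_nonneg hε (hx.trans hxb))
  gcongr

/-- Two solutions of a locally uniformly Lipschitz equation that agree at one time agree. -/
theorem solution_unique {F : ℝ → E → E} {T K : ℝ} (hK : 0 ≤ K)
    (hF : ∀ t ∈ Icc (-T) T, ∀ y z, ‖F t y - F t z‖ ≤ K * ‖y - z‖) {γ η : ℝ → E}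
    (hγ : ∀ t ∈ Icc (-T) T, HasDerivAt γ (F t (γ t)) t)
    (hη : ∀ t ∈ Icc (-T) T, HasDerivAt η (F t (η t)) t) {t₀ : ℝ} (ht₀ : t₀ ∈ Icc (-T) T)
    (h : γ t₀ = η t₀) {s : ℝ} (hs : s ∈ Icc (-T) T) : γ s = η s := by
  have := norm_le_of_norm_deriv_le (γ := fun t => γ t - η t)
    (γ' := fun t => F t (γ t) - F t (η t)) hK le_rfl ht₀
    (fun s hs => (hγ s hs).sub (hη s hs)) (δ := 0) (fun s hs => by simpa using hF s hs _ _)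
    (by simp [h]) hs
  simpa [sub_eq_zero] using this

/-- Clamping both coordinates to `[-N, N]`. -/
noncomputable def boxClamp (N : ℝ) (p : ℝ × ℝ) : ℝ × ℝ :=
  (max (-N) (min N p.1), max (-N) (min N p.2))

theorem abs_clamp_le {N : ℝ} (hN : 0 ≤ N) (x : ℝ) : |max (-N) (min N x)| ≤ N := by
  rw [abs_le]; constructor
  · exact le_max_left _ _
  · exact max_le (by linarith) (min_le_left _ _)

theorem abs_clamp_le_abs {N : ℝ} (hN : 0 ≤ N) (x : ℝ) : |max (-N) (min N x)| ≤ |x| := by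
  rw [abs_le]
  constructor
  · rcases le_total N x with h | h
    · rw [min_eq_left h]; exact le_max_of_le_right (by linarith [abs_nonneg x])
    · rw [min_eq_right h]; exact le_max_of_le_right (neg_abs_le x)
  · exact max_le (by linarith [abs_nonneg x]) ((min_le_right _ _).trans (le_abs_self x))

theorem abs_clamp_sub_clamp_le (N x y : ℝ) :
    |max (-N) (min N x) - max (-N) (min N y)| ≤ |x - y| := by
  rw [max_comm (-N), max_comm (-N), min_comm N, min_comm N]
  exact (abs_max_sub_max_le_abs _ _ _).trans ((abs_min_sub_min_le_max x N y N).trans (by simp))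

theorem clamp_eq_self {N x : ℝ} (h : |x| ≤ N) : max (-N) (min N x) = x := by
  rw [abs_le] at h
  rw [min_eq_right h.2, max_eq_right h.1]

theorem norm_boxClamp_le {N : ℝ} (hN : 0 ≤ N) (p : ℝ × ℝ) : ‖boxClamp N p‖ ≤ N := by
  simp only [boxClamp, Prod.norm_def, Real.norm_eq_abs]
  exact max_le (abs_clamp_le hN _) (abs_clamp_le hN _)

theorem norm_boxClamp_le_norm {N : ℝ} (hN : 0 ≤ N) (p : ℝ × ℝ) : ‖boxClamp N p‖ ≤ ‖p‖ := by
  simp only [boxClamp, Prod.norm_def, Real.norm_eq_abs]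
  exact max_le_max (abs_clamp_le_abs hN _) (abs_clamp_le_abs hN _)

theorem norm_boxClamp_sub_le (N : ℝ) (p q : ℝ × ℝ) : ‖boxClamp N p - boxClamp N q‖ ≤ ‖p - q‖ := by
  simp only [boxClamp, Prod.norm_def, Real.norm_eq_abs, Prod.fst_sub, Prod.snd_sub]
  exact max_le_max (abs_clamp_sub_clamp_le _ _ _) (abs_clamp_sub_clamp_le _ _ _)

theorem boxClamp_eq_self {N : ℝ} {p : ℝ × ℝ} (h : ‖p‖ ≤ N) : boxClamp N p = p := by
  rw [Prod.norm_def, max_le_iff] at h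
  exact Prod.ext (clamp_eq_self h.1) (clamp_eq_self h.2)

/-- Picard–Lindelöf on a prescribed interval needs a bounded right-hand side, whereas `F` grows
linearly. The argument of `F` is therefore clamped to a box as large as the Grönwall bound; the
solution of the truncated equation never leaves that box, so the truncation is inactive. -/
theorem exists_solution_Icc {F : ℝ → ℝ × ℝ → ℝ × ℝ} (hc : ∀ z, Continuous fun t => F t z)
    {T K : ℝ} (hT : 0 ≤ T) (hK : 0 ≤ K)
    (hF : ∀ t ∈ Icc (-(T + 1)) (T + 1), ∀ y z, ‖F t y - F t z‖ ≤ K * ‖y - z‖)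
    {t₀ : ℝ} (ht₀ : t₀ ∈ Icc (-T) T) (z : ℝ × ℝ) :
    ∃ γ : ℝ → ℝ × ℝ, γ t₀ = z ∧ ∀ t ∈ Icc (-T) T, HasDerivAt γ (F t (γ t)) t := by
  obtain ⟨B, hB⟩ := (isCompact_Icc (a := -(T + 1)) (b := T + 1)).exists_bound_of_continuousOn
    (hc 0).continuousOn
  have hB0 : 0 ≤ B := (norm_nonneg _).trans (hB 0 ⟨by linarith, by linarith⟩)
  set N : ℝ := (‖z‖ + B * (T - -T)) * Real.exp (K * (T - -T)) with hN
  have hN0 : 0 ≤ N := by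
    have : 0 ≤ T - -T := by linarith
    positivity
  have hbd : ∀ t ∈ Icc (-(T + 1)) (T + 1), ∀ p, ‖F t (boxClamp N p)‖ ≤ K * ‖p‖ + B := by
    intro t ht p
    have h1 := hF t ht (boxClamp N p) 0
    rw [sub_zero] at h1
    have h2 := norm_boxClamp_le_norm hN0 p
    have h3 : ‖F t (boxClamp N p)‖ ≤ ‖F t (boxClamp N p) - F t 0‖ + ‖F t 0‖ := by
      simpa using norm_add_le (F t (boxClamp N p) - F t 0) (F t 0)
    nlinarith [hB t ht]
  have hbd' : ∀ t ∈ Icc (-(T + 1)) (T + 1), ∀ p, ‖F t (boxClamp N p)‖ ≤ K * N + B := by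
    intro t ht p
    have h1 := hF t ht (boxClamp N p) 0
    rw [sub_zero] at h1
    have h2 := norm_boxClamp_le hN0 p
    have h3 : ‖F t (boxClamp N p)‖ ≤ ‖F t (boxClamp N p) - F t 0‖ + ‖F t 0‖ := by
      simpa using norm_add_le (F t (boxClamp N p) - F t 0) (F t 0)
    nlinarith [hB t ht]
  have ht₀' : t₀ ∈ Icc (-(T + 1)) (T + 1) := ⟨by linarith [ht₀.1], by linarith [ht₀.2]⟩
  -- The equation is solved on an interval longer by one at each end, so that one-sided derivatives
  -- at its ends do not matter on `[-T, T]`.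
  have hPL : IsPicardLindelof (fun t p => F t (boxClamp N p)) (⟨t₀, ht₀'⟩ : Icc (-(T + 1)) (T + 1)) z
      ⟨(K * N + B) * (2 * (T + 1)), by positivity⟩ 0 ⟨K * N + B, by positivity⟩ ⟨K, hK⟩ := by
    refine ⟨?_, ?_, ?_, ?_⟩
    · intro t ht
      refine (LipschitzWith.of_dist_le_mul fun p q => ?_).lipschitzOnWith
      rw [dist_eq_norm, dist_eq_norm]
      refine (hF t ht _ _).trans ?_
      exact mul_le_mul_of_nonneg_left (norm_boxClamp_sub_le _ _ _) hK
    · exact fun x _ => (hc _).continuousOn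
    · exact fun t ht x _ => hbd' t ht x
    · simp only [NNReal.coe_zero, sub_zero]
      refine mul_le_mul_of_nonneg_left ?_ (add_nonneg (mul_nonneg hK hN0) hB0)
      exact max_le (by linarith [ht₀.1]) (by linarith [ht₀.2])
  obtain ⟨γ, h0, hγ⟩ := hPL.exists_eq_forall_mem_Icc_hasDerivWithinAt₀
  have hd : ∀ t ∈ Icc (-T) T, HasDerivAt γ (F t (boxClamp N (γ t))) t := fun t ht =>
    (hγ t ⟨by linarith [ht.1], by linarith [ht.2]⟩).hasDerivAt
      (Icc_mem_nhds (by linarith [ht.1]) (by linarith [ht.2]))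
  refine ⟨γ, h0, fun t ht => ?_⟩
  have := norm_le_of_norm_deriv_le hK hB0 ht₀ hd
    (fun s hs => hbd s ⟨by linarith [hs.1], by linarith [hs.2]⟩ _) (by rw [h0]) ht
  have h := hd t ht
  rwa [boxClamp_eq_self (hN ▸ this)] at h

/-- Global existence for a planar equation whose right-hand side is globally Lipschitz,
locally uniformly in time. -/
theorem exists_global_solution {F : ℝ → ℝ × ℝ → ℝ × ℝ} (hc : ∀ z, Continuous fun t => F t z)
    (hF : ∀ T, ∃ K, 0 ≤ K ∧ ∀ t ∈ Icc (-T) T, ∀ y z, ‖F t y - F t z‖ ≤ K * ‖y - z‖)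
    (t₀ : ℝ) (z : ℝ × ℝ) :
    ∃ γ : ℝ → ℝ × ℝ, γ t₀ = z ∧ ∀ t, HasDerivAt γ (F t (γ t)) t := by
  have key : ∀ n : ℕ, ∃ γ : ℝ → ℝ × ℝ, γ t₀ = z ∧
      ∀ t ∈ Icc (-(|t₀| + n)) (|t₀| + n), HasDerivAt γ (F t (γ t)) t := by
    intro n
    obtain ⟨K, hK, h⟩ := hF (|t₀| + n + 1)
    exact exists_solution_Icc hc (by positivity) hK h
      (abs_le.1 (by linarith [n.cast_nonneg (α := ℝ)])) z
  choose γ h0 hγ using key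
  have hmono : ∀ m n : ℕ, m ≤ n → ∀ t ∈ Icc (-(|t₀| + m)) (|t₀| + m), γ m t = γ n t := by
    intro m n hmn t ht
    obtain ⟨K, hK, h⟩ := hF (|t₀| + m)
    have hc : (m : ℝ) ≤ n := by exact_mod_cast hmn
    refine solution_unique hK h (hγ m) (fun t ht => hγ n t ⟨?_, ?_⟩)
      (abs_le.1 (by linarith [m.cast_nonneg (α := ℝ)])) ((h0 m).trans (h0 n).symm) ht
    · linarith [ht.1]
    · linarith [ht.2]
  have hmem : ∀ s : ℝ, s ∈ Icc (-(|t₀| + (⌈|s|⌉₊ : ℝ))) (|t₀| + (⌈|s|⌉₊ : ℝ)) := fun s =>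
    abs_le.1 ((Nat.le_ceil _).trans (by linarith [abs_nonneg t₀]))
  refine ⟨fun s => γ ⌈|s|⌉₊ s, h0 _, fun t => ?_⟩
  have heq : ∀ s, ⌈|s|⌉₊ ≤ ⌈|t|⌉₊ + 1 → γ ⌈|s|⌉₊ s = γ (⌈|t|⌉₊ + 1) s := fun s hs =>
    hmono _ _ hs s (hmem s)
  -- For `s` close to `t` the index `⌈|s|⌉₊` is at most `⌈|t|⌉₊ + 1`, so a single local solution
  -- represents the glued curve near `t`.
  have hev : (fun s => γ ⌈|s|⌉₊ s) =ᶠ[𝓝 t] γ (⌈|t|⌉₊ + 1) := by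
    have : ∀ᶠ s in 𝓝 t, |s| < |t| + 1 := continuous_abs.continuousAt.eventually_lt
      continuousAt_const (by linarith)
    filter_upwards [this] with s hs
    refine heq s (Nat.ceil_le.2 ?_)
    push_cast
    linarith [Nat.le_ceil |t|]
  have ht : t ∈ Icc (-(|t₀| + ((⌈|t|⌉₊ + 1 : ℕ) : ℝ))) (|t₀| + ((⌈|t|⌉₊ + 1 : ℕ) : ℝ)) := by
    have := hmem t
    push_cast
    exact ⟨by linarith [this.1], by linarith [this.2]⟩
  have := (hγ (⌈|t|⌉₊ + 1) t ht).congr_of_eventuallyEq hev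
  simpa only [heq t (Nat.le_succ _)] using this

/-- Solutions depend continuously on parameters and time. -/
theorem continuous_solution {Λ : Type*} [TopologicalSpace Λ] {F : Λ → ℝ → E → E}
    (hF : Continuous fun p : Λ × ℝ × E => F p.1 p.2.1 p.2.2)
    (hL : ∀ l₀ T, ∃ K, 0 ≤ K ∧ ∀ᶠ l in 𝓝 l₀, ∀ s ∈ Icc (-T) T, ∀ y z,
      ‖F l s y - F l s z‖ ≤ K * ‖y - z‖)
    {Y : Λ → ℝ → E} (hY : ∀ l s, HasDerivAt (Y l) (F l s (Y l s)) s) {τ : Λ → ℝ}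
    (hτ : Continuous τ) (h₀ : Continuous fun l => Y l (τ l)) :
    Continuous fun p : Λ × ℝ => Y p.1 p.2 := by
  rw [continuous_iff_continuousAt]
  rintro ⟨l₀, s₀⟩
  have hY0 : Continuous (Y l₀) := continuous_iff_continuousAt.2 fun s => (hY l₀ s).continuousAt
  set T : ℝ := max |s₀| |τ l₀| + 1 with hT
  have hT0 : 0 < T := by positivity
  obtain ⟨K, hK, hKL⟩ := hL l₀ T
  rw [Metric.continuousAt_iff']
  intro e he
  have hexp := Real.exp_pos (K * (T - -T))
  have hTT : 0 < T - -T := by linarith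
  obtain ⟨δ, hδ, hδe⟩ : ∃ δ > 0, (δ + δ * (T - -T)) * Real.exp (K * (T - -T)) < e / 2 := by
    refine ⟨e / 4 / ((1 + (T - -T)) * Real.exp (K * (T - -T))), by positivity, ?_⟩
    have h1 : (1 + (T - -T)) ≠ 0 := by positivity
    have : e / 4 / ((1 + (T - -T)) * Real.exp (K * (T - -T))) * (1 + (T - -T))
      * Real.exp (K * (T - -T)) = e / 4 := by field_simp
    nlinarith
  -- By compactness of the time interval, the right-hand sides for `l` near `l₀` are uniformly
  -- `δ`-close along the fixed curve `Y l₀`. This defect and the initial discrepancy are what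
  -- Grönwall amplifies, and `δ` was chosen for that.
  obtain ⟨v, hv, hvF⟩ := (isCompact_Icc (a := -T) (b := T)).mem_uniformity_of_prod
    (f := fun l s => F l s (Y l₀ s)) (s := univ) (q := l₀)
    (by
      have : Continuous fun p : Λ × ℝ => F p.1 p.2 (Y l₀ p.2) :=
        hF.comp (continuous_fst.prodMk (continuous_snd.prodMk (hY0.comp continuous_snd)))
      exact this.continuousOn)
    (mem_univ _) (Metric.dist_mem_uniformity hδ)
  rw [nhdsWithin_univ] at hv
  have hτT : ∀ᶠ l in 𝓝 l₀, |τ l| < T := (continuous_abs.comp hτ).continuousAt.eventually_lt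
    continuousAt_const (by simp only [Function.comp]; linarith [le_max_right |s₀| |τ l₀|])
  have hinit : ∀ᶠ l in 𝓝 l₀, ‖Y l (τ l) - Y l₀ (τ l)‖ < δ := by
    have hcont : Continuous fun l => ‖Y l (τ l) - Y l₀ (τ l)‖ := (h₀.sub (hY0.comp hτ)).norm
    exact hcont.continuousAt.eventually_lt continuousAt_const (by simpa using hδ)
  have hs : ∀ᶠ s in 𝓝 s₀, |s| < T ∧ dist (Y l₀ s) (Y l₀ s₀) < e / 2 :=
    (continuous_abs.continuousAt.eventually_lt continuousAt_const
      (by linarith [le_max_left |s₀| |τ l₀|])).and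
      (Metric.continuousAt_iff'.1 hY0.continuousAt _ (half_pos he))
  rw [nhds_prod_eq]
  filter_upwards [((hKL.and hv).and (hτT.and hinit)).prod_mk hs]
  rintro ⟨l, s⟩ ⟨⟨⟨hKl, hlv⟩, hτl, hil⟩, hsT, hse⟩
  simp only at *
  have hg := norm_le_of_norm_deriv_le (γ := fun s => Y l s - Y l₀ s)
    (γ' := fun s => F l s (Y l s) - F l₀ s (Y l₀ s)) (a := -T) (b := T) hK hδ.le (abs_le.1 hτl.le)
    (fun s _ => (hY l s).sub (hY l₀ s)) (δ := δ)
    (fun s hs => by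
      have h1 := hKl s hs (Y l s) (Y l₀ s)
      have h2 := hvF l hlv s hs
      simp only [mem_ofPred_eq, dist_eq_norm] at h2
      have h3 := norm_add_le (F l s (Y l s) - F l s (Y l₀ s)) (F l s (Y l₀ s) - F l₀ s (Y l₀ s))
      rw [sub_add_sub_cancel] at h3
      linarith) hil.le (abs_le.1 hsT.le)
  calc dist (Y l s) (Y l₀ s₀) ≤ dist (Y l s) (Y l₀ s) + dist (Y l₀ s) (Y l₀ s₀) :=
        dist_triangle _ _ _
    _ < e := by rw [dist_eq_norm (Y l s)]; linarith

end ODE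

/-! ### Differentiation tools -/

section Calculus

open Filter Topology

theorem contDiff_one_of_partial {E : Type*} [NormedAddCommGroup E] [NormedSpace ℝ E]
    {f f₁ : ℝ → E → ℝ} {f₂ : ℝ → E → E →L[ℝ] ℝ}
    (h₁ : ∀ t x, HasDerivAt (fun s => f s x) (f₁ t x) t)
    (h₂ : ∀ t x, HasFDerivAt (f t) (f₂ t x) x)
    (c₁ : Continuous fun p : ℝ × E => f₁ p.1 p.2)
    (c₂ : Continuous fun p : ℝ × E => f₂ p.1 p.2) :
    ContDiff ℝ 1 fun p : ℝ × E => f p.1 p.2 := by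
  have c₁' : Continuous fun p : ℝ × E => ContinuousLinearMap.toSpanSingleton ℝ (f₁ p.1 p.2) :=
    (ContinuousLinearMap.toSpanSingletonCLE (𝕜 := ℝ) (E := ℝ)).continuous.comp c₁
  have key : ∀ p : ℝ × E, HasFDerivAt (fun p : ℝ × E => f p.1 p.2)
      ((ContinuousLinearMap.toSpanSingleton ℝ (f₁ p.1 p.2)).coprod (f₂ p.1 p.2)) p := fun p =>
    (hasStrictFDerivAt_uncurry_coprod (𝕜 := ℝ) (f := f)
      (f₁ := fun t x => ContinuousLinearMap.toSpanSingleton ℝ (f₁ t x)) (f₂ := f₂)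
      (Eventually.of_forall fun v => (h₁ v.1 v.2).hasFDerivAt)
      (Eventually.of_forall fun v => h₂ v.1 v.2) c₁'.continuousAt c₂.continuousAt).hasFDerivAt
  rw [contDiff_one_iff_fderiv]
  refine ⟨fun p => (key p).differentiableAt, ?_⟩
  rw [show fderiv ℝ (fun p : ℝ × E => f p.1 p.2) = fun p : ℝ × E =>
    (ContinuousLinearMap.toSpanSingleton ℝ (f₁ p.1 p.2)).coprod (f₂ p.1 p.2) from
    funext fun p => (key p).fderiv]
  exact (ContinuousLinearMap.coprodEquivL (E := ℝ) (F := E) (G := ℝ) ℝ).continuous.comp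
    (c₁'.prodMk c₂)

theorem contDiff_one_of_partial_deriv {f f₁ f₂ : ℝ → ℝ → ℝ}
    (h₁ : ∀ t x, HasDerivAt (fun s => f s x) (f₁ t x) t)
    (h₂ : ∀ t x, HasDerivAt (f t) (f₂ t x) x)
    (c₁ : Continuous fun p : ℝ × ℝ => f₁ p.1 p.2)
    (c₂ : Continuous fun p : ℝ × ℝ => f₂ p.1 p.2) :
    ContDiff ℝ 1 fun p : ℝ × ℝ => f p.1 p.2 :=
  contDiff_one_of_partial h₁ (fun t x => (h₂ t x).hasFDerivAt) c₁
    ((ContinuousLinearMap.toSpanSingletonCLE (𝕜 := ℝ) (E := ℝ)).continuous.comp c₂)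

/-- The derivative along a curve of a `C¹` function given by its partial derivatives. -/
theorem hasDerivAt_comp_of_partial {f f₁ f₂ : ℝ → ℝ → ℝ}
    (h₁ : ∀ t x, HasDerivAt (fun s => f s x) (f₁ t x) t)
    (h₂ : ∀ t x, HasDerivAt (f t) (f₂ t x) x)
    (c₁ : Continuous fun p : ℝ × ℝ => f₁ p.1 p.2)
    (c₂ : Continuous fun p : ℝ × ℝ => f₂ p.1 p.2) {a b : ℝ → ℝ} {a' b' s : ℝ}
    (ha : HasDerivAt a a' s) (hb : HasDerivAt b b' s) :
    HasDerivAt (fun s => f (a s) (b s)) (a' * f₁ (a s) (b s) + b' * f₂ (a s) (b s)) s := by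
  have hd := (contDiff_one_of_partial_deriv h₁ h₂ c₁ c₂).differentiable one_ne_zero (a s, b s)
  have key := hd.hasFDerivAt
  have e1 : fderiv ℝ (fun p : ℝ × ℝ => f p.1 p.2) (a s, b s) (1, 0) = f₁ (a s) (b s) := by
    have := key.comp_hasDerivAt (a s) ((hasDerivAt_id (a s)).prodMk (hasDerivAt_const (a s) (b s)))
    exact this.unique (h₁ (a s) (b s))
  have e2 : fderiv ℝ (fun p : ℝ × ℝ => f p.1 p.2) (a s, b s) (0, 1) = f₂ (a s) (b s) := by
    have := key.comp_hasDerivAt (b s) ((hasDerivAt_const (b s) (a s)).prodMk (hasDerivAt_id (b s)))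
    exact this.unique (h₂ (a s) (b s))
  have := key.comp_hasDerivAt s (ha.prodMk hb)
  have e3 : ((a', b') : ℝ × ℝ) = a' • (1, 0) + b' • (0, 1) := by simp
  rw [e3, map_add, map_smul, map_smul, e1, e2] at this
  exact this

/-- Differentiation under the integral over a fixed interval. -/
theorem hasDerivAt_intervalIntegral {F F' : ℝ → ℝ → ℝ} (a b : ℝ)
    (hF : ∀ p v, HasDerivAt (fun q => F q v) (F' p v) p)
    (c : ∀ p, Continuous (F p)) (c' : Continuous fun p : ℝ × ℝ => F' p.1 p.2) (p : ℝ) :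
    HasDerivAt (fun q => ∫ v in a..b, F q v) (∫ v in a..b, F' p v) p := by
  obtain ⟨M, hM⟩ := ((isCompact_Icc (a := p - 1) (b := p + 1)).prod
    (isCompact_uIcc (a := a) (b := b))).exists_bound_of_continuousOn c'.continuousOn
  refine (intervalIntegral.hasDerivAt_integral_of_dominated_loc_of_deriv_le (μ := volume)
    (F := F) (F' := F') (bound := fun _ => M) (s := Icc (p - 1) (p + 1))
    (Icc_mem_nhds (by linarith) (by linarith)) ?_ ((c p).intervalIntegrable _ _) ?_ ?_
    (by simp) ?_).2
  · exact Eventually.of_forall fun q => (c q).aestronglyMeasurable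
  · exact (c'.comp (continuous_const.prodMk continuous_id)).aestronglyMeasurable
  · exact ae_of_all _ fun v hv q hq => hM (q, v) ⟨hq, uIoc_subset_uIcc hv⟩
  · exact ae_of_all _ fun v _ q _ => hF q v

/-- Hadamard's lemma in one variable. -/
theorem sub_eq_integral_mul {g g' : ℝ → ℝ} (hg : ∀ x, HasDerivAt g (g' x) x) (c : Continuous g')
    (a b : ℝ) : g b - g a = (∫ θ in (0 : ℝ)..1, g' (a + θ * (b - a))) * (b - a) := by
  have h : ∀ θ : ℝ, HasDerivAt (fun θ => g (a + θ * (b - a))) (g' (a + θ * (b - a)) * (b - a)) θ := by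
    intro θ
    have : HasDerivAt (fun θ : ℝ => a + θ * (b - a)) (b - a) θ := by
      simpa using ((hasDerivAt_id θ).mul_const (b - a)).const_add a
    exact (hg _).comp θ this
  have := intervalIntegral.integral_eq_sub_of_hasDerivAt (a := 0) (b := 1) (fun θ _ => h θ)
    (by apply Continuous.intervalIntegrable; fun_prop)
  rw [intervalIntegral.integral_mul_const] at this
  rw [this]
  simp

/-- A product of a continuous factor and a factor vanishing at the point is differentiable. -/
theorem hasDerivAt_mul_of_eq_zero {a b : ℝ → ℝ} {b' s : ℝ} (ha : ContinuousAt a s)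
    (hb : HasDerivAt b b' s) (h0 : b s = 0) : HasDerivAt (fun r => a r * b r) (a s * b') s := by
  rw [hasDerivAt_iff_tendsto_slope] at hb ⊢
  have := (ha.tendsto.mono_left nhdsWithin_le_nhds).mul hb
  refine this.congr' (Eventually.of_forall fun r => ?_)
  simp only [slope_def_field, h0]
  ring

end Calculus

/-! ### Integration along characteristic lines of the wave operator -/

section LineIntegral

/-- The integral of `g` along the line `s ↦ (s, x + σ (t - s))`. -/
noncomputable def lineIntegral (σ : ℝ) (g : ℝ → ℝ → ℝ) (t x : ℝ) : ℝ :=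
  ∫ s in (0 : ℝ)..t, g s (x + σ * (t - s))

variable {σ : ℝ} {g g' : ℝ → ℝ → ℝ}

theorem continuous_lineIntegral (σ : ℝ) (c : Continuous fun p : ℝ × ℝ => g p.1 p.2) :
    Continuous fun p : ℝ × ℝ => lineIntegral σ g p.1 p.2 := by
  unfold lineIntegral
  refine intervalIntegral.continuous_parametric_intervalIntegral_of_continuous
    (f := fun (p : ℝ × ℝ) s => g s (p.2 + σ * (p.1 - s))) ?_ continuous_fst
  have : Continuous fun q : (ℝ × ℝ) × ℝ => (q.2, q.1.2 + σ * (q.1.1 - q.2)) := by fun_prop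
  exact c.comp this

theorem hasDerivAt_lineIntegral_right (σ : ℝ) (c : Continuous fun p : ℝ × ℝ => g p.1 p.2)
    (c' : Continuous fun p : ℝ × ℝ => g' p.1 p.2) (h : ∀ t x, HasDerivAt (g t) (g' t x) x)
    (t x : ℝ) : HasDerivAt (lineIntegral σ g t) (lineIntegral σ g' t x) x := by
  unfold lineIntegral
  refine hasDerivAt_intervalIntegral (F := fun x s => g s (x + σ * (t - s)))
    (F' := fun x s => g' s (x + σ * (t - s))) 0 t ?_ ?_ ?_ x
  · intro p v
    simpa using (h v (p + σ * (t - v))).comp_add_const p (σ * (t - v))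
  · intro p
    have : Continuous fun s : ℝ => (s, p + σ * (t - s)) := by fun_prop
    exact c.comp this
  · have : Continuous fun q : ℝ × ℝ => (q.2, q.1 + σ * (t - q.2)) := by fun_prop
    exact c'.comp this

theorem hasDerivAt_lineIntegral_left (σ : ℝ) (c : Continuous fun p : ℝ × ℝ => g p.1 p.2)
    (c' : Continuous fun p : ℝ × ℝ => g' p.1 p.2) (h : ∀ t x, HasDerivAt (g t) (g' t x) x)
    (t x : ℝ) :
    HasDerivAt (fun s => lineIntegral σ g s x) (σ * lineIntegral σ g' t x + g t x) t := by
  -- In terms of the label `y = x + σt` of the ray, `t` occurs in the integral only as the upper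
  -- limit; the other dependence on `t` goes through `y` and the chain rule.
  set G : ℝ → ℝ → ℝ := fun t y => ∫ s in (0 : ℝ)..t, g s (y - σ * s)
  set G' : ℝ → ℝ → ℝ := fun t y => ∫ s in (0 : ℝ)..t, g' s (y - σ * s)
  have h1 : ∀ t y, HasDerivAt (fun s => G s y) (g t (y - σ * t)) t := fun t y => by
    have : Continuous fun s : ℝ => g s (y - σ * s) :=
      c.comp (show Continuous fun s : ℝ => (s, y - σ * s) by fun_prop)
    exact intervalIntegral.integral_hasDerivAt_right (this.intervalIntegrable _ _)
      (this.stronglyMeasurableAtFilter _ _) this.continuousAt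
  have h2 : ∀ t y, HasDerivAt (G t) (G' t y) y := fun t y => by
    refine hasDerivAt_intervalIntegral (F := fun x s => g s (x - σ * s))
      (F' := fun x s => g' s (x - σ * s)) 0 t ?_ ?_ ?_ y
    · intro p v
      simpa using (h v (p - σ * v)).comp_sub_const p (σ * v)
    · exact fun p => c.comp (show Continuous fun s : ℝ => (s, p - σ * s) by fun_prop)
    · exact c'.comp (show Continuous fun q : ℝ × ℝ => (q.2, q.1 - σ * q.2) by fun_prop)
  have c1 : Continuous fun p : ℝ × ℝ => g p.1 (p.2 - σ * p.1) :=
    c.comp (show Continuous fun q : ℝ × ℝ => (q.1, q.2 - σ * q.1) by fun_prop)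
  have c2 : Continuous fun p : ℝ × ℝ => G' p.1 p.2 :=
    intervalIntegral.continuous_parametric_intervalIntegral_of_continuous
      (f := fun (p : ℝ × ℝ) s => g' s (p.2 - σ * s))
      (c'.comp (show Continuous fun q : (ℝ × ℝ) × ℝ => (q.2, q.1.2 - σ * q.2) by fun_prop))
      continuous_fst
  have hb : HasDerivAt (fun s : ℝ => x + σ * s) σ t := by
    simpa using ((hasDerivAt_id t).const_mul σ).const_add x
  have := hasDerivAt_comp_of_partial h1 h2 c1 c2 (hasDerivAt_id t) hb
  have e : (fun s => lineIntegral σ g s x) = fun s => G (id s) (x + σ * s) := by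
    funext s
    simp only [lineIntegral, G, id]
    congr 1; funext r; ring_nf
  rw [e]
  convert this using 1
  simp only [lineIntegral, G', id]
  rw [add_comm, one_mul]
  congr 1
  · ring_nf
  · congr 2; funext r; ring_nf

end LineIntegral

/-! ### The relativistic velocity -/

section RelVelocity

theorem sqrt_one_add_sq_pos (v : ℝ) : 0 < Real.sqrt (1 + v ^ 2) := Real.sqrt_pos.2 (by positivity)

theorem abs_lt_sqrt_one_add_sq (v : ℝ) : |v| < Real.sqrt (1 + v ^ 2) := by
  rw [← Real.sqrt_sq_eq_abs]
  exact Real.sqrt_lt_sqrt (sq_nonneg v) (by linarith)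

theorem abs_relVelocity_lt_one (v : ℝ) : |relVelocity v| < 1 := by
  rw [relVelocity, abs_div, abs_of_pos (sqrt_one_add_sq_pos v), div_lt_one (sqrt_one_add_sq_pos v)]
  exact abs_lt_sqrt_one_add_sq v

/-- The derivative of the relativistic velocity. -/
noncomputable def relVelocityDeriv (v : ℝ) : ℝ := 1 / (Real.sqrt (1 + v ^ 2)) ^ 3

theorem hasDerivAt_relVelocity (v : ℝ) : HasDerivAt relVelocity (relVelocityDeriv v) v := by
  have hp := sqrt_one_add_sq_pos v
  have h0 : HasDerivAt (fun v : ℝ => 1 + v ^ 2) (2 * v) v := by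
    simpa using (hasDerivAt_pow 2 v).const_add 1
  have h1 := h0.sqrt (by positivity)
  have h2 := (hasDerivAt_id v).div h1 hp.ne'
  refine (h2.congr_deriv ?_)
  have hs : Real.sqrt (1 + v ^ 2) ^ 2 = 1 + v ^ 2 := Real.sq_sqrt (by positivity)
  simp only [relVelocityDeriv, id]
  field_simp
  rw [hs]; ring

theorem continuous_relVelocityDeriv : Continuous relVelocityDeriv := by
  unfold relVelocityDeriv
  refine continuous_const.div (by fun_prop) fun v => ?_
  exact pow_ne_zero _ (sqrt_one_add_sq_pos v).ne'

theorem continuous_relVelocity : Continuous relVelocity :=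
  continuous_iff_continuousAt.2 fun v => (hasDerivAt_relVelocity v).continuousAt

theorem abs_relVelocityDeriv_le_one (v : ℝ) : |relVelocityDeriv v| ≤ 1 := by
  have h1 : 1 ≤ Real.sqrt (1 + v ^ 2) := Real.one_le_sqrt.2 (by nlinarith [sq_nonneg v])
  rw [relVelocityDeriv, abs_of_nonneg (by positivity)]
  exact (div_le_one (by positivity)).2 (one_le_pow₀ h1)

theorem abs_relVelocity_sub_le (v w : ℝ) : |relVelocity v - relVelocity w| ≤ |v - w| := by
  have := Convex.norm_image_sub_le_of_norm_hasDerivWithin_le (f := relVelocity)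
    (f' := relVelocityDeriv) (C := 1) (s := univ) (x := w) (y := v)
    (fun x _ => (hasDerivAt_relVelocity x).hasDerivWithinAt)
    (fun x _ => abs_relVelocityDeriv_le_one x) convex_univ (mem_univ _) (mem_univ _)
  simpa using this

theorem add_relVelocity_ne_zero {σ : ℝ} (hσ : |σ| = 1) (v : ℝ) : σ + relVelocity v ≠ 0 := by
  intro h
  have := abs_relVelocity_lt_one v
  rw [show relVelocity v = -σ by linarith, abs_neg, hσ] at this
  exact lt_irrefl _ this

end RelVelocity

/-! ### Characteristics of the Vlasov equation -/

section Flow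

open Filter Topology

/-- A continuous force field that is Lipschitz in space, locally uniformly in time. -/
structure IsLipField (E : ℝ → ℝ → ℝ) : Prop where
  cont : Continuous fun p : ℝ × ℝ => E p.1 p.2
  lip : ∀ T, ∃ L, 0 ≤ L ∧ ∀ t ∈ Icc (-T) T, ∀ x y, |E t x - E t y| ≤ L * |x - y|

/-- The vector field in phase space whose integral curves are the characteristics. -/
noncomputable def charField (E : ℝ → ℝ → ℝ) (t : ℝ) (z : ℝ × ℝ) : ℝ × ℝ :=
  (relVelocity z.2, -E t z.1)

variable {E : ℝ → ℝ → ℝ}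

theorem norm_charField_sub_le {L : ℝ} (hL : 0 ≤ L) {t : ℝ}
    {y z : ℝ × ℝ} (h : |E t y.1 - E t z.1| ≤ L * |y.1 - z.1|) :
    ‖charField E t y - charField E t z‖ ≤ (1 + L) * ‖y - z‖ := by
  have h1 : |y.1 - z.1| ≤ ‖y - z‖ := norm_fst_le (y - z)
  have h2 : |y.2 - z.2| ≤ ‖y - z‖ := norm_snd_le (y - z)
  have h3 := abs_relVelocity_sub_le y.2 z.2
  have h0 := norm_nonneg (y - z)
  simp only [charField, Prod.norm_def, Prod.fst_sub, Prod.snd_sub, Real.norm_eq_abs] at h0 h1 h2 ⊢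
  refine max_le ?_ ?_
  · nlinarith
  · rw [neg_sub_neg, abs_sub_comm]; nlinarith

theorem IsLipField.continuous_charField (hE : IsLipField E) :
    Continuous fun p : ℝ × ℝ × ℝ => charField E p.1 p.2 := by
  unfold charField
  exact (continuous_relVelocity.comp (continuous_snd.comp continuous_snd)).prodMk
    (hE.cont.comp (continuous_fst.prodMk (continuous_fst.comp continuous_snd))).neg

theorem IsLipField.charField_lip (hE : IsLipField E) (T : ℝ) :
    ∃ K, 0 ≤ K ∧ ∀ t ∈ Icc (-T) T, ∀ y z, ‖charField E t y - charField E t z‖ ≤ K * ‖y - z‖ := by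
  obtain ⟨L, hL, h⟩ := hE.lip T
  exact ⟨1 + L, by positivity, fun t ht y z => norm_charField_sub_le hL (h t ht _ _)⟩

theorem IsLipField.exists_char (hE : IsLipField E) (t : ℝ) (z : ℝ × ℝ) :
    ∃ γ : ℝ → ℝ × ℝ, γ t = z ∧ ∀ s, HasDerivAt γ (charField E s (γ s)) s :=
  exists_global_solution
    (fun _ => hE.continuous_charField.comp (continuous_id.prodMk continuous_const))
    hE.charField_lip t z

open Classical in
/-- The characteristic that passes through `z` at time `t`. -/
noncomputable def charFlow (E : ℝ → ℝ → ℝ) (t : ℝ) (z : ℝ × ℝ) : ℝ → ℝ × ℝ :=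
  if h : ∃ γ : ℝ → ℝ × ℝ, γ t = z ∧ ∀ s, HasDerivAt γ (charField E s (γ s)) s then h.choose
  else fun _ => z

theorem IsLipField.charFlow_self (hE : IsLipField E) (t : ℝ) (z : ℝ × ℝ) : charFlow E t z t = z := by
  rw [charFlow, dif_pos (hE.exists_char t z)]
  exact (hE.exists_char t z).choose_spec.1

theorem IsLipField.hasDerivAt_charFlow (hE : IsLipField E) (t : ℝ) (z : ℝ × ℝ) (s : ℝ) :
    HasDerivAt (charFlow E t z) (charField E s (charFlow E t z s)) s := by
  rw [charFlow, dif_pos (hE.exists_char t z)]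
  exact (hE.exists_char t z).choose_spec.2 s

theorem solution_unique_univ {F : ℝ → ℝ × ℝ → ℝ × ℝ}
    (hF : ∀ T, ∃ K, 0 ≤ K ∧ ∀ t ∈ Icc (-T) T, ∀ y z, ‖F t y - F t z‖ ≤ K * ‖y - z‖)
    {γ η : ℝ → ℝ × ℝ} (hγ : ∀ t, HasDerivAt γ (F t (γ t)) t)
    (hη : ∀ t, HasDerivAt η (F t (η t)) t) {t₀ : ℝ} (h : γ t₀ = η t₀) : γ = η := by
  funext s
  obtain ⟨K, hK, h'⟩ := hF (max |t₀| |s|)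
  exact solution_unique hK h' (fun t _ => hγ t) (fun t _ => hη t)
    (abs_le.1 (le_max_left _ _)) h (abs_le.1 (le_max_right _ _))

theorem IsLipField.charFlow_comp (hE : IsLipField E) (t s : ℝ) (z : ℝ × ℝ) :
    charFlow E s (charFlow E t z s) = charFlow E t z :=
  solution_unique_univ hE.charField_lip (hE.hasDerivAt_charFlow _ _) (hE.hasDerivAt_charFlow _ _)
    (hE.charFlow_self _ _)

theorem IsLipField.continuous_charFlow (hE : IsLipField E) :
    Continuous fun p : (ℝ × (ℝ × ℝ)) × ℝ => charFlow E p.1.1 p.1.2 p.2 := by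
  refine continuous_solution (Λ := ℝ × (ℝ × ℝ)) (F := fun _ => charField E)
    (Y := fun l => charFlow E l.1 l.2) (τ := Prod.fst)
    (hE.continuous_charField.comp continuous_snd) ?_ ?_ continuous_fst ?_
  · intro _ T
    obtain ⟨K, hK, h⟩ := hE.charField_lip T
    exact ⟨K, hK, Eventually.of_forall fun _ => h⟩
  · exact fun l s => hE.hasDerivAt_charFlow _ _ s
  · simp only [hE.charFlow_self]
    exact continuous_snd

/-- Transport of the initial density along the characteristics. -/
noncomputable def transport (f₀ : ℝ × ℝ → ℝ) (E : ℝ → ℝ → ℝ) (t x v : ℝ) : ℝ :=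
  f₀ (charFlow E t (x, v) 0)

theorem IsLipField.continuous_transport (hE : IsLipField E) {f₀ : ℝ × ℝ → ℝ} (hf : Continuous f₀) :
    Continuous fun p : ℝ × ℝ × ℝ => transport f₀ E p.1 p.2.1 p.2.2 :=
  hf.comp (hE.continuous_charFlow.comp (continuous_id.prodMk continuous_const))

theorem abs_deriv_le_of_lip {g : ℝ → ℝ} {g' L x : ℝ} (h : HasDerivAt g g' x)
    (hL : 0 ≤ L) (hg : ∀ y, |g y - g x| ≤ L * |y - x|) : |g'| ≤ L := by
  have := h.hasFDerivAt.le_of_lip' hL (Eventually.of_forall fun y => hg y)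
  simpa using this

/-- The mean of `g' s` over the segment from `a` to `b`. -/
noncomputable def meanSlope (g' : ℝ → ℝ → ℝ) (s a b : ℝ) : ℝ :=
  ∫ θ in (0 : ℝ)..1, g' s (a + θ * (b - a))

theorem continuous_meanSlope {g' : ℝ → ℝ → ℝ} (c : Continuous fun p : ℝ × ℝ => g' p.1 p.2) :
    Continuous fun p : ℝ × ℝ × ℝ => meanSlope g' p.1 p.2.1 p.2.2 :=
  intervalIntegral.continuous_parametric_intervalIntegral_of_continuous'
    (f := fun (p : ℝ × ℝ × ℝ) θ => g' p.1 (p.2.1 + θ * (p.2.2 - p.2.1)))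
    (c.comp (show Continuous fun q : (ℝ × ℝ × ℝ) × ℝ =>
      (q.1.1, q.1.2.1 + q.2 * (q.1.2.2 - q.1.2.1)) by fun_prop)) 0 1

theorem abs_meanSlope_le {g' : ℝ → ℝ → ℝ} {s L : ℝ} (h : ∀ x, |g' s x| ≤ L) (a b : ℝ) :
    |meanSlope g' s a b| ≤ L := by
  have := intervalIntegral.norm_integral_le_of_norm_le_const (a := 0) (b := 1)
    (f := fun θ => g' s (a + θ * (b - a))) (C := L) (fun θ _ => h _)
  simpa [meanSlope] using this

variable {E' : ℝ → ℝ → ℝ}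

/-- The linear system satisfied by the difference of two characteristics, which pass at time `l.1`
through `l.2.1` and `l.2.2`. -/
noncomputable def diffField (E E' : ℝ → ℝ → ℝ) (l : ℝ × (ℝ × ℝ) × (ℝ × ℝ)) (s : ℝ) (y : ℝ × ℝ) :
    ℝ × ℝ :=
  (meanSlope (fun _ => relVelocityDeriv) s (charFlow E l.1 l.2.1 s).2
      (charFlow E l.1 l.2.2 s).2 * y.2,
    -(meanSlope E' s (charFlow E l.1 l.2.1 s).1 (charFlow E l.1 l.2.2 s).1 * y.1))

theorem IsLipField.continuous_diffField (hE : IsLipField E)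
    (cE' : Continuous fun p : ℝ × ℝ => E' p.1 p.2) :
    Continuous fun p : (ℝ × (ℝ × ℝ) × (ℝ × ℝ)) × ℝ × (ℝ × ℝ) => diffField E E' p.1 p.2.1 p.2.2 := by
  have hz : Continuous fun p : (ℝ × (ℝ × ℝ) × (ℝ × ℝ)) × ℝ × (ℝ × ℝ) =>
      charFlow E p.1.1 p.1.2.1 p.2.1 := hE.continuous_charFlow.comp
    (show Continuous fun p : (ℝ × (ℝ × ℝ) × (ℝ × ℝ)) × ℝ × (ℝ × ℝ) =>
      ((p.1.1, p.1.2.1), p.2.1) by fun_prop)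
  have hz' : Continuous fun p : (ℝ × (ℝ × ℝ) × (ℝ × ℝ)) × ℝ × (ℝ × ℝ) =>
      charFlow E p.1.1 p.1.2.2 p.2.1 := hE.continuous_charFlow.comp
    (show Continuous fun p : (ℝ × (ℝ × ℝ) × (ℝ × ℝ)) × ℝ × (ℝ × ℝ) =>
      ((p.1.1, p.1.2.2), p.2.1) by fun_prop)
  have h1 := (continuous_meanSlope (g' := fun _ => relVelocityDeriv)
    (continuous_relVelocityDeriv.comp continuous_snd)).comp
      ((continuous_fst.comp continuous_snd).prodMk (hz.snd.prodMk hz'.snd))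
  have h2 := (continuous_meanSlope cE').comp
    ((continuous_fst.comp continuous_snd).prodMk (hz.fst.prodMk hz'.fst))
  exact (h1.mul (by fun_prop)).prodMk (h2.mul (by fun_prop)).neg

theorem IsLipField.diffField_lip (hE : IsLipField E)
    (hE' : ∀ t x, HasDerivAt (E t) (E' t x) x) (T : ℝ) :
    ∃ K, 0 ≤ K ∧ ∀ l, ∀ t ∈ Icc (-T) T, ∀ y z,
      ‖diffField E E' l t y - diffField E E' l t z‖ ≤ K * ‖y - z‖ := by
  obtain ⟨L, hL, h⟩ := hE.lip T
  refine ⟨1 + L, by positivity, fun l t ht y z => ?_⟩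
  have h1 : |y.1 - z.1| ≤ ‖y - z‖ := norm_fst_le (y - z)
  have h2 : |y.2 - z.2| ≤ ‖y - z‖ := norm_snd_le (y - z)
  have h0 := norm_nonneg (y - z)
  have b1 := abs_meanSlope_le (g' := fun _ => relVelocityDeriv) (s := t)
    abs_relVelocityDeriv_le_one (charFlow E l.1 l.2.1 t).2 (charFlow E l.1 l.2.2 t).2
  have b2 := abs_meanSlope_le (g' := E') (s := t)
    (fun x => abs_deriv_le_of_lip (hE' t x) hL fun y => h t ht y x)
    (charFlow E l.1 l.2.1 t).1 (charFlow E l.1 l.2.2 t).1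
  have key : ∀ m₁ m₂ : ℝ, |m₁| ≤ 1 → |m₂| ≤ L →
      ‖((m₁ * y.2, -(m₂ * y.1)) : ℝ × ℝ) - (m₁ * z.2, -(m₂ * z.1))‖ ≤ (1 + L) * ‖y - z‖ := by
    intro m₁ m₂ hm₁ hm₂
    rw [Prod.mk_sub_mk, norm_prod_le_iff, neg_sub_neg, ← mul_sub, ← mul_sub, Real.norm_eq_abs,
      Real.norm_eq_abs, abs_mul, abs_mul, abs_sub_comm z.1]
    have := mul_le_mul hm₁ h2 (abs_nonneg _) zero_le_one
    have := mul_le_mul hm₂ h1 (abs_nonneg _) hL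
    have := mul_nonneg hL h0
    constructor <;> linarith
  exact key _ _ b1 b2

/-- The system is linear, with coefficients bounded uniformly in `l` on compact time intervals and
jointly continuous. Hence its solutions are global and continuous in all parameters, also on the
diagonal `z = w`, where they become the columns of the derivative of the flow. -/
theorem IsLipField.exists_diffField_solution (hE : IsLipField E)
    (hE' : ∀ t x, HasDerivAt (E t) (E' t x) x) (cE' : Continuous fun p : ℝ × ℝ => E' p.1 p.2)
    (e : ℝ × ℝ) :
    ∃ Y : (ℝ × (ℝ × ℝ) × (ℝ × ℝ)) → ℝ → ℝ × ℝ, (∀ l, Y l l.1 = e) ∧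
      (Continuous fun p : (ℝ × (ℝ × ℝ) × (ℝ × ℝ)) × ℝ => Y p.1 p.2) ∧
      ∀ l s, HasDerivAt (Y l) (diffField E E' l s (Y l s)) s := by
  have hc := hE.continuous_diffField cE'
  have hex : ∀ l : ℝ × (ℝ × ℝ) × (ℝ × ℝ), ∃ γ : ℝ → ℝ × ℝ, γ l.1 = e ∧
      ∀ s, HasDerivAt γ (diffField E E' l s (γ s)) s := by
    intro l
    refine exists_global_solution (F := diffField E E' l) (fun z => ?_) (fun T => ?_) l.1 e
    · have hz : Continuous fun t : ℝ => (l, t, z) := by fun_prop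
      have := hc.comp hz
      simp only [Function.comp_def] at this
      exact this
    · obtain ⟨K, hK, h⟩ := hE.diffField_lip hE' T
      exact ⟨K, hK, h l⟩
  choose Y h0 hY using hex
  refine ⟨Y, h0, continuous_solution (F := diffField E E') hc (fun l T => ?_) hY continuous_fst ?_, hY⟩
  · obtain ⟨K, hK, h⟩ := hE.diffField_lip hE' T
    exact ⟨K, hK, Eventually.of_forall h⟩
  · simp only [h0]
    exact continuous_const

/-- Hadamard's lemma for the characteristic flow. -/
theorem IsLipField.exists_charFlow_sub_eq (hE : IsLipField E)
    (hE' : ∀ t x, HasDerivAt (E t) (E' t x) x) (cE' : Continuous fun p : ℝ × ℝ => E' p.1 p.2) :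
    ∃ A B : ℝ × (ℝ × ℝ) × (ℝ × ℝ) → ℝ × ℝ, Continuous A ∧ Continuous B ∧ ∀ t z w,
      charFlow E t w 0 - charFlow E t z 0 = (w.1 - z.1) • A (t, z, w) + (w.2 - z.2) • B (t, z, w) := by
  obtain ⟨Y₁, h₁, c₁, d₁⟩ := hE.exists_diffField_solution hE' cE' (1, 0)
  obtain ⟨Y₂, h₂, c₂, d₂⟩ := hE.exists_diffField_solution hE' cE' (0, 1)
  refine ⟨fun l => Y₁ l 0, fun l => Y₂ l 0, c₁.comp (continuous_id.prodMk continuous_const),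
    c₂.comp (continuous_id.prodMk continuous_const), fun t z w => ?_⟩
  -- Both sides solve the linear system of `diffField` and equal `w - z` at time `t`.
  have key : (fun s => charFlow E t w s - charFlow E t z s) =
      fun s => (w.1 - z.1) • Y₁ (t, z, w) s + (w.2 - z.2) • Y₂ (t, z, w) s := by
    refine solution_unique_univ (F := diffField E E' (t, z, w)) (t₀ := t) (fun T => ?_)
      (fun s => ?_) (fun s => ?_) ?_
    · obtain ⟨K, hK, h⟩ := hE.diffField_lip hE' T
      exact ⟨K, hK, h _⟩
    · refine ((hE.hasDerivAt_charFlow t w s).sub (hE.hasDerivAt_charFlow t z s)).congr_deriv ?_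
      refine Prod.ext ?_ ?_
      · exact sub_eq_integral_mul hasDerivAt_relVelocity continuous_relVelocityDeriv _ _
      · simp only [charField, diffField, Prod.snd_sub, Prod.fst_sub, neg_sub_neg]
        rw [← neg_sub, sub_eq_integral_mul (hE' s) (cE'.comp (continuous_const.prodMk continuous_id))]
        rfl
    · refine (((d₁ _ s).const_smul (w.1 - z.1)).add ((d₂ _ s).const_smul (w.2 - z.2))).congr_deriv ?_
      simp only [diffField, Prod.smul_mk, Prod.mk_add_mk, smul_eq_mul, Prod.fst_add, Prod.snd_add,
        Prod.smul_fst, Prod.smul_snd]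
      refine Prod.ext ?_ ?_ <;> simp only <;> ring
    · have e₁ := h₁ (t, z, w)
      have e₂ := h₂ (t, z, w)
      simp only at e₁ e₂
      simp only [hE.charFlow_self, e₁, e₂]
      ext <;> simp
  exact congrFun key 0

/-- Hadamard's lemma in the plane: the coefficients are the means of the two partial derivatives
over the segment from `a` to `b`. -/
theorem exists_sub_eq_of_contDiff {f₀ : ℝ × ℝ → ℝ} (hf : ContDiff ℝ 1 f₀) :
    ∃ p q : (ℝ × ℝ) × (ℝ × ℝ) → ℝ, Continuous p ∧ Continuous q ∧ ∀ a b,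
      f₀ b - f₀ a = p (a, b) * (b - a).1 + q (a, b) * (b - a).2 := by
  have hc : Continuous (fderiv ℝ f₀) := hf.continuous_fderiv one_ne_zero
  have hcont : ∀ e : ℝ × ℝ, Continuous fun l : (ℝ × ℝ) × (ℝ × ℝ) =>
      ∫ θ in (0 : ℝ)..1, fderiv ℝ f₀ (l.1 + θ • (l.2 - l.1)) e := fun e =>
    intervalIntegral.continuous_parametric_intervalIntegral_of_continuous'
      (f := fun (l : (ℝ × ℝ) × (ℝ × ℝ)) (θ : ℝ) => fderiv ℝ f₀ (l.1 + θ • (l.2 - l.1)) e)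
      ((hc.comp (show Continuous fun q : ((ℝ × ℝ) × (ℝ × ℝ)) × ℝ =>
        q.1.1 + q.2 • (q.1.2 - q.1.1) by fun_prop)).clm_apply continuous_const) 0 1
  refine ⟨_, _, hcont (1, 0), hcont (0, 1), fun a b => ?_⟩
  have h : ∀ θ : ℝ, HasDerivAt (fun θ : ℝ => f₀ (a + θ • (b - a)))
      (fderiv ℝ f₀ (a + θ • (b - a)) (b - a)) θ := by
    intro θ
    have h1 : HasDerivAt (fun θ : ℝ => a + θ • (b - a)) (b - a) θ := by
      simpa using ((hasDerivAt_id θ).smul_const (b - a)).const_add a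
    exact ((hf.differentiable one_ne_zero _).hasFDerivAt).comp_hasDerivAt θ h1
  have cont : ∀ e : ℝ × ℝ, Continuous fun θ : ℝ => fderiv ℝ f₀ (a + θ • (b - a)) e := fun e =>
    (hc.comp (by fun_prop)).clm_apply continuous_const
  have := intervalIntegral.integral_eq_sub_of_hasDerivAt (a := 0) (b := 1) (fun θ _ => h θ)
    ((cont _).intervalIntegrable _ _)
  simp only [one_smul, zero_smul, add_sub_cancel, add_zero] at this
  rw [← this, ← intervalIntegral.integral_mul_const, ← intervalIntegral.integral_mul_const,
    ← intervalIntegral.integral_add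
      (f := fun θ : ℝ => fderiv ℝ f₀ (a + θ • (b - a)) (1, 0) * (b - a).1)
      (g := fun θ : ℝ => fderiv ℝ f₀ (a + θ • (b - a)) (0, 1) * (b - a).2)
      (((cont _).mul continuous_const).intervalIntegrable _ _)
      (((cont _).mul continuous_const).intervalIntegrable _ _)]
  congr 1
  funext θ
  have e : b - a = (b - a).1 • ((1, 0) : ℝ × ℝ) + (b - a).2 • ((0, 1) : ℝ × ℝ) := by
    ext <;> simp
  have := congrArg (fderiv ℝ f₀ (a + θ • (b - a))) e
  rw [map_add, map_smul, map_smul, smul_eq_mul, smul_eq_mul] at this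
  rw [this, mul_comm, mul_comm (b - a).2]

/-- Hadamard's lemma for `f₀` composed with that for the flow. Continuity of `A` and `B` across `z =
w` encodes that the transported density is `C¹` in phase space. -/
theorem IsLipField.exists_transport_sub_eq (hE : IsLipField E)
    (hE' : ∀ t x, HasDerivAt (E t) (E' t x) x) (cE' : Continuous fun p : ℝ × ℝ => E' p.1 p.2)
    {f₀ : ℝ × ℝ → ℝ} (hf : ContDiff ℝ 1 f₀) :
    ∃ A B : ℝ × (ℝ × ℝ) × (ℝ × ℝ) → ℝ, Continuous A ∧ Continuous B ∧ ∀ t z w,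
      transport f₀ E t w.1 w.2 - transport f₀ E t z.1 z.2
        = A (t, z, w) * (w.1 - z.1) + B (t, z, w) * (w.2 - z.2) := by
  obtain ⟨A, B, cA, cB, h⟩ := hE.exists_charFlow_sub_eq hE' cE'
  obtain ⟨p, q, cp, cq, hpq⟩ := exists_sub_eq_of_contDiff hf
  have cz : Continuous fun l : ℝ × (ℝ × ℝ) × (ℝ × ℝ) =>
      (charFlow E l.1 l.2.1 0, charFlow E l.1 l.2.2 0) :=
    (hE.continuous_charFlow.comp (show Continuous fun l : ℝ × (ℝ × ℝ) × (ℝ × ℝ) =>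
      ((l.1, l.2.1), (0 : ℝ)) by fun_prop)).prodMk
    (hE.continuous_charFlow.comp (show Continuous fun l : ℝ × (ℝ × ℝ) × (ℝ × ℝ) =>
      ((l.1, l.2.2), (0 : ℝ)) by fun_prop))
  refine ⟨fun l => p (charFlow E l.1 l.2.1 0, charFlow E l.1 l.2.2 0) * (A l).1 +
      q (charFlow E l.1 l.2.1 0, charFlow E l.1 l.2.2 0) * (A l).2,
    fun l => p (charFlow E l.1 l.2.1 0, charFlow E l.1 l.2.2 0) * (B l).1 +
      q (charFlow E l.1 l.2.1 0, charFlow E l.1 l.2.2 0) * (B l).2, ?_, ?_, fun t z w => ?_⟩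
  · exact ((cp.comp cz).mul cA.fst).add ((cq.comp cz).mul cA.snd)
  · exact ((cp.comp cz).mul cB.fst).add ((cq.comp cz).mul cB.snd)
  · simp only [transport]
    rw [hpq, h]
    simp only [Prod.fst_add, Prod.snd_add, Prod.smul_fst, Prod.smul_snd, smul_eq_mul]
    ring

/-- The transported density of a `C¹` datum under a field that is `C¹` in space is `C¹` and
satisfies the Vlasov equation. -/
theorem IsLipField.exists_transport_deriv (hE : IsLipField E)
    (hE' : ∀ t x, HasDerivAt (E t) (E' t x) x) (cE' : Continuous fun p : ℝ × ℝ => E' p.1 p.2)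
    {f₀ : ℝ × ℝ → ℝ} (hf : ContDiff ℝ 1 f₀) :
    ∃ fx fv : ℝ → ℝ → ℝ → ℝ, (Continuous fun p : ℝ × ℝ × ℝ => fx p.1 p.2.1 p.2.2) ∧
      (Continuous fun p : ℝ × ℝ × ℝ => fv p.1 p.2.1 p.2.2) ∧
      (∀ t x v, HasDerivAt (fun y => transport f₀ E t y v) (fx t x v) x) ∧
      (∀ t x v, HasDerivAt (transport f₀ E t x) (fv t x v) v) ∧
      (∀ t x v, HasDerivAt (fun s => transport f₀ E s x v)
        (-relVelocity v * fx t x v + E t x * fv t x v) t) ∧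
      ContDiff ℝ 1 fun p : ℝ × ℝ × ℝ => transport f₀ E p.1 p.2.1 p.2.2 := by
  obtain ⟨A, B, cA, cB, h⟩ := hE.exists_transport_sub_eq hE' cE' hf
  have hdiag : Continuous fun p : ℝ × ℝ × ℝ => (p.1, p.2, p.2) := by fun_prop
  have ht : ∀ t x v, HasDerivAt (fun s => transport f₀ E s x v)
      (-relVelocity v * A (t, (x, v), (x, v)) + E t x * B (t, (x, v), (x, v))) t := by
    intro t x v
    set γ := charFlow E t (x, v) with hγ
    have hγt : γ t = (x, v) := hE.charFlow_self _ _
    have hγd := hE.hasDerivAt_charFlow t (x, v) t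
    rw [← hγ, hγt] at hγd
    have hγc : Continuous γ := continuous_iff_continuousAt.2 fun s =>
      (hE.hasDerivAt_charFlow t (x, v) s).continuousAt
    -- The density is constant along `γ`, so its change in time at the fixed point `(x, v)` equals
    -- its difference in phase space between `(x, v)` and `γ s`. Those increments vanish at `s = t`,
    -- so mere continuity of `A` and `B` suffices to differentiate.
    have hconst : ∀ s, transport f₀ E s (γ s).1 (γ s).2 = transport f₀ E t x v := by
      intro s
      simp only [transport, Prod.mk.eta]
      rw [hγ, hE.charFlow_comp]
    have e : (fun s => transport f₀ E s x v) = fun s => transport f₀ E t x v +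
        (A (s, γ s, (x, v)) * (x - (γ s).1) + B (s, γ s, (x, v)) * (v - (γ s).2)) := by
      funext s
      rw [← h s (γ s) (x, v), hconst]
      ring
    have hl : Continuous fun s => (s, γ s, ((x, v) : ℝ × ℝ)) := by fun_prop
    have d1 : HasDerivAt (fun s => (γ s).1) (relVelocity v) t :=
      (ContinuousLinearMap.fst ℝ ℝ ℝ).hasFDerivAt.comp_hasDerivAt t hγd
    have d2 : HasDerivAt (fun s => (γ s).2) (-E t x) t :=
      (ContinuousLinearMap.snd ℝ ℝ ℝ).hasFDerivAt.comp_hasDerivAt t hγd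
    have m1 := hasDerivAt_mul_of_eq_zero (cA.comp hl).continuousAt (d1.const_sub x) (by simp [hγt])
    have m2 := hasDerivAt_mul_of_eq_zero (cB.comp hl).continuousAt (d2.const_sub v) (by simp [hγt])
    rw [e]
    refine ((m1.add m2).const_add _).congr_deriv ?_
    simp only [Function.comp, hγt]
    ring
  have hx : ∀ t x v, HasDerivAt (fun y => transport f₀ E t y v) (A (t, (x, v), (x, v))) x := by
    intro t x v
    have hl : Continuous fun y => (t, (x, v), ((y, v) : ℝ × ℝ)) := by fun_prop
    have m := hasDerivAt_mul_of_eq_zero (cA.comp hl).continuousAt ((hasDerivAt_id x).sub_const x)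
      (by simp)
    have e : (fun y => transport f₀ E t y v) = fun y => transport f₀ E t x v +
        A (t, (x, v), (y, v)) * (y - x) := by
      funext y
      have := h t (x, v) (y, v)
      simp only [sub_self, mul_zero, add_zero] at this
      linarith
    rw [e]
    simpa using m.const_add (transport f₀ E t x v)
  have hv : ∀ t x v, HasDerivAt (transport f₀ E t x) (B (t, (x, v), (x, v))) v := by
    intro t x v
    have hl : Continuous fun y => (t, (x, v), ((x, y) : ℝ × ℝ)) := by fun_prop
    have m := hasDerivAt_mul_of_eq_zero (cB.comp hl).continuousAt ((hasDerivAt_id v).sub_const v)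
      (by simp)
    have e : transport f₀ E t x = fun y => transport f₀ E t x v +
        B (t, (x, v), (x, y)) * (y - v) := by
      funext y
      have := h t (x, v) (x, y)
      simp only [sub_self, mul_zero, zero_add] at this
      linarith
    rw [e]
    simpa using m.const_add (transport f₀ E t x v)
  have cA' : Continuous fun p : ℝ × ℝ × ℝ => A (p.1, p.2, p.2) := cA.comp hdiag
  have cB' : Continuous fun p : ℝ × ℝ × ℝ => B (p.1, p.2, p.2) := cB.comp hdiag
  refine ⟨fun t x v => A (t, (x, v), (x, v)), fun t x v => B (t, (x, v), (x, v)), cA', cB', hx, hv,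
    ht, ?_⟩
  have cf : ∀ t : ℝ, Continuous fun q : ℝ × ℝ => (t, q) := by fun_prop
  refine contDiff_one_of_partial (E := ℝ × ℝ) (f := fun t z => transport f₀ E t z.1 z.2)
    (f₁ := fun t z => -relVelocity z.2 * A (t, z, z) + E t z.1 * B (t, z, z))
    (f₂ := fun t z => A (t, z, z) • ContinuousLinearMap.fst ℝ ℝ ℝ +
      B (t, z, z) • ContinuousLinearMap.snd ℝ ℝ ℝ) (fun t z => ht t z.1 z.2) (fun t z => ?_) ?_ ?_
  · have := (contDiff_one_of_partial_deriv (f := fun x v => transport f₀ E t x v)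
      (f₁ := fun x v => A (t, (x, v), (x, v))) (f₂ := fun x v => B (t, (x, v), (x, v)))
      (hx t) (hv t) (cA'.comp (cf t)) (cB'.comp (cf t))).differentiable
        one_ne_zero z
    have hd := this.hasFDerivAt
    refine hd.congr_fderiv ?_
    have e1 : fderiv ℝ (fun p : ℝ × ℝ => transport f₀ E t p.1 p.2) z (1, 0) = A (t, z, z) := by
      have := hd.comp_hasDerivAt z.1 ((hasDerivAt_id z.1).prodMk (hasDerivAt_const z.1 z.2))
      exact this.unique (hx t z.1 z.2)
    have e2 : fderiv ℝ (fun p : ℝ × ℝ => transport f₀ E t p.1 p.2) z (0, 1) = B (t, z, z) := by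
      have := hd.comp_hasDerivAt z.2 ((hasDerivAt_const z.2 z.1).prodMk (hasDerivAt_id z.2))
      exact this.unique (hv t z.1 z.2)
    ext
    · simpa using e1
    · simpa using e2
  · exact ((continuous_relVelocity.comp (continuous_snd.comp continuous_snd)).neg.mul cA').add
      ((hE.cont.comp (show Continuous fun p : ℝ × ℝ × ℝ => (p.1, p.2.1) by fun_prop)).mul cB')
  · exact (cA'.smul continuous_const).add (cB'.smul continuous_const)

end Flow

/-! ### Velocity moments -/

section Moments

open Filter Topology

/-- The velocity support of `f` is bounded, locally uniformly in time. -/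
def HasBddVelocitySupport (f : ℝ → ℝ → ℝ → ℝ) : Prop :=
  ∀ T, ∃ Q, 0 ≤ Q ∧ ∀ t ∈ Icc (-T) T, ∀ x v, Q ≤ |v| → f t x v = 0

/-- The velocity moment of `f` with weight `a`. -/
noncomputable def moment (a : ℝ → ℝ) (f : ℝ → ℝ → ℝ → ℝ) (t x : ℝ) : ℝ := ∫ v, a v * f t x v

variable {f fx fv : ℝ → ℝ → ℝ → ℝ} {a b : ℝ → ℝ}

theorem support_subset_Ioc {h : ℝ → ℝ} {Q : ℝ} (hQ : ∀ v, Q ≤ |v| → h v = 0) :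
    Function.support h ⊆ Ioc (-Q) Q := by
  intro v hv
  have : |v| < Q := not_le.1 fun h' => hv (hQ v h')
  exact ⟨(abs_lt.1 this).1, (abs_lt.1 this).2.le⟩

theorem moment_eq_intervalIntegral {t x Q : ℝ} (hQ : ∀ v, Q ≤ |v| → f t x v = 0) :
    moment a f t x = ∫ v in (-Q)..Q, a v * f t x v :=
  (intervalIntegral.integral_eq_integral_of_support_subset
    (support_subset_Ioc fun v hv => by rw [hQ v hv, mul_zero])).symm

theorem HasBddVelocitySupport.continuous_moment (hs : HasBddVelocitySupport f)
    (cf : Continuous fun p : ℝ × ℝ × ℝ => f p.1 p.2.1 p.2.2) (ca : Continuous a) :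
    Continuous fun p : ℝ × ℝ => moment a f p.1 p.2 := by
  rw [continuous_iff_continuousAt]
  intro p
  -- The extra unit of time gives one velocity cutoff valid in a neighbourhood of `p`.
  obtain ⟨Q, hQ, h⟩ := hs (|p.1| + 1)
  have hc : Continuous fun q : ℝ × ℝ => ∫ v in (-Q)..Q, a v * f q.1 q.2 v :=
    intervalIntegral.continuous_parametric_intervalIntegral_of_continuous'
      (f := fun (q : ℝ × ℝ) v => a v * f q.1 q.2 v)
      ((ca.comp continuous_snd).mul (cf.comp (show Continuous fun q : (ℝ × ℝ) × ℝ =>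
        (q.1.1, q.1.2, q.2) by fun_prop))) _ _
  refine hc.continuousAt.congr ?_
  have : ∀ᶠ q : ℝ × ℝ in 𝓝 p, |q.1| < |p.1| + 1 :=
    (continuous_abs.comp continuous_fst).continuousAt.eventually_lt continuousAt_const
      (by simp)
  filter_upwards [this] with q hq
  exact (moment_eq_intervalIntegral (h q.1 (abs_le.1 hq.le) q.2)).symm

theorem HasBddVelocitySupport.deriv_right (hs : HasBddVelocitySupport f)
    (hx : ∀ t x v, HasDerivAt (fun y => f t y v) (fx t x v) x) : HasBddVelocitySupport fx := by
  intro T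
  obtain ⟨Q, hQ, h⟩ := hs T
  refine ⟨Q, hQ, fun t ht x v hv => (hx t x v).unique ?_⟩
  simp only [h t ht _ v hv]
  exact hasDerivAt_const _ _

theorem HasBddVelocitySupport.deriv_velocity (hs : HasBddVelocitySupport f)
    (hv : ∀ t x v, HasDerivAt (f t x) (fv t x v) v) : HasBddVelocitySupport fv := by
  intro T
  obtain ⟨Q, hQ, h⟩ := hs T
  -- The derivative at `v` vanishes once `f` vanishes near `v`, which is not clear at `|v| = Q`
  -- itself.
  refine ⟨Q + 1, by positivity, fun t ht x v hv' => (hv t x v).unique ?_⟩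
  refine (hasDerivAt_const v (0 : ℝ)).congr_of_eventuallyEq ?_
  have : ∀ᶠ w in 𝓝 v, Q < |w| := continuousAt_const.eventually_lt
    continuous_abs.continuousAt (by linarith)
  filter_upwards [this] with w hw
  exact h t ht x w hw.le

theorem HasBddVelocitySupport.hasDerivAt_moment_right (hs : HasBddVelocitySupport f)
    (cf : Continuous fun p : ℝ × ℝ × ℝ => f p.1 p.2.1 p.2.2)
    (cfx : Continuous fun p : ℝ × ℝ × ℝ => fx p.1 p.2.1 p.2.2) (ca : Continuous a)
    (hx : ∀ t x v, HasDerivAt (fun y => f t y v) (fx t x v) x) (t x : ℝ) :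
    HasDerivAt (moment a f t) (moment a fx t x) x := by
  obtain ⟨Q, hQ, h⟩ := hs |t|
  obtain ⟨Q', hQ', h'⟩ := hs.deriv_right hx |t|
  have e1 : moment a f t = fun x => ∫ v in (-max Q Q')..(max Q Q'), a v * f t x v := funext fun x =>
    moment_eq_intervalIntegral fun v hv => h t (abs_le.1 le_rfl) x v ((le_max_left _ _).trans hv)
  rw [e1, moment_eq_intervalIntegral fun v hv =>
    h' t (abs_le.1 le_rfl) x v ((le_max_right Q _).trans hv)]
  refine hasDerivAt_intervalIntegral (F := fun x v => a v * f t x v)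
    (F' := fun x v => a v * fx t x v) _ _ (fun x v => (hx t x v).const_mul _) (fun x => ?_) ?_ x
  · exact ca.mul (cf.comp (show Continuous fun v : ℝ => (t, x, v) by fun_prop))
  · exact (ca.comp continuous_snd).mul
      (cfx.comp (show Continuous fun q : ℝ × ℝ => (t, q.1, q.2) by fun_prop))

theorem HasBddVelocitySupport.hasDerivAt_moment_left {ft : ℝ → ℝ → ℝ → ℝ}
    (hs : HasBddVelocitySupport f) (hs' : HasBddVelocitySupport ft)
    (cf : Continuous fun p : ℝ × ℝ × ℝ => f p.1 p.2.1 p.2.2)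
    (cft : Continuous fun p : ℝ × ℝ × ℝ => ft p.1 p.2.1 p.2.2) (ca : Continuous a)
    (ht : ∀ t x v, HasDerivAt (fun s => f s x v) (ft t x v) t) (t x : ℝ) :
    HasDerivAt (fun s => moment a f s x) (moment a ft t x) t := by
  obtain ⟨Q, hQ, h⟩ := hs (|t| + 1)
  obtain ⟨Q', hQ', h'⟩ := hs' |t|
  have hev : (fun s => moment a f s x) =ᶠ[𝓝 t]
      fun s => ∫ v in (-max Q Q')..(max Q Q'), a v * f s x v := by
    have : ∀ᶠ s in 𝓝 t, |s| < |t| + 1 := continuous_abs.continuousAt.eventually_lt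
      continuousAt_const (by simp)
    filter_upwards [this] with s hs
    exact moment_eq_intervalIntegral fun v hv =>
      h s (abs_le.1 hs.le) x v ((le_max_left _ _).trans hv)
  refine HasDerivAt.congr_of_eventuallyEq ?_ hev
  rw [moment_eq_intervalIntegral fun v hv =>
    h' t (abs_le.1 le_rfl) x v ((le_max_right Q _).trans hv)]
  refine hasDerivAt_intervalIntegral (F := fun s v => a v * f s x v)
    (F' := fun s v => a v * ft s x v) _ _ (fun s v => (ht s x v).const_mul _) (fun s => ?_) ?_ t
  · exact ca.mul (cf.comp (show Continuous fun v : ℝ => (s, x, v) by fun_prop))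
  · exact (ca.comp continuous_snd).mul
      (cft.comp (show Continuous fun q : ℝ × ℝ => (q.1, x, q.2) by fun_prop))

theorem abs_moment_sub_le {g : ℝ → ℝ → ℝ → ℝ} {t x s y Q c ε : ℝ} (hQ0 : 0 ≤ Q)
    (hQ : ∀ v, Q ≤ |v| → f t x v = 0) (hQ' : ∀ v, Q ≤ |v| → g s y v = 0)
    (cf : Continuous (f t x)) (cg : Continuous (g s y)) (ca : Continuous a)
    (ha : ∀ v, |v| ≤ Q → |a v| ≤ c) (h : ∀ v, |f t x v - g s y v| ≤ ε) :
    |moment a f t x - moment a g s y| ≤ 2 * Q * c * ε := by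
  have c1 : Continuous fun v => a v * f t x v := ca.mul cf
  have c2 : Continuous fun v => a v * g s y v := ca.mul cg
  rw [moment_eq_intervalIntegral hQ, moment_eq_intervalIntegral hQ',
    ← intervalIntegral.integral_sub (c1.intervalIntegrable _ _) (c2.intervalIntegrable _ _)]
  have := intervalIntegral.norm_integral_le_of_norm_le_const (a := -Q) (b := Q)
    (f := fun v => a v * f t x v - a v * g s y v) (C := c * ε) ?_
  · rw [Real.norm_eq_abs] at this
    refine this.trans (le_of_eq ?_)
    rw [abs_of_nonneg (by linarith)]
    ring
  · intro v hv
    rw [uIoc_of_le (by linarith)] at hv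
    have hv' : |v| ≤ Q := abs_le.2 ⟨hv.1.le, hv.2⟩
    rw [← mul_sub, norm_mul]
    exact mul_le_mul (ha v hv') (h v) (norm_nonneg _) ((abs_nonneg _).trans (ha v hv'))

theorem abs_moment_le {t x Q c M : ℝ} (hQ0 : 0 ≤ Q) (hQ : ∀ v, Q ≤ |v| → f t x v = 0)
    (cf : Continuous (f t x)) (ca : Continuous a)
    (ha : ∀ v, |v| ≤ Q → |a v| ≤ c) (h : ∀ v, |f t x v| ≤ M) :
    |moment a f t x| ≤ 2 * Q * c * M := by
  have := abs_moment_sub_le (g := fun _ _ _ => 0) (s := 0) (y := 0) hQ0 hQ (fun _ _ => rfl) cf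
    continuous_const ca ha (by simpa using h)
  simpa [moment] using this

end Moments

/-! ### The decomposition of the derivatives of the density along light cones -/

section GlasseyStrauss

open Filter Topology

/-- The weight `1 / (σ + v̂)`. -/
noncomputable def coneWeight (σ v : ℝ) : ℝ := 1 / (σ + relVelocity v)

/-- Minus the derivative of the weight `1 / (σ + v̂)`. -/
noncomputable def coneWeightDeriv (σ v : ℝ) : ℝ := relVelocityDeriv v / (σ + relVelocity v) ^ 2

variable {σ : ℝ}

theorem continuous_coneWeight (hσ : |σ| = 1) : Continuous (coneWeight σ) :=
  continuous_const.div (continuous_const.add continuous_relVelocity)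
    (add_relVelocity_ne_zero hσ)

theorem continuous_coneWeightDeriv (hσ : |σ| = 1) : Continuous (coneWeightDeriv σ) :=
  continuous_relVelocityDeriv.div ((continuous_const.add continuous_relVelocity).pow 2)
    fun v => pow_ne_zero 2 (add_relVelocity_ne_zero hσ v)

theorem hasDerivAt_coneWeight (hσ : |σ| = 1) (v : ℝ) :
    HasDerivAt (coneWeight σ) (-coneWeightDeriv σ v) v := by
  have h := (hasDerivAt_const v (1 : ℝ)).div ((hasDerivAt_relVelocity v).const_add σ)
    (add_relVelocity_ne_zero hσ v)
  refine h.congr_deriv ?_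
  simp [coneWeightDeriv, neg_div]

variable {f fx fv : ℝ → ℝ → ℝ → ℝ} {E : ℝ → ℝ → ℝ}

/-- The left side is the derivative `∂ₜ - σ∂ₓ` along a light ray of the moment with weight `1/(σ +
v̂)`. Inserting the Vlasov equation produces the factor `-(σ + v̂)` in front of `∂ₓf`, which cancels
the weight, and `E ∂ᵥf`, whose `v`-derivative moves onto the weight. -/
theorem HasBddVelocitySupport.moment_vlasov (hs : HasBddVelocitySupport f)
    (cf : Continuous fun p : ℝ × ℝ × ℝ => f p.1 p.2.1 p.2.2)
    (cfx : Continuous fun p : ℝ × ℝ × ℝ => fx p.1 p.2.1 p.2.2)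
    (cfv : Continuous fun p : ℝ × ℝ × ℝ => fv p.1 p.2.1 p.2.2)
    (hx : ∀ t x v, HasDerivAt (fun y => f t y v) (fx t x v) x)
    (hv : ∀ t x v, HasDerivAt (f t x) (fv t x v) v) (hσ : |σ| = 1) (t x : ℝ) :
    moment (coneWeight σ) (fun t x v => -relVelocity v * fx t x v + E t x * fv t x v) t x
      - σ * moment (coneWeight σ) fx t x
      = -moment (fun _ => 1) fx t x + E t x * moment (coneWeightDeriv σ) f t x := by
  obtain ⟨Q₁, hQ₁, h₁⟩ := hs |t|
  obtain ⟨Q₂, hQ₂, h₂⟩ := hs.deriv_right hx |t|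
  obtain ⟨Q₃, hQ₃, h₃⟩ := hs.deriv_velocity hv |t|
  set Q := max Q₁ (max Q₂ Q₃) with hQ
  have ht : t ∈ Icc (-|t|) |t| := abs_le.1 le_rfl
  have k₁ : ∀ v, Q ≤ |v| → f t x v = 0 := fun v hv => h₁ t ht x v ((le_max_left _ _).trans hv)
  have k₂ : ∀ v, Q ≤ |v| → fx t x v = 0 := fun v hv =>
    h₂ t ht x v (((le_max_left _ _).trans (le_max_right _ _)).trans hv)
  have k₃ : ∀ v, Q ≤ |v| → fv t x v = 0 := fun v hv =>
    h₃ t ht x v (((le_max_right _ _).trans (le_max_right _ _)).trans hv)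
  have hQ0 : 0 ≤ Q := hQ₁.trans (le_max_left _ _)
  have l : Continuous fun v : ℝ => (t, x, v) := by fun_prop
  have cx : Continuous (fx t x) := cfx.comp l
  have cv : Continuous (fv t x) := cfv.comp l
  have c0 : Continuous (f t x) := cf.comp l
  have cw := continuous_coneWeight hσ
  have cw' := continuous_coneWeightDeriv hσ
  rw [moment_eq_intervalIntegral k₁, moment_eq_intervalIntegral k₂, moment_eq_intervalIntegral k₂,
    moment_eq_intervalIntegral (Q := Q) fun v hv => by rw [k₂ v hv, k₃ v hv]; simp]
  -- The boundary terms vanish because `f` is zero at `v = ±Q`.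
  have parts := intervalIntegral.integral_mul_deriv_eq_deriv_mul (a := -Q) (b := Q)
    (u := coneWeight σ) (v := f t x) (u' := fun v => -coneWeightDeriv σ v) (v' := fv t x)
    (fun v _ => hasDerivAt_coneWeight hσ v) (fun v _ => hv t x v)
    (cw'.neg.intervalIntegrable _ _) (cv.intervalIntegrable _ _)
  rw [k₁ Q (le_abs_self Q), k₁ (-Q) (by rw [abs_neg]; exact le_abs_self Q)] at parts
  simp only [mul_zero, sub_zero, zero_sub, neg_mul, intervalIntegral.integral_neg, neg_neg] at parts
  rw [← parts, ← intervalIntegral.integral_const_mul, ← intervalIntegral.integral_const_mul,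
    ← intervalIntegral.integral_neg,
    ← intervalIntegral.integral_sub, ← intervalIntegral.integral_add]
  · congr 1
    funext v
    have := add_relVelocity_ne_zero hσ v
    simp only [coneWeight]
    field_simp
    ring
  all_goals apply Continuous.intervalIntegrable
  · exact (continuous_const.mul cx).neg
  · exact continuous_const.mul (cw.mul cv)
  · exact cw.mul ((continuous_relVelocity.neg.mul cx).add (continuous_const.mul cv))
  · exact continuous_const.mul (cw.mul cx)

/-- The derivative of the density, integrated along a light ray, in terms of undifferentiated
moments. -/
theorem HasBddVelocitySupport.lineIntegral_moment_deriv (hs : HasBddVelocitySupport f)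
    (cE : Continuous fun p : ℝ × ℝ => E p.1 p.2)
    (cf : Continuous fun p : ℝ × ℝ × ℝ => f p.1 p.2.1 p.2.2)
    (cfx : Continuous fun p : ℝ × ℝ × ℝ => fx p.1 p.2.1 p.2.2)
    (cfv : Continuous fun p : ℝ × ℝ × ℝ => fv p.1 p.2.1 p.2.2)
    (hx : ∀ t x v, HasDerivAt (fun y => f t y v) (fx t x v) x)
    (hv : ∀ t x v, HasDerivAt (f t x) (fv t x v) v)
    (ht : ∀ t x v, HasDerivAt (fun s => f s x v) (-relVelocity v * fx t x v + E t x * fv t x v) t)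
    (hσ : |σ| = 1) (t x : ℝ) :
    lineIntegral σ (moment (fun _ => 1) fx) t x =
      moment (coneWeight σ) f 0 (x + σ * t) - moment (coneWeight σ) f t x +
        lineIntegral σ (fun s y => E s y * moment (coneWeightDeriv σ) f s y) t x := by
  set ft : ℝ → ℝ → ℝ → ℝ := fun t x v => -relVelocity v * fx t x v + E t x * fv t x v with hft
  have hsx := hs.deriv_right hx
  have hsv := hs.deriv_velocity hv
  have hst : HasBddVelocitySupport ft := by
    intro T
    obtain ⟨Q₂, hQ₂, h₂⟩ := hsx T
    obtain ⟨Q₃, hQ₃, h₃⟩ := hsv T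
    refine ⟨max Q₂ Q₃, hQ₂.trans (le_max_left _ _), fun t ht x v hv => ?_⟩
    simp [ft, h₂ t ht x v ((le_max_left _ _).trans hv), h₃ t ht x v ((le_max_right _ _).trans hv)]
  have cft : Continuous fun p : ℝ × ℝ × ℝ => ft p.1 p.2.1 p.2.2 :=
    ((continuous_relVelocity.comp (continuous_snd.comp continuous_snd)).neg.mul cfx).add
      ((cE.comp (show Continuous fun p : ℝ × ℝ × ℝ => (p.1, p.2.1) by fun_prop)).mul cfv)
  have cw := continuous_coneWeight hσ
  have cw' := continuous_coneWeightDeriv hσ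
  -- Along the ray the spatial moment `∫ ∂ₓf dv` is, up to the field term, a total derivative in
  -- `s`.
  have dA : ∀ s, HasDerivAt (fun s => moment (coneWeight σ) f s (x + σ * (t - s)))
      (-moment (fun _ => 1) fx s (x + σ * (t - s)) +
        E s (x + σ * (t - s)) * moment (coneWeightDeriv σ) f s (x + σ * (t - s))) s := by
    intro s
    have hb : HasDerivAt (fun s : ℝ => x + σ * (t - s)) (-σ) s := by
      simpa using (((hasDerivAt_id s).const_sub t).const_mul σ).const_add x
    refine (hasDerivAt_comp_of_partial (hs.hasDerivAt_moment_left hst cf cft cw ht)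
      (hs.hasDerivAt_moment_right cf cfx cw hx) (hst.continuous_moment cft cw)
      (hsx.continuous_moment cfx cw) (hasDerivAt_id s) hb).congr_deriv ?_
    rw [← hs.moment_vlasov cf cfx cfv hx hv hσ]
    simp only [id]
    ring
  have l : Continuous fun s : ℝ => (s, x + σ * (t - s)) := by fun_prop
  have c1 : Continuous fun s : ℝ => moment (fun _ => 1) fx s (x + σ * (t - s)) :=
    (hsx.continuous_moment cfx continuous_const).comp l
  have c2 : Continuous fun s : ℝ => E s (x + σ * (t - s)) *
      moment (coneWeightDeriv σ) f s (x + σ * (t - s)) :=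
    (cE.comp l).mul ((hs.continuous_moment cf cw').comp l)
  have c3 : Continuous fun s : ℝ => -moment (fun _ => 1) fx s (x + σ * (t - s)) := c1.neg
  have ftc := intervalIntegral.integral_eq_sub_of_hasDerivAt (a := 0) (b := t) (fun s _ => dA s)
    ((c3.add c2).intervalIntegrable _ _)
  rw [intervalIntegral.integral_add (c3.intervalIntegrable _ _) (c2.intervalIntegrable _ _),
    intervalIntegral.integral_neg] at ftc
  simp only [sub_self, mul_zero, add_zero, sub_zero] at ftc
  simp only [lineIntegral]
  linarith

end GlasseyStrauss

/-! ### Estimates along characteristics -/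

section CharEstimates

open Filter Topology

/-- `γ` is a characteristic of the field `E` on `[0, t]`. -/
def IsCharOn (E : ℝ → ℝ → ℝ) (t : ℝ) (γ : ℝ → ℝ × ℝ) : Prop :=
  ∀ s ∈ Icc 0 t, HasDerivAt γ (charField E s (γ s)) s

/-- The value `f t x v` is obtained by transporting `f₀` along a characteristic of `E`. -/
def IsTransported (f₀ : ℝ × ℝ → ℝ) (E : ℝ → ℝ → ℝ) (f : ℝ → ℝ → ℝ → ℝ) (t x v : ℝ) : Prop :=
  ∃ γ : ℝ → ℝ × ℝ, γ t = (x, v) ∧ IsCharOn E t γ ∧ f t x v = f₀ (γ 0)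

variable {E E₂ : ℝ → ℝ → ℝ} {f₀ : ℝ × ℝ → ℝ} {f f₂ : ℝ → ℝ → ℝ → ℝ} {t x v : ℝ}
  {γ η : ℝ → ℝ × ℝ}

theorem IsLipField.isTransported (hE : IsLipField E) (f₀ : ℝ × ℝ → ℝ) (t x v : ℝ) :
    IsTransported f₀ E (transport f₀ E) t x v :=
  ⟨charFlow E t (x, v), hE.charFlow_self _ _, fun s _ => hE.hasDerivAt_charFlow _ _ s, rfl⟩

theorem HasDerivAt.fst_prod {γ : ℝ → ℝ × ℝ} {γ' : ℝ × ℝ} {s : ℝ} (h : HasDerivAt γ γ' s) :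
    HasDerivAt (fun s => (γ s).1) γ'.1 s :=
  (ContinuousLinearMap.fst ℝ ℝ ℝ).hasFDerivAt.comp_hasDerivAt s h

theorem HasDerivAt.snd_prod {γ : ℝ → ℝ × ℝ} {γ' : ℝ × ℝ} {s : ℝ} (h : HasDerivAt γ γ' s) :
    HasDerivAt (fun s => (γ s).2) γ'.2 s :=
  (ContinuousLinearMap.snd ℝ ℝ ℝ).hasFDerivAt.comp_hasDerivAt s h

/-- Since `|v̂| < 1`, a characteristic stays in the backward light cone of its end point. For this
reason the estimates below ask for information on the field in that cone only, which is all that an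
arbitrary solution offers. -/
theorem IsCharOn.abs_fst_sub_le (h : IsCharOn E t γ) {s : ℝ} (hs : s ∈ Icc 0 t) :
    |(γ s).1 - (γ t).1| ≤ t - s := by
  have := Convex.norm_image_sub_le_of_norm_hasDerivWithin_le (f := fun s => (γ s).1)
    (f' := fun s => relVelocity (γ s).2) (C := 1) (s := Icc 0 t) (x := t) (y := s)
    (fun r hr => (h r hr).fst_prod.hasDerivWithinAt)
    (fun r _ => (abs_relVelocity_lt_one _).le) (convex_Icc _ _) ⟨hs.1.trans hs.2, le_rfl⟩ hs
  rw [one_mul, Real.norm_eq_abs, Real.norm_eq_abs, abs_sub_comm s t,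
    abs_of_nonneg (sub_nonneg.2 hs.2)] at this
  exact this

/-- The majorant `B` is left free: it is `momentumBound` for the iterates and an affine function for
the local argument in the uniqueness proof. -/
theorem IsCharOn.abs_snd_sub_le (h : IsCharOn E t γ) (ht : 0 ≤ t) {B B' : ℝ → ℝ}
    (hB : ∀ s, HasDerivAt B (B' s) s)
    (hE : ∀ s ∈ Icc 0 t, ∀ y, |y - (γ t).1| ≤ t - s → |E s y| ≤ B' s) :
    |(γ t).2 - (γ 0).2| ≤ B t - B 0 := by
  have hd : ∀ s ∈ Icc 0 t, HasDerivAt (fun s => (γ s).2 - (γ 0).2) (-E s (γ s).1) s := fun s hs =>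
    ((h s hs).snd_prod).sub_const _
  exact image_norm_le_of_norm_deriv_right_le_deriv_boundary
    (f := fun s => (γ s).2 - (γ 0).2) (f' := fun s => -E s (γ s).1) (a := 0) (b := t)
    (B := fun s => B s - B 0) (B' := B')
    (fun s hs => (hd s hs).continuousAt.continuousWithinAt)
    (fun s hs => (hd s ⟨hs.1, hs.2.le⟩).hasDerivWithinAt) (by simp) (fun s => (hB s).sub_const _)
    (fun s hs => by
      rw [norm_neg]
      exact hE s ⟨hs.1, hs.2.le⟩ _ (h.abs_fst_sub_le ⟨hs.1, hs.2.le⟩)) ⟨ht, le_rfl⟩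

/-- Grönwall backward from the common point at time `t`. A Lipschitz constant is required of the
first field only, since the two fields are compared along the second curve. -/
theorem IsCharOn.norm_sub_le (h : IsCharOn E t γ) (h₂ : IsCharOn E₂ t η) (ht : 0 ≤ t)
    (heq : γ t = η t) {L ε : ℝ} (hL : 0 ≤ L) (hε : 0 ≤ ε)
    (hlip : ∀ s ∈ Icc 0 t, ∀ y y', |y - (γ t).1| ≤ t - s → |y' - (γ t).1| ≤ t - s →
      |E s y - E s y'| ≤ L * |y - y'|)
    (hdiff : ∀ s ∈ Icc 0 t, ∀ y, |y - (γ t).1| ≤ t - s → |E s y - E₂ s y| ≤ ε) :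
    ‖γ 0 - η 0‖ ≤ ε * t * Real.exp ((1 + L) * t) := by
  have := norm_le_of_norm_deriv_le (γ := fun s => γ s - η s)
    (γ' := fun s => charField E s (γ s) - charField E₂ s (η s)) (a := 0) (b := t) (t₀ := t)
    (K := 1 + L) (ε := ε) (δ := 0) (by positivity) hε ⟨ht, le_rfl⟩
    (fun s hs => (h s hs).sub (h₂ s hs)) (fun s hs => ?_) (by simp [heq]) ⟨le_rfl, ht⟩
  · simpa using this
  · have k₁ := h.abs_fst_sub_le hs
    have k₂ := h₂.abs_fst_sub_le hs
    rw [← heq] at k₂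
    have l₁ := norm_charField_sub_le hL (hlip s hs _ _ k₁ k₂)
    have l₂ : ‖charField E s (η s) - charField E₂ s (η s)‖ ≤ ε := by
      simp only [charField, Prod.mk_sub_mk, sub_self, neg_sub_neg, norm_prod_le_iff, norm_zero]
      refine ⟨hε, ?_⟩
      rw [norm_sub_rev]
      exact hdiff s hs _ k₂
    have l₃ := norm_add_le (charField E s (γ s) - charField E s (η s))
      (charField E s (η s) - charField E₂ s (η s))
    rw [sub_add_sub_cancel] at l₃
    linarith

/-- Comparison of densities transported by two fields that are close on the backward cone. -/
theorem IsTransported.abs_sub_le (h : IsTransported f₀ E f t x v)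
    (h₂ : IsTransported f₀ E₂ f₂ t x v) (ht : 0 ≤ t) {Λ L ε : ℝ} (hΛ : 0 ≤ Λ)
    (hf₀ : ∀ z w, |f₀ z - f₀ w| ≤ Λ * ‖z - w‖) (hL : 0 ≤ L) (hε : 0 ≤ ε)
    (hlip : ∀ s ∈ Icc 0 t, ∀ y y', |y - x| ≤ t - s → |y' - x| ≤ t - s →
      |E s y - E s y'| ≤ L * |y - y'|)
    (hdiff : ∀ s ∈ Icc 0 t, ∀ y, |y - x| ≤ t - s → |E s y - E₂ s y| ≤ ε) :
    |f t x v - f₂ t x v| ≤ Λ * (ε * t * Real.exp ((1 + L) * t)) := by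
  obtain ⟨γ, hγ, cγ, e⟩ := h
  obtain ⟨η, hη, cη, e₂⟩ := h₂
  rw [e, e₂]
  refine (hf₀ _ _).trans (mul_le_mul_of_nonneg_left ?_ hΛ)
  refine cγ.norm_sub_le cη ht (hγ.trans hη.symm) hL hε ?_ ?_ <;> simpa only [hγ]

/-- The momentum changes by at most `B t - B 0` on the way back to time zero, so it starts with
modulus at least `B 0`, where `f₀` vanishes. -/
theorem IsTransported.eq_zero_of_velocity (h : IsTransported f₀ E f t x v) (ht : 0 ≤ t)
    {B B' : ℝ → ℝ} (hB : ∀ s, HasDerivAt B (B' s) s)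
    (hE : ∀ s ∈ Icc 0 t, ∀ y, |y - x| ≤ t - s → |E s y| ≤ B' s)
    (hf₀ : ∀ x v, B 0 ≤ |v| → f₀ (x, v) = 0) (hv : B t ≤ |v|) : f t x v = 0 := by
  obtain ⟨γ, hγ, cγ, e⟩ := h
  have := cγ.abs_snd_sub_le ht hB (by simpa only [hγ] using hE)
  rw [hγ] at this
  rw [e]
  refine hf₀ _ _ ?_
  have h2 := abs_sub_abs_le_abs_sub v (γ 0).2
  simp only at this
  linarith

theorem IsTransported.eq_zero_of_position (h : IsTransported f₀ E f t x v) (ht : 0 ≤ t) {R : ℝ}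
    (hf₀ : ∀ x v, R ≤ |x| → f₀ (x, v) = 0) (hx : R + t ≤ |x|) : f t x v = 0 := by
  obtain ⟨γ, hγ, cγ, e⟩ := h
  have := cγ.abs_fst_sub_le ⟨le_rfl, ht⟩
  rw [hγ] at this
  rw [e]
  refine hf₀ _ _ ?_
  have h2 := abs_sub_abs_le_abs_sub x (γ 0).1
  rw [abs_sub_comm] at h2
  simp only at this
  linarith

/-- A crude bound that covers negative times as well. Two-sided time derivatives of moments at `t =
0` require it. -/
theorem IsLipField.hasBddVelocitySupport (hE : IsLipField E)
    (hb : ∀ T, ∃ K, 0 ≤ K ∧ ∀ t ∈ Icc (-T) T, ∀ x, |E t x| ≤ K)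
    (hf₀ : ∃ Q, 0 ≤ Q ∧ ∀ x v, Q ≤ |v| → f₀ (x, v) = 0) :
    HasBddVelocitySupport (transport f₀ E) := by
  intro T
  obtain ⟨K, hK, hKE⟩ := hb |T|
  obtain ⟨Q, hQ, h⟩ := hf₀
  refine ⟨Q + K * |T|, by positivity, fun t ht x v hv => h _ _ ?_⟩
  have ht' : |t| ≤ |T| := abs_le_abs (by linarith [ht.2]) (by linarith [ht.1])
  have := Convex.norm_image_sub_le_of_norm_hasDerivWithin_le
    (f := fun s => (charFlow E t (x, v) s).2)
    (f' := fun s => -E s (charFlow E t (x, v) s).1) (C := K) (s := Icc (-|t|) |t|) (x := t) (y := 0)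
    (fun r _ => (hE.hasDerivAt_charFlow t (x, v) r).snd_prod.hasDerivWithinAt)
    (fun r hr => by
      rw [norm_neg]
      exact hKE r ⟨by linarith [hr.1], by linarith [hr.2]⟩ _) (convex_Icc _ _)
      (abs_le.1 le_rfl) ⟨by simp, by simp⟩
  simp only [hE.charFlow_self, zero_sub, norm_neg, Real.norm_eq_abs] at this
  have h2 := abs_sub_abs_le_abs_sub v (charFlow E t (x, v) 0).2
  rw [abs_sub_comm] at h2
  have h3 : K * |t| ≤ K * |T| := mul_le_mul_of_nonneg_left ht' hK
  change Q ≤ |(charFlow E t (x, v) 0).2|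
  linarith

end CharEstimates

/-! ### The momentum bound -/

section MomentumBound

/-- The solution of the integral equation `P(t) = P₀ + C (1 + t)³ + C ∫₀ᵗ s P(s) ds`. -/
noncomputable def momentumBound (C P₀ t : ℝ) : ℝ :=
  Real.exp (C * t ^ 2 / 2) *
    (P₀ + C + ∫ s in (0 : ℝ)..t, 3 * C * (1 + s) ^ 2 * Real.exp (-(C * s ^ 2 / 2)))

/-- The derivative of the momentum bound. -/
noncomputable def momentumRate (C P₀ t : ℝ) : ℝ := 3 * C * (1 + t) ^ 2 + C * t * momentumBound C P₀ t

variable {C P₀ P₁ t : ℝ}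

theorem hasDerivAt_momentumBound (C P₀ t : ℝ) :
    HasDerivAt (momentumBound C P₀) (momentumRate C P₀ t) t := by
  have h1 : HasDerivAt (fun t : ℝ => C * t ^ 2 / 2) (C * t) t := by
    refine (((hasDerivAt_pow 2 t).const_mul C).div_const 2).congr_deriv ?_
    simp; ring
  have hc : Continuous fun s : ℝ => 3 * C * (1 + s) ^ 2 * Real.exp (-(C * s ^ 2 / 2)) := by fun_prop
  have h2 := (intervalIntegral.integral_hasDerivAt_right (hc.intervalIntegrable 0 t)
    (hc.stronglyMeasurableAtFilter _ _) hc.continuousAt).const_add (P₀ + C)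
  refine (h1.exp.mul h2).congr_deriv ?_
  have : Real.exp (C * t ^ 2 / 2) * Real.exp (-(C * t ^ 2 / 2)) = 1 := by
    rw [← Real.exp_add]; simp
  rw [momentumRate, momentumBound]
  linear_combination (3 * C * (1 + t) ^ 2) * this

theorem continuous_momentumBound (C P₀ : ℝ) : Continuous (momentumBound C P₀) :=
  continuous_iff_continuousAt.2 fun t => (hasDerivAt_momentumBound C P₀ t).continuousAt

theorem continuous_momentumRate (C P₀ : ℝ) : Continuous (momentumRate C P₀) := by
  unfold momentumRate
  have := continuous_momentumBound C P₀
  fun_prop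

theorem momentumBound_zero (C P₀ : ℝ) : momentumBound C P₀ 0 = P₀ + C := by simp [momentumBound]

/-- `momentumBound` solves the linear equation `P' = 3C(1 + t)² + CtP`, `P(0) = P₀ + C`; integrating
this gives the claim, as `3C(1 + t)²` is the derivative of `C(1 + t)³`. -/
theorem momentumBound_eq (C P₀ t : ℝ) : momentumBound C P₀ t =
    P₀ + C * (1 + t) ^ 3 + C * ∫ s in (0 : ℝ)..t, s * momentumBound C P₀ s := by
  have hc := continuous_momentumBound C P₀
  have h := intervalIntegral.integral_eq_sub_of_hasDerivAt (a := 0) (b := t)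
    (fun s _ => hasDerivAt_momentumBound C P₀ s)
    ((continuous_momentumRate C P₀).intervalIntegrable _ _)
  have h2 : ∫ s in (0 : ℝ)..t, 3 * C * (1 + s) ^ 2 = C * (1 + t) ^ 3 - C := by
    have hd : ∀ s : ℝ, HasDerivAt (fun s => C * (1 + s) ^ 3) (3 * C * (1 + s) ^ 2) s := by
      intro s
      refine ((((hasDerivAt_id s).const_add 1).pow 3).const_mul C).congr_deriv ?_
      simp; ring
    rw [intervalIntegral.integral_eq_sub_of_hasDerivAt (fun s _ => hd s)
      (by apply Continuous.intervalIntegrable; fun_prop)]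
    simp
  have e : ∀ s, momentumRate C P₀ s = 3 * C * (1 + s) ^ 2 + C * (s * momentumBound C P₀ s) := by
    intro s; rw [momentumRate]; ring
  simp only [e] at h
  rw [intervalIntegral.integral_add (by apply Continuous.intervalIntegrable; fun_prop)
    (by apply Continuous.intervalIntegrable; fun_prop), h2, intervalIntegral.integral_const_mul,
    momentumBound_zero] at h
  linarith

theorem solvesMomentumEquation_momentumBound (C P₀ : ℝ) :
    SolvesMomentumEquation C P₀ (momentumBound C P₀) :=
  ⟨(continuous_momentumBound C P₀).continuousOn, fun t _ => momentumBound_eq C P₀ t⟩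

/-- The difference `d` of two solutions satisfies `d' = C t d` and `d(0) = 0`. Continuity on `[0,
∞[` yields right derivatives, which is enough for Grönwall. -/
theorem SolvesMomentumEquation.eqOn (hC : 0 ≤ C) {P Q : ℝ → ℝ} (hP : SolvesMomentumEquation C P₀ P)
    (hQ : SolvesMomentumEquation C P₀ Q) : EqOn Q P (Ici 0) := by
  intro T hT
  set d : ℝ → ℝ := fun t => Q t - P t with hd
  have dc : ContinuousOn d (Ici 0) := hQ.continuousOn.sub hP.continuousOn
  have sc : ContinuousOn (fun s => s * d s) (Ici 0) := continuousOn_id.mul dc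
  have int : ∀ {P : ℝ → ℝ} (t : ℝ), 0 ≤ t → ContinuousOn P (Ici 0) →
      IntervalIntegrable (fun s => s * P s) volume 0 t := fun t ht hc =>
    ((continuousOn_id.mul hc).mono fun s hs => (by
      rw [uIcc_of_le ht] at hs; exact hs.1)).intervalIntegrable
  have deq : ∀ t ∈ Ici (0 : ℝ), d t = C * ∫ s in (0 : ℝ)..t, s * d s := by
    intro t ht
    have : (fun s => s * d s) = fun s => s * Q s - s * P s := by funext s; simp only [hd]; ring
    rw [this, intervalIntegral.integral_sub (int t ht hQ.continuousOn) (int t ht hP.continuousOn)]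
    simp only [hd]
    rw [hQ.eq t ht, hP.eq t ht]
    ring
  have hder : ∀ t ∈ Ico 0 T, HasDerivWithinAt d (C * (t * d t)) (Ici t) t := by
    intro t ht
    have h1 : HasDerivWithinAt (fun t => ∫ s in (0 : ℝ)..t, s * d s) (t * d t) (Ici t) t := by
      refine intervalIntegral.integral_hasDerivWithinAt_right (int t ht.1 dc) (s := Ici t)
        (t := Ioi t) ?_ ((sc t ht.1).mono fun s hs => ht.1.trans (le_of_lt hs))
      exact (sc.stronglyMeasurableAtFilter_nhdsWithin measurableSet_Ici t).filter_mono
        (nhdsWithin_mono _ fun s hs => ht.1.trans (le_of_lt hs))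
    exact (h1.const_mul C).congr (fun s hs => deq s (ht.1.trans hs)) (deq t ht.1)
  have hz := eq_zero_of_abs_deriv_le_mul_abs_self_of_eq_zero_right (K := C * T) (a := 0) (b := T)
    (dc.mono fun s hs => hs.1) hder (by rw [deq 0 self_mem_Ici]; simp) (fun t ht => by
      rw [norm_mul, norm_mul, Real.norm_of_nonneg hC, Real.norm_of_nonneg ht.1, ← mul_assoc]
      gcongr
      exact ht.2.le) T ⟨hT, le_rfl⟩
  exact sub_eq_zero.1 hz

theorem momentumBound_mono (h : P₀ ≤ P₁) : momentumBound C P₀ t ≤ momentumBound C P₁ t := by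
  unfold momentumBound
  gcongr

theorem momentumBound_nonneg (hC : 0 ≤ C) (hP : 0 ≤ P₀) (ht : 0 ≤ t) : 0 ≤ momentumBound C P₀ t := by
  unfold momentumBound
  have : 0 ≤ ∫ s in (0 : ℝ)..t, 3 * C * (1 + s) ^ 2 * Real.exp (-(C * s ^ 2 / 2)) :=
    intervalIntegral.integral_nonneg ht fun s _ => by positivity
  positivity

theorem momentumRate_nonneg (hC : 0 ≤ C) (hP : 0 ≤ P₀) (ht : 0 ≤ t) : 0 ≤ momentumRate C P₀ t := by
  have := momentumBound_nonneg hC hP ht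
  unfold momentumRate
  positivity

theorem monotoneOn_momentumBound (hC : 0 ≤ C) (hP : 0 ≤ P₀) :
    MonotoneOn (momentumBound C P₀) (Ici 0) := by
  refine monotoneOn_of_deriv_nonneg (convex_Ici 0) (continuous_momentumBound C P₀).continuousOn
    (fun t _ => (hasDerivAt_momentumBound C P₀ t).differentiableAt.differentiableWithinAt)
    fun t ht => ?_
  rw [interior_Ici] at ht
  rw [(hasDerivAt_momentumBound C P₀ t).deriv]
  exact momentumRate_nonneg hC hP (le_of_lt ht)

theorem momentumRate_mono (hC : 0 ≤ C) (hP : 0 ≤ P₀) {s : ℝ} (hs : 0 ≤ s) (hst : s ≤ t) :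
    momentumRate C P₀ s ≤ momentumRate C P₀ t := by
  have h1 := monotoneOn_momentumBound hC hP hs (hs.trans hst) hst
  have h2 := momentumBound_nonneg hC hP hs
  have h3 : 0 ≤ t := hs.trans hst
  unfold momentumRate
  gcongr

/-- The growth of the field generated by a density with this momentum bound is at most the rate of
growth of the momentum bound. -/
theorem add_le_momentumRate {M : ℝ} (hM : 0 ≤ M) (hC : C = 4 * M + 2) (hP : 0 ≤ P₀) (ht : 0 ≤ t) :
    2 * M + 2 * M * (∫ s in (0 : ℝ)..t, momentumBound C P₀ s) +
      (momentumBound C P₀ t - momentumBound C P₀ 0) ≤ momentumRate C P₀ t := by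
  have hC0 : 0 ≤ C := by linarith
  have hP0 := momentumBound_nonneg hC0 hP ht
  have hc := continuous_momentumBound C P₀
  set p := momentumBound C P₀ t with hp
  have h1 : ∫ s in (0 : ℝ)..t, momentumBound C P₀ s ≤ t * p := by
    have := intervalIntegral.integral_mono_on ht (hc.intervalIntegrable 0 t)
      (continuous_const.intervalIntegrable 0 t (μ := volume))
      (fun s hs => monotoneOn_momentumBound hC0 hP hs.1 ht hs.2)
    simpa using this
  have h2 : ∫ s in (0 : ℝ)..t, s * momentumBound C P₀ s ≤ t ^ 2 / 2 * p := by
    have := intervalIntegral.integral_mono_on ht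
      ((continuous_id.mul hc).intervalIntegrable 0 t (μ := volume))
      ((continuous_id.mul continuous_const).intervalIntegrable 0 t (μ := volume))
      (fun s hs => mul_le_mul_of_nonneg_left (monotoneOn_momentumBound hC0 hP hs.1 ht hs.2) hs.1)
    simpa using this
  have h3 := momentumBound_eq C P₀ t
  rw [← hp] at h3
  rw [momentumBound_zero, momentumRate, ← hp]
  have h4 : M * (∫ s in (0 : ℝ)..t, momentumBound C P₀ s) ≤ M * (t * p) :=
    mul_le_mul_of_nonneg_left h1 hM
  have htp : 0 ≤ t * p := mul_nonneg ht hP0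
  -- For `t ≤ 1`, the integral equation bounds `P(t) - P(0)` by `C((1 + t)³ - 1) + C t P(t)/2`; half
  -- of `C t P(t)` remains to absorb `2M t P(t)`. For `t ≥ 1`, `P(t) ≤ t P(t)`, and `C t P(t) = (4M
  -- + 2) t P(t)` absorbs everything but the constant.
  rcases le_total t 1 with h | h
  · have h5 : C * ∫ s in (0 : ℝ)..t, s * momentumBound C P₀ s ≤ C * (t * p / 2) := by
      refine mul_le_mul_of_nonneg_left (h2.trans ?_) hC0
      nlinarith
    have h6 : 3 ≤ 3 + 3 * t - t ^ 3 := by nlinarith [mul_nonneg ht (sub_nonneg.2 h), sq_nonneg t]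
    have h7 : C * 3 ≤ C * (3 + 3 * t - t ^ 3) := mul_le_mul_of_nonneg_left h6 hC0
    have h8 : (4 * M) * (t * p) ≤ C * (t * p) := mul_le_mul_of_nonneg_right (by linarith) htp
    nlinarith
  · have h5 : p ≤ t * p := by nlinarith
    have h6 : C * 1 ≤ C * (1 + t) ^ 2 := mul_le_mul_of_nonneg_left (by nlinarith) hC0
    have h8 : 0 ≤ M * (t * p) := mul_nonneg hM htp
    have h7 : C * t * p = 4 * (M * (t * p)) + 2 * (t * p) := by rw [hC]; ring
    linarith

end MomentumBound

/-! ### One step of the iteration -/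

section Step

open Filter Topology

/-- The source of the wave equation for the potential. -/
noncomputable def waveSource (f₀ : ℝ × ℝ → ℝ) (u E : ℝ → ℝ → ℝ) (t x : ℝ) : ℝ :=
  -moment (fun _ => 1) (transport f₀ E) t x - u t x

/-- The Riemann invariant `∂ₜ w + σ ∂ₓ w` of the solution `w` of the wave equation. -/
noncomputable def riemann (f₀ : ℝ × ℝ → ℝ) (u₁ u₂ : ℝ → ℝ) (u E : ℝ → ℝ → ℝ) (σ t x : ℝ) : ℝ :=
  u₂ (x + σ * t) + σ * deriv u₁ (x + σ * t) + lineIntegral σ (waveSource f₀ u E) t x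

/-- The spatial derivative of the Riemann invariant, free of derivatives of the density. -/
noncomputable def riemannDeriv (f₀ : ℝ × ℝ → ℝ) (u₁ u₂ : ℝ → ℝ) (E : ℝ → ℝ → ℝ) (σ t x : ℝ) : ℝ :=
  deriv u₂ (x + σ * t) + σ * deriv (deriv u₁) (x + σ * t)
    + moment (coneWeight σ) (transport f₀ E) t x
    - moment (coneWeight σ) (transport f₀ E) 0 (x + σ * t)
    - lineIntegral σ (fun s y => E s y * moment (coneWeightDeriv σ) (transport f₀ E) s y + E s y) t x

/-- The spatial derivative of the next potential. -/
noncomputable def nextField (f₀ : ℝ × ℝ → ℝ) (u₁ u₂ : ℝ → ℝ) (u E : ℝ → ℝ → ℝ) (t x : ℝ) : ℝ :=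
  (riemann f₀ u₁ u₂ u E 1 t x - riemann f₀ u₁ u₂ u E (-1) t x) / 2

/-- The next potential. -/
noncomputable def nextPotential (f₀ : ℝ × ℝ → ℝ) (u₁ u₂ : ℝ → ℝ) (u E : ℝ → ℝ → ℝ) (t x : ℝ) : ℝ :=
  u₁ x + ∫ s in (0 : ℝ)..t, (riemann f₀ u₁ u₂ u E 1 s x + riemann f₀ u₁ u₂ u E (-1) s x) / 2

/-- The spatial derivative of the next field. -/
noncomputable def nextFieldDeriv (f₀ : ℝ × ℝ → ℝ) (u₁ u₂ : ℝ → ℝ) (E : ℝ → ℝ → ℝ) (t x : ℝ) : ℝ :=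
  (riemannDeriv f₀ u₁ u₂ E 1 t x - riemannDeriv f₀ u₁ u₂ E (-1) t x) / 2

/-- Extension to negative times by the value at time zero. -/
def clampTime (h : ℝ → ℝ → ℝ) (t x : ℝ) : ℝ := h (max t 0) x

theorem clampTime_of_nonneg {h : ℝ → ℝ → ℝ} {t : ℝ} (ht : 0 ≤ t) (x : ℝ) :
    clampTime h t x = h t x := by rw [clampTime, max_eq_left ht]

theorem continuous_clampTime {h : ℝ → ℝ → ℝ} (c : Continuous fun p : ℝ × ℝ => h p.1 p.2) :
    Continuous fun p : ℝ × ℝ => clampTime h p.1 p.2 :=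
  c.comp (show Continuous fun p : ℝ × ℝ => (max p.1 0, p.2) by fun_prop)

/-- Potential and field of an approximate solution. -/
structure IsWeakState (R : ℝ → ℝ) (u E : ℝ → ℝ → ℝ) : Prop where
  cont_u : Continuous fun p : ℝ × ℝ => u p.1 p.2
  lip : IsLipField E
  bound_u : ∀ t x, |u t x| ≤ R (max t 0)
  bound_E : ∀ t x, |E t x| ≤ R (max t 0)

/-- Potential, field and gradient of the field of a differentiable approximate solution. -/
structure IsState (R : ℝ → ℝ) (u E E' : ℝ → ℝ → ℝ) : Prop extends IsWeakState R u E where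
  cont_E' : Continuous fun p : ℝ × ℝ => E' p.1 p.2
  deriv_u : ∀ t x, HasDerivAt (u t) (E t x) x
  deriv_E : ∀ t x, HasDerivAt (E t) (E' t x) x

/-- Initial data with the constants of the momentum bound. -/
structure IsBoundedData (M C P₀ : ℝ) (f₀ : ℝ × ℝ → ℝ) (u₁ u₂ : ℝ → ℝ) : Prop
    extends IsVKGData M f₀ u₁ u₂ where
  const_eq : C = 4 * M + 2
  nonneg : 0 ≤ P₀
  velocity_le : ∀ x v, f₀ (x, v) ≠ 0 → |v| ≤ P₀

variable {M C P₀ : ℝ} {f₀ : ℝ × ℝ → ℝ} {u₁ u₂ : ℝ → ℝ} {u E E' u' F : ℝ → ℝ → ℝ} {σ t x T : ℝ}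

namespace IsBoundedData

theorem bound_nonneg (hd : IsBoundedData M C P₀ f₀ u₁ u₂) : 0 ≤ M :=
  (abs_nonneg _).trans (hd.sup_f_le 0)

theorem const_pos (hd : IsBoundedData M C P₀ f₀ u₁ u₂) : 0 < C := by
  linarith [hd.bound_nonneg, hd.const_eq]

/-- `P(0) = P₀ + C` exceeds `P₀` strictly, which allows the non-strict inequality on `|v|`. -/
theorem f_eq_zero (hd : IsBoundedData M C P₀ f₀ u₁ u₂) (x v : ℝ)
    (h : momentumBound C P₀ 0 ≤ |v|) : f₀ (x, v) = 0 := by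
  by_contra hne
  rw [momentumBound_zero] at h
  linarith [hd.velocity_le x v hne, hd.const_pos]

theorem contDiff_deriv (hd : IsBoundedData M C P₀ f₀ u₁ u₂) : ContDiff ℝ 2 (deriv u₁) :=
  ((contDiff_succ_iff_deriv (n := 2)).1 hd.contDiff_u₁).2.2

theorem contDiff_deriv_deriv (hd : IsBoundedData M C P₀ f₀ u₁ u₂) :
    ContDiff ℝ 1 (deriv (deriv u₁)) :=
  ((contDiff_succ_iff_deriv (n := 1)).1 hd.contDiff_deriv).2.2

theorem contDiff_deriv₂ (hd : IsBoundedData M C P₀ f₀ u₁ u₂) : ContDiff ℝ 1 (deriv u₂) :=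
  ((contDiff_succ_iff_deriv (n := 1)).1 hd.contDiff_u₂).2.2

theorem hasDerivAt_u₁ (hd : IsBoundedData M C P₀ f₀ u₁ u₂) (x : ℝ) :
    HasDerivAt u₁ (deriv u₁ x) x :=
  (hd.contDiff_u₁.differentiable (by norm_num) x).hasDerivAt

theorem hasDerivAt_deriv (hd : IsBoundedData M C P₀ f₀ u₁ u₂) (x : ℝ) :
    HasDerivAt (deriv u₁) (deriv (deriv u₁) x) x :=
  (hd.contDiff_deriv.differentiable (by norm_num) x).hasDerivAt

theorem hasDerivAt_u₂ (hd : IsBoundedData M C P₀ f₀ u₁ u₂) (x : ℝ) :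
    HasDerivAt u₂ (deriv u₂ x) x :=
  (hd.contDiff_u₂.differentiable (by norm_num) x).hasDerivAt

theorem abs_u₁_le (hd : IsBoundedData M C P₀ f₀ u₁ u₂) (x : ℝ) : |u₁ x| ≤ M := by
  simpa using hd.bound_u₁ 0 (by norm_num) x

theorem abs_deriv_le (hd : IsBoundedData M C P₀ f₀ u₁ u₂) (x : ℝ) : |deriv u₁ x| ≤ M := by
  simpa using hd.bound_u₁ 1 (by norm_num) x

theorem abs_deriv_deriv_le (hd : IsBoundedData M C P₀ f₀ u₁ u₂) (x : ℝ) :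
    |deriv (deriv u₁) x| ≤ M := by
  simpa [iteratedDeriv_succ] using hd.bound_u₁ 2 (by norm_num) x

theorem abs_u₂_le (hd : IsBoundedData M C P₀ f₀ u₁ u₂) (x : ℝ) : |u₂ x| ≤ M := by
  simpa using hd.bound_u₂ 0 (by norm_num) x

theorem abs_deriv₂_le (hd : IsBoundedData M C P₀ f₀ u₁ u₂) (x : ℝ) : |deriv u₂ x| ≤ M := by
  simpa using hd.bound_u₂ 1 (by norm_num) x

theorem exists_lipschitz (hd : IsBoundedData M C P₀ f₀ u₁ u₂) :
    ∃ Λ, 0 ≤ Λ ∧ ∀ z w, |f₀ z - f₀ w| ≤ Λ * ‖z - w‖ := by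
  obtain ⟨K, hK⟩ := hd.contDiff_f.lipschitzWith_of_hasCompactSupport hd.compactSupport_f one_ne_zero
  refine ⟨K, K.2, fun z w => ?_⟩
  simpa [dist_eq_norm] using hK.dist_le_mul z w

end IsBoundedData

theorem abs_lineIntegral_le {g : ℝ → ℝ → ℝ} {B : ℝ → ℝ} (ht : 0 ≤ t) (cB : Continuous B)
    (h : ∀ s ∈ Icc 0 t, |g s (x + σ * (t - s))| ≤ B s) :
    |lineIntegral σ g t x| ≤ ∫ s in (0 : ℝ)..t, B s := by
  have := intervalIntegral.norm_integral_le_of_norm_le (f := fun s => g s (x + σ * (t - s)))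
    (g := B) (a := 0) (b := t) (μ := volume) ht
    (ae_of_all _ fun s hs => h s ⟨hs.1.le, hs.2⟩) (cB.intervalIntegrable _ _)
  exact this

namespace IsWeakState

/-- The assumed bound on the field is exactly the derivative of `momentumBound`, so momenta that
start below `P(0)` stay below `P(t)`. -/
theorem transport_eq_zero (hs : IsWeakState (momentumRate C P₀) u E)
    (hd : IsBoundedData M C P₀ f₀ u₁ u₂) (ht : 0 ≤ t) (x v : ℝ) (hv : momentumBound C P₀ t ≤ |v|) :
    transport f₀ E t x v = 0 :=
  (hs.lip.isTransported f₀ t x v).eq_zero_of_velocity ht (hasDerivAt_momentumBound C P₀)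
    (fun s hs' y _ => by simpa [max_eq_left hs'.1] using hs.bound_E s y) hd.f_eq_zero hv

theorem hasBddVelocitySupport (hs : IsWeakState (momentumRate C P₀) u E)
    (hd : IsBoundedData M C P₀ f₀ u₁ u₂) : HasBddVelocitySupport (transport f₀ E) := by
  refine hs.lip.hasBddVelocitySupport (fun T => ?_) ⟨P₀ + C, ?_, fun x v h => ?_⟩
  · refine ⟨momentumRate C P₀ (max T 0), momentumRate_nonneg hd.const_pos.le hd.nonneg
      (le_max_right _ _), fun t ht x => (hs.bound_E t x).trans ?_⟩
    exact momentumRate_mono hd.const_pos.le hd.nonneg (le_max_right _ _)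
      (max_le_max ht.2 le_rfl)
  · linarith [hd.nonneg, hd.const_pos]
  · exact hd.f_eq_zero x v (by rwa [momentumBound_zero])

theorem continuous_transport (hs : IsWeakState (momentumRate C P₀) u E)
    (hd : IsBoundedData M C P₀ f₀ u₁ u₂) :
    Continuous fun p : ℝ × ℝ × ℝ => transport f₀ E p.1 p.2.1 p.2.2 :=
  hs.lip.continuous_transport hd.contDiff_f.continuous

theorem continuous_moment (hs : IsWeakState (momentumRate C P₀) u E)
    (hd : IsBoundedData M C P₀ f₀ u₁ u₂) {a : ℝ → ℝ} (ca : Continuous a) :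
    Continuous fun p : ℝ × ℝ => moment a (transport f₀ E) p.1 p.2 :=
  (hs.hasBddVelocitySupport hd).continuous_moment (hs.continuous_transport hd) ca

theorem continuous_waveSource (hs : IsWeakState (momentumRate C P₀) u E)
    (hd : IsBoundedData M C P₀ f₀ u₁ u₂) : Continuous fun p : ℝ × ℝ => waveSource f₀ u E p.1 p.2 :=
  (hs.continuous_moment hd continuous_const).neg.sub hs.cont_u

theorem continuous_riemann (hs : IsWeakState (momentumRate C P₀) u E)
    (hd : IsBoundedData M C P₀ f₀ u₁ u₂) (σ : ℝ) :
    Continuous fun p : ℝ × ℝ => riemann f₀ u₁ u₂ u E σ p.1 p.2 := by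
  have l : Continuous fun p : ℝ × ℝ => p.2 + σ * p.1 := by fun_prop
  exact ((hd.contDiff_u₂.continuous.comp l).add
    (continuous_const.mul (hd.contDiff_deriv.continuous.comp l))).add
      (continuous_lineIntegral σ (hs.continuous_waveSource hd))

theorem continuous_nextField (hs : IsWeakState (momentumRate C P₀) u E)
    (hd : IsBoundedData M C P₀ f₀ u₁ u₂) : Continuous fun p : ℝ × ℝ => nextField f₀ u₁ u₂ u E p.1 p.2 :=
  ((hs.continuous_riemann hd 1).sub (hs.continuous_riemann hd (-1))).div_const 2

theorem continuous_nextPotential (hs : IsWeakState (momentumRate C P₀) u E)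
    (hd : IsBoundedData M C P₀ f₀ u₁ u₂) :
    Continuous fun p : ℝ × ℝ => nextPotential f₀ u₁ u₂ u E p.1 p.2 := by
  refine (hd.contDiff_u₁.continuous.comp continuous_snd).add
    (intervalIntegral.continuous_parametric_intervalIntegral_of_continuous
    (f := fun (p : ℝ × ℝ) s => (riemann f₀ u₁ u₂ u E 1 s p.2 + riemann f₀ u₁ u₂ u E (-1) s p.2) / 2)
    ?_ continuous_fst)
  have l : Continuous fun q : (ℝ × ℝ) × ℝ => (q.2, q.1.2) := by fun_prop
  exact (((hs.continuous_riemann hd 1).comp l).add ((hs.continuous_riemann hd (-1)).comp l)).div_const 2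

theorem continuous_riemannDeriv (hs : IsWeakState (momentumRate C P₀) u E)
    (hd : IsBoundedData M C P₀ f₀ u₁ u₂) (hσ : |σ| = 1) :
    Continuous fun p : ℝ × ℝ => riemannDeriv f₀ u₁ u₂ E σ p.1 p.2 := by
  have l : Continuous fun p : ℝ × ℝ => p.2 + σ * p.1 := by fun_prop
  have l' : Continuous fun p : ℝ × ℝ => ((0 : ℝ), p.2 + σ * p.1) := by fun_prop
  have cm := hs.continuous_moment hd (continuous_coneWeight hσ)
  have cm' := hs.continuous_moment hd (continuous_coneWeightDeriv hσ)
  exact ((((hd.contDiff_deriv₂.continuous.comp l).add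
    (continuous_const.mul (hd.contDiff_deriv_deriv.continuous.comp l))).add cm).sub
      (cm.comp l')).sub (continuous_lineIntegral σ ((hs.lip.cont.mul cm').add hs.lip.cont))

theorem abs_transport_moment_le (hs : IsWeakState (momentumRate C P₀) u E)
    (hd : IsBoundedData M C P₀ f₀ u₁ u₂) {a : ℝ → ℝ} {c : ℝ} (ca : Continuous a) (ht : 0 ≤ t) (x : ℝ)
    (ha : ∀ v, |v| ≤ momentumBound C P₀ t → |a v| ≤ c) :
    |moment a (transport f₀ E) t x| ≤ 2 * momentumBound C P₀ t * c * M :=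
  abs_moment_le (momentumBound_nonneg hd.const_pos.le hd.nonneg ht)
    (hs.transport_eq_zero hd ht x)
    ((hs.continuous_transport hd).comp (show Continuous fun v : ℝ => (t, x, v) by fun_prop)) ca ha
    fun _ => hd.sup_f_le _

/-- At time `t` the density is at most `M` in modulus and lives on `|v| ≤ P(t)`, hence `|ρ| ≤
2MP(t)`. -/
theorem abs_waveSource_le (hs : IsWeakState (momentumRate C P₀) u E)
    (hd : IsBoundedData M C P₀ f₀ u₁ u₂) (ht : 0 ≤ t) (x : ℝ) :
    |waveSource f₀ u E t x| ≤ 2 * M * momentumBound C P₀ t + momentumRate C P₀ t := by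
  have h1 := hs.abs_transport_moment_le hd (a := fun _ => 1) (c := 1) continuous_const ht x
    (by simp)
  have h2 := hs.bound_u t x
  rw [max_eq_left ht] at h2
  rw [abs_le] at *
  unfold waveSource
  constructor <;> linarith

/-- The point where the bound reproduces itself: `∫₀ᵗ P' = P(t) - P(0)`, so the data and the
integrated source add up to precisely the left side of `add_le_momentumRate`. -/
theorem abs_riemann_le (hs : IsWeakState (momentumRate C P₀) u E)
    (hd : IsBoundedData M C P₀ f₀ u₁ u₂) (hσ : |σ| = 1) (ht : 0 ≤ t) (x : ℝ) :
    |riemann f₀ u₁ u₂ u E σ t x| ≤ momentumRate C P₀ t := by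
  have cP := continuous_momentumBound C P₀
  have cR := continuous_momentumRate C P₀
  have h1 := abs_lineIntegral_le (σ := σ) (x := x) (g := waveSource f₀ u E)
    (B := fun s => 2 * M * momentumBound C P₀ s + momentumRate C P₀ s) ht (by fun_prop)
    (fun s hs' => hs.abs_waveSource_le hd hs'.1 _)
  rw [intervalIntegral.integral_add (by apply Continuous.intervalIntegrable; fun_prop)
    (cR.intervalIntegrable _ _), intervalIntegral.integral_const_mul,
    intervalIntegral.integral_eq_sub_of_hasDerivAt
      (fun s _ => hasDerivAt_momentumBound C P₀ s) (cR.intervalIntegrable _ _)] at h1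
  have h2 := add_le_momentumRate hd.bound_nonneg hd.const_eq hd.nonneg ht
  have h3 := hd.abs_u₂_le (x + σ * t)
  have h4 : |σ * deriv u₁ (x + σ * t)| ≤ M := by
    rw [abs_mul, hσ, one_mul]; exact hd.abs_deriv_le _
  rw [riemann]
  refine (abs_add_le _ _).trans ?_
  linarith [abs_add_le (u₂ (x + σ * t)) (σ * deriv u₁ (x + σ * t))]

theorem abs_nextField_le (hs : IsWeakState (momentumRate C P₀) u E)
    (hd : IsBoundedData M C P₀ f₀ u₁ u₂) (ht : 0 ≤ t) (x : ℝ) :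
    |nextField f₀ u₁ u₂ u E t x| ≤ momentumRate C P₀ t := by
  have h1 := hs.abs_riemann_le hd (σ := 1) (by simp) ht x
  have h2 := hs.abs_riemann_le hd (σ := -1) (by simp) ht x
  rw [abs_le] at *
  unfold nextField
  constructor <;> linarith

/-- Integrating `|∂ₜu| ≤ P'` gives `|u| ≤ M + P(t) - P(0)`, again below `P'(t)`. -/
theorem abs_nextPotential_le (hs : IsWeakState (momentumRate C P₀) u E)
    (hd : IsBoundedData M C P₀ f₀ u₁ u₂) (ht : 0 ≤ t) (x : ℝ) :
    |nextPotential f₀ u₁ u₂ u E t x| ≤ momentumRate C P₀ t := by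
  have cR := continuous_momentumRate C P₀
  have h1 := intervalIntegral.norm_integral_le_of_norm_le
    (f := fun s => (riemann f₀ u₁ u₂ u E 1 s x + riemann f₀ u₁ u₂ u E (-1) s x) / 2)
    (g := momentumRate C P₀) (a := 0) (b := t) (μ := volume) ht
    (ae_of_all _ fun s hs' => by
      have h1 := hs.abs_riemann_le hd (σ := 1) (by simp) hs'.1.le x
      have h2 := hs.abs_riemann_le hd (σ := -1) (by simp) hs'.1.le x
      rw [Real.norm_eq_abs]
      rw [abs_le] at *
      constructor <;> linarith) (cR.intervalIntegrable _ _)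
  rw [intervalIntegral.integral_eq_sub_of_hasDerivAt
      (fun s _ => hasDerivAt_momentumBound C P₀ s) (cR.intervalIntegrable _ _),
      Real.norm_eq_abs] at h1
  have h2 := add_le_momentumRate hd.bound_nonneg hd.const_eq hd.nonneg ht
  have h3 : 0 ≤ 2 * M * ∫ s in (0 : ℝ)..t, momentumBound C P₀ s :=
    mul_nonneg (by linarith [hd.bound_nonneg]) (intervalIntegral.integral_nonneg ht
      fun s hs' => momentumBound_nonneg hd.const_pos.le hd.nonneg hs'.1)
  have h4 := hd.abs_u₁_le x
  rw [nextPotential]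
  refine (abs_add_le _ _).trans ?_
  linarith [hd.bound_nonneg]

/-- The gradient of the field is bounded on compact time intervals, uniformly over all approximate
solutions. -/
theorem _root_.IsBoundedData.exists_riemannDeriv_bound (hd : IsBoundedData M C P₀ f₀ u₁ u₂) (hσ : |σ| = 1) (T : ℝ) :
    ∃ L, 0 ≤ L ∧ ∀ u E, IsWeakState (momentumRate C P₀) u E → ∀ t ∈ Icc 0 T, ∀ x,
      |riemannDeriv f₀ u₁ u₂ E σ t x| ≤ L := by
  have hC := hd.const_pos.le
  have hM := hd.bound_nonneg
  set Q := momentumBound C P₀ T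
  set R := momentumRate C P₀ T
  -- The weights are singular only as `|v| → ∞`, where `σ + v̂` can tend to zero; on the momentum
  -- support up to time `T` they are bounded.
  obtain ⟨c, hc⟩ := (isCompact_Icc (a := -Q) (b := Q)).exists_bound_of_continuousOn
    (continuous_coneWeight hσ).continuousOn
  obtain ⟨c', hc'⟩ := (isCompact_Icc (a := -Q) (b := Q)).exists_bound_of_continuousOn
    (continuous_coneWeightDeriv hσ).continuousOn
  rcases lt_or_ge T 0 with hT | hT
  · exact ⟨0, le_rfl, fun u E _ t ht => absurd (ht.1.trans ht.2) (not_le.2 hT)⟩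
  have hQ0 : 0 ≤ Q := momentumBound_nonneg hC hd.nonneg hT
  have hR0 : 0 ≤ R := momentumRate_nonneg hC hd.nonneg hT
  have hc0 : 0 ≤ c := (norm_nonneg _).trans (hc 0 ⟨by linarith, hQ0⟩)
  have hc0' : 0 ≤ c' := (norm_nonneg _).trans (hc' 0 ⟨by linarith, hQ0⟩)
  refine ⟨2 * M + 2 * (2 * Q * c * M) + T * (R * (2 * Q * c' * M) + R), by positivity,
    fun u E hs t ht x => ?_⟩
  have hPt : ∀ s ∈ Icc 0 T, momentumBound C P₀ s ≤ Q := fun s hs =>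
    monotoneOn_momentumBound hC hd.nonneg hs.1 hT hs.2
  have hm : ∀ s ∈ Icc 0 T, ∀ y, |moment (coneWeight σ) (transport f₀ E) s y| ≤ 2 * Q * c * M := by
    intro s hs' y
    refine (hs.abs_transport_moment_le hd (continuous_coneWeight hσ) hs'.1 y
      fun v hv => hc v (abs_le.1 (hv.trans (hPt s hs')))).trans ?_
    have := hPt s hs'
    gcongr
  have hm' : ∀ s ∈ Icc 0 T, ∀ y,
      |moment (coneWeightDeriv σ) (transport f₀ E) s y| ≤ 2 * Q * c' * M := by
    intro s hs' y
    refine (hs.abs_transport_moment_le hd (continuous_coneWeightDeriv hσ) hs'.1 y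
      fun v hv => hc' v (abs_le.1 (hv.trans (hPt s hs')))).trans ?_
    have := hPt s hs'
    gcongr
  have hE : ∀ s ∈ Icc 0 T, ∀ y, |E s y| ≤ R := by
    intro s hs' y
    have := hs.bound_E s y
    rw [max_eq_left hs'.1] at this
    exact this.trans (momentumRate_mono hC hd.nonneg hs'.1 hs'.2)
  have h1 := abs_lineIntegral_le (σ := σ) (x := x)
    (g := fun s y => E s y * moment (coneWeightDeriv σ) (transport f₀ E) s y + E s y)
    (B := fun _ => R * (2 * Q * c' * M) + R) ht.1 continuous_const (fun s hs' => by
      have hsT : s ∈ Icc 0 T := ⟨hs'.1, hs'.2.trans ht.2⟩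
      refine (abs_add_le _ _).trans (add_le_add ?_ (hE s hsT _))
      rw [abs_mul]
      exact mul_le_mul (hE s hsT _) (hm' s hsT _) (abs_nonneg _) hR0)
  rw [intervalIntegral.integral_const, sub_zero, smul_eq_mul] at h1
  have h2 : t * (R * (2 * Q * c' * M) + R) ≤ T * (R * (2 * Q * c' * M) + R) :=
    mul_le_mul_of_nonneg_right ht.2 (by positivity)
  have h3 := hd.abs_deriv₂_le (x + σ * t)
  have h4 : |σ * deriv (deriv u₁) (x + σ * t)| ≤ M := by
    rw [abs_mul, hσ, one_mul]; exact hd.abs_deriv_deriv_le _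
  have h5 := hm t ht x
  have h6 := hm 0 ⟨le_rfl, hT⟩ (x + σ * t)
  have h7 := h1.trans h2
  unfold riemannDeriv
  rw [abs_le] at h3 h4 h5 h6 h7 ⊢
  constructor <;> linarith

end IsWeakState

end Step

/-! ### Regularity of one step of the iteration -/

section StepRegularity

open Filter Topology

variable {M C P₀ : ℝ} {f₀ : ℝ × ℝ → ℝ} {u₁ u₂ : ℝ → ℝ} {u E E' u' F : ℝ → ℝ → ℝ} {σ t x T : ℝ}

theorem lineIntegral_add {g h : ℝ → ℝ → ℝ} (σ t x : ℝ) (cg : Continuous fun p : ℝ × ℝ => g p.1 p.2)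
    (ch : Continuous fun p : ℝ × ℝ => h p.1 p.2) :
    lineIntegral σ (fun s y => g s y + h s y) t x = lineIntegral σ g t x + lineIntegral σ h t x := by
  have l : Continuous fun s : ℝ => (s, x + σ * (t - s)) := by fun_prop
  exact intervalIntegral.integral_add ((cg.comp l).intervalIntegrable _ _)
    ((ch.comp l).intervalIntegrable _ _)

theorem lineIntegral_sub {g h : ℝ → ℝ → ℝ} (σ t x : ℝ) (cg : Continuous fun p : ℝ × ℝ => g p.1 p.2)
    (ch : Continuous fun p : ℝ × ℝ => h p.1 p.2) :
    lineIntegral σ (fun s y => g s y - h s y) t x = lineIntegral σ g t x - lineIntegral σ h t x := by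
  have l : Continuous fun s : ℝ => (s, x + σ * (t - s)) := by fun_prop
  exact intervalIntegral.integral_sub ((cg.comp l).intervalIntegrable _ _)
    ((ch.comp l).intervalIntegrable _ _)

theorem lineIntegral_neg (g : ℝ → ℝ → ℝ) (σ t x : ℝ) :
    lineIntegral σ (fun s y => -g s y) t x = -lineIntegral σ g t x :=
  intervalIntegral.integral_neg

theorem isLipField_of_deriv_bound (cE : Continuous fun p : ℝ × ℝ => E p.1 p.2)
    (hE : ∀ t x, HasDerivAt (E t) (E' t x) x)
    (hb : ∀ T, ∃ L, 0 ≤ L ∧ ∀ t ∈ Icc (-T) T, ∀ x, |E' t x| ≤ L) : IsLipField E := by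
  refine ⟨cE, fun T => ?_⟩
  obtain ⟨L, hL, h⟩ := hb T
  refine ⟨L, hL, fun t ht x y => ?_⟩
  exact Convex.norm_image_sub_le_of_norm_hasDerivWithin_le (f := E t) (f' := E' t) (C := L)
    (s := univ) (x := y) (y := x) (fun z _ => (hE t z).hasDerivWithinAt) (fun z _ => h t ht z)
    convex_univ (mem_univ _) (mem_univ _)

theorem IsWeakState.hasDerivAt_nextPotential_left (hs : IsWeakState (momentumRate C P₀) u E)
    (hd : IsBoundedData M C P₀ f₀ u₁ u₂) (t x : ℝ) :
    HasDerivAt (fun s => nextPotential f₀ u₁ u₂ u E s x)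
      ((riemann f₀ u₁ u₂ u E 1 t x + riemann f₀ u₁ u₂ u E (-1) t x) / 2) t := by
  have l : Continuous fun s : ℝ => (s, x) := by fun_prop
  have c : Continuous fun s => (riemann f₀ u₁ u₂ u E 1 s x + riemann f₀ u₁ u₂ u E (-1) s x) / 2 :=
    (((hs.continuous_riemann hd 1).comp l).add ((hs.continuous_riemann hd (-1)).comp l)).div_const 2
  exact (intervalIntegral.integral_hasDerivAt_right (c.intervalIntegrable 0 t)
    (c.stronglyMeasurableAtFilter _ _) c.continuousAt).const_add (u₁ x)

namespace IsState

/-- The derivative `g'` contains `∂ₓρ`, on which no uniform bound is available. Only its ray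
integrals enter the derivatives of the Riemann invariants, and these are expressed without
derivatives of the density. -/
theorem exists_deriv_waveSource (hs : IsState (momentumRate C P₀) u E E')
    (hd : IsBoundedData M C P₀ f₀ u₁ u₂) :
    ∃ g' : ℝ → ℝ → ℝ, (Continuous fun p : ℝ × ℝ => g' p.1 p.2) ∧
      (∀ t x, HasDerivAt (waveSource f₀ u E t) (g' t x) x) ∧
      ∀ σ, |σ| = 1 → ∀ t x, lineIntegral σ g' t x =
        moment (coneWeight σ) (transport f₀ E) t x
        - moment (coneWeight σ) (transport f₀ E) 0 (x + σ * t)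
        - lineIntegral σ (fun s y => E s y * moment (coneWeightDeriv σ) (transport f₀ E) s y
          + E s y) t x := by
  obtain ⟨fx, fv, cfx, cfv, hx, hv, ht, -⟩ :=
    hs.lip.exists_transport_deriv hs.deriv_E hs.cont_E' hd.contDiff_f
  have hb := hs.hasBddVelocitySupport hd
  have cf := hs.continuous_transport hd
  have cE := hs.lip.cont
  have cm : Continuous fun p : ℝ × ℝ => moment (fun _ => 1) fx p.1 p.2 :=
    (hb.deriv_right hx).continuous_moment cfx continuous_const
  refine ⟨fun t x => -moment (fun _ => 1) fx t x - E t x, cm.neg.sub cE, fun t x => ?_,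
    fun σ hσ t x => ?_⟩
  · exact (hb.hasDerivAt_moment_right cf cfx continuous_const hx t x).neg.sub (hs.deriv_u t x)
  · have cm' := hs.continuous_moment hd (continuous_coneWeightDeriv hσ)
    rw [lineIntegral_sub (g := fun t x => -moment (fun _ => 1) fx t x) σ t x cm.neg cE,
      lineIntegral_neg, hb.lineIntegral_moment_deriv cE cf cfx cfv hx hv ht hσ,
      lineIntegral_add (g := fun s y => E s y * moment (coneWeightDeriv σ) (transport f₀ E) s y)
        σ t x (cE.mul cm') cE]
    ring

theorem hasDerivAt_riemann_right (hs : IsState (momentumRate C P₀) u E E')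
    (hd : IsBoundedData M C P₀ f₀ u₁ u₂) (hσ : |σ| = 1) (t x : ℝ) :
    HasDerivAt (riemann f₀ u₁ u₂ u E σ t) (riemannDeriv f₀ u₁ u₂ E σ t x) x := by
  obtain ⟨g', cg', hg', hl⟩ := hs.exists_deriv_waveSource hd
  have h1 := hasDerivAt_lineIntegral_right σ (hs.continuous_waveSource hd) cg' hg' t x
  have h2 := (hd.hasDerivAt_u₂ (x + σ * t)).comp_add_const x (σ * t)
  have h3 := ((hd.hasDerivAt_deriv (x + σ * t)).comp_add_const x (σ * t)).const_mul σ
  refine ((h2.add h3).add h1).congr_deriv ?_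
  rw [hl σ hσ, riemannDeriv]
  ring

theorem hasDerivAt_riemann_left (hs : IsState (momentumRate C P₀) u E E')
    (hd : IsBoundedData M C P₀ f₀ u₁ u₂) (hσ : |σ| = 1) (t x : ℝ) :
    HasDerivAt (fun s => riemann f₀ u₁ u₂ u E σ s x)
      (σ * riemannDeriv f₀ u₁ u₂ E σ t x + waveSource f₀ u E t x) t := by
  obtain ⟨g', cg', hg', hl⟩ := hs.exists_deriv_waveSource hd
  have h1 := hasDerivAt_lineIntegral_left σ (hs.continuous_waveSource hd) cg' hg' t x
  have hb : HasDerivAt (fun s : ℝ => x + σ * s) σ t := by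
    simpa using ((hasDerivAt_id t).const_mul σ).const_add x
  have h2 := (hd.hasDerivAt_u₂ (x + σ * t)).comp t hb
  have h3 := ((hd.hasDerivAt_deriv (x + σ * t)).comp t hb).const_mul σ
  refine ((h2.add h3).add h1).congr_deriv ?_
  rw [hl σ hσ, riemannDeriv]
  ring

theorem hasDerivAt_nextField_right (hs : IsState (momentumRate C P₀) u E E')
    (hd : IsBoundedData M C P₀ f₀ u₁ u₂) (t x : ℝ) :
    HasDerivAt (nextField f₀ u₁ u₂ u E t) (nextFieldDeriv f₀ u₁ u₂ E t x) x :=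
  ((hs.hasDerivAt_riemann_right hd (by simp) t x).sub
    (hs.hasDerivAt_riemann_right hd (by simp) t x)).div_const 2

theorem hasDerivAt_nextField_left (hs : IsState (momentumRate C P₀) u E E')
    (hd : IsBoundedData M C P₀ f₀ u₁ u₂) (t x : ℝ) :
    HasDerivAt (fun s => nextField f₀ u₁ u₂ u E s x)
      ((riemannDeriv f₀ u₁ u₂ E 1 t x + riemannDeriv f₀ u₁ u₂ E (-1) t x) / 2) t := by
  refine (((hs.hasDerivAt_riemann_left hd (σ := 1) (by simp) t x).sub
    (hs.hasDerivAt_riemann_left hd (σ := -1) (by simp) t x)).div_const 2).congr_deriv ?_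
  ring

/-- Potential and field are built separately, so their compatibility needs a proof. Differentiating
the time integral in `x` yields the integral of `∂ₜ` of the next field, hence the field at `t` minus
its value at zero, and the latter is `u₁'`. -/
theorem hasDerivAt_nextPotential_right (hs : IsState (momentumRate C P₀) u E E')
    (hd : IsBoundedData M C P₀ f₀ u₁ u₂) (t x : ℝ) :
    HasDerivAt (nextPotential f₀ u₁ u₂ u E t) (nextField f₀ u₁ u₂ u E t x) x := by
  have c1 := hs.continuous_riemannDeriv hd (σ := 1) (by simp)
  have c2 := hs.continuous_riemannDeriv hd (σ := -1) (by simp)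
  have cD : Continuous fun p : ℝ × ℝ =>
      (riemannDeriv f₀ u₁ u₂ E 1 p.1 p.2 + riemannDeriv f₀ u₁ u₂ E (-1) p.1 p.2) / 2 :=
    (c1.add c2).div_const 2
  have h := hasDerivAt_intervalIntegral
    (F := fun x s => (riemann f₀ u₁ u₂ u E 1 s x + riemann f₀ u₁ u₂ u E (-1) s x) / 2)
    (F' := fun x s => (riemannDeriv f₀ u₁ u₂ E 1 s x + riemannDeriv f₀ u₁ u₂ E (-1) s x) / 2)
    0 t (fun x s => ((hs.hasDerivAt_riemann_right hd (by simp) s x).add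
      (hs.hasDerivAt_riemann_right hd (by simp) s x)).div_const 2)
    (fun x => by
      have l : Continuous fun s : ℝ => (s, x) := by fun_prop
      exact (((hs.continuous_riemann hd 1).comp l).add
        ((hs.continuous_riemann hd (-1)).comp l)).div_const 2)
    (cD.comp continuous_swap) x
  have l : Continuous fun s : ℝ => (s, x) := by fun_prop
  have ftc := intervalIntegral.integral_eq_sub_of_hasDerivAt (a := 0) (b := t)
    (fun s _ => hs.hasDerivAt_nextField_left hd s x) ((cD.comp l).intervalIntegrable _ _)
  refine ((hd.hasDerivAt_u₁ x).add h).congr_deriv ?_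
  rw [ftc]
  simp only [nextField, riemann, lineIntegral, mul_zero, add_zero, intervalIntegral.integral_same]
  ring

/-- The next approximate solution. -/
theorem next (hs : IsState (momentumRate C P₀) u E E') (hd : IsBoundedData M C P₀ f₀ u₁ u₂) :
    IsState (momentumRate C P₀) (clampTime (nextPotential f₀ u₁ u₂ u E))
      (clampTime (nextField f₀ u₁ u₂ u E)) (clampTime (nextFieldDeriv f₀ u₁ u₂ E)) := by
  have hE : ∀ t x, HasDerivAt (clampTime (nextField f₀ u₁ u₂ u E) t)
      (clampTime (nextFieldDeriv f₀ u₁ u₂ E) t x) x := fun t x =>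
    hs.hasDerivAt_nextField_right hd _ x
  refine ⟨⟨continuous_clampTime (hs.continuous_nextPotential hd), ?_, ?_, ?_⟩, ?_, ?_, hE⟩
  -- Boundedness of `nextFieldDeriv` on compact time intervals, uniformly in `x`, supplies the
  -- Lipschitz property.
  · refine isLipField_of_deriv_bound (continuous_clampTime (hs.continuous_nextField hd)) hE
      fun T => ?_
    obtain ⟨L, hL, h⟩ := hd.exists_riemannDeriv_bound (σ := 1) (by simp) (max T 0)
    obtain ⟨L', hL', h'⟩ := hd.exists_riemannDeriv_bound (σ := -1) (by simp) (max T 0)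
    refine ⟨L + L', by positivity, fun t ht x => ?_⟩
    have hm : max t 0 ∈ Icc 0 (max T 0) := ⟨le_max_right _ _, max_le_max ht.2 le_rfl⟩
    have k := h u E hs.toIsWeakState _ hm x
    have k' := h' u E hs.toIsWeakState _ hm x
    simp only [clampTime, nextFieldDeriv]
    rw [abs_le] at *
    constructor <;> linarith
  · exact fun t x => hs.abs_nextPotential_le hd (le_max_right _ _) x
  · exact fun t x => hs.abs_nextField_le hd (le_max_right _ _) x
  · exact continuous_clampTime (((hs.continuous_riemannDeriv hd (by simp)).sub
      (hs.continuous_riemannDeriv hd (by simp))).div_const 2)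
  · exact fun t x => hs.hasDerivAt_nextPotential_right hd _ x

end IsState

end StepRegularity

/-! ### Contraction -/

section Contraction

variable {M C P₀ : ℝ} {f₀ : ℝ × ℝ → ℝ} {u₁ u₂ : ℝ → ℝ} {u E u' F : ℝ → ℝ → ℝ}
  {σ t x T Λ L ε : ℝ}

theorem integral_mul_exp_le {c l t : ℝ} (hc : 0 ≤ c) (hl : 0 < l) :
    ∫ s in (0 : ℝ)..t, c * Real.exp (l * s) ≤ c / l * Real.exp (l * t) := by
  have hd : ∀ s : ℝ, HasDerivAt (fun s => c / l * Real.exp (l * s)) (c * Real.exp (l * s)) s := by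
    intro s
    refine ((((hasDerivAt_id s).const_mul l).exp).const_mul (c / l)).congr_deriv ?_
    simp only [id]
    field_simp
  rw [intervalIntegral.integral_eq_sub_of_hasDerivAt (fun s _ => hd s)
    (by apply Continuous.intervalIntegrable; fun_prop)]
  have : 0 ≤ c / l * Real.exp (l * 0) := by positivity
  linarith

/-- Both densities vanish beyond `P(T)`, and they differ by a multiple of the distance of the
fields, because `f₀` is Lipschitz and the characteristics are close. -/
theorem IsWeakState.abs_moment_sub_le (hs : IsWeakState (momentumRate C P₀) u E)
    (hs' : IsWeakState (momentumRate C P₀) u' F) (hd : IsBoundedData M C P₀ f₀ u₁ u₂)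
    (hΛ : 0 ≤ Λ) (hf₀ : ∀ z w, |f₀ z - f₀ w| ≤ Λ * ‖z - w‖) (hL : 0 ≤ L) (hε : 0 ≤ ε)
    (ht : t ∈ Icc 0 T) (hlip : ∀ s ∈ Icc 0 T, ∀ y y', |E s y - E s y'| ≤ L * |y - y'|)
    (hdiff : ∀ s ∈ Icc 0 t, ∀ y, |E s y - F s y| ≤ ε) {a : ℝ → ℝ} {c : ℝ} (ca : Continuous a)
    (ha : ∀ v, |v| ≤ momentumBound C P₀ T → |a v| ≤ c) (x : ℝ) :
    |moment a (transport f₀ E) t x - moment a (transport f₀ F) t x| ≤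
      2 * momentumBound C P₀ T * c * (Λ * (ε * T * Real.exp ((1 + L) * T))) := by
  have hT : 0 ≤ T := ht.1.trans ht.2
  have hQ := monotoneOn_momentumBound hd.const_pos.le hd.nonneg ht.1 hT ht.2
  have l : Continuous fun v : ℝ => (t, x, v) := by fun_prop
  refine _root_.abs_moment_sub_le (momentumBound_nonneg hd.const_pos.le hd.nonneg hT)
    (fun v hv => hs.transport_eq_zero hd ht.1 x v (hQ.trans hv))
    (fun v hv => hs'.transport_eq_zero hd ht.1 x v (hQ.trans hv))
    ((hs.continuous_transport hd).comp l) ((hs'.continuous_transport hd).comp l) ca ha fun v => ?_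
  refine ((hs.lip.isTransported f₀ t x v).abs_sub_le (hs'.lip.isTransported f₀ t x v) ht.1 hΛ hf₀
    hL hε (fun s hs y y' _ _ => hlip s ⟨hs.1, hs.2.trans ht.2⟩ y y')
    (fun s hs y _ => hdiff s hs y)).trans ?_
  have h1 : ε * t * Real.exp ((1 + L) * t) ≤ ε * T * Real.exp ((1 + L) * T) := by
    have := ht.2
    gcongr
  exact mul_le_mul_of_nonneg_left h1 hΛ

/-- The iteration is a contraction for exponentially weighted norms. -/
theorem IsBoundedData.exists_contraction (hd : IsBoundedData M C P₀ f₀ u₁ u₂) (hT : 0 ≤ T)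
    (hL : 0 ≤ L) :
    ∃ l, 0 < l ∧ ∀ u E u' F, IsWeakState (momentumRate C P₀) u E →
      IsWeakState (momentumRate C P₀) u' F →
      (∀ s ∈ Icc 0 T, ∀ y y', |E s y - E s y'| ≤ L * |y - y'|) → ∀ D, 0 ≤ D →
      (∀ s ∈ Icc 0 T, ∀ y, |u s y - u' s y| ≤ D * Real.exp (l * s) ∧
        |E s y - F s y| ≤ D * Real.exp (l * s)) →
      ∀ t ∈ Icc 0 T, ∀ x,
        |nextPotential f₀ u₁ u₂ u E t x - nextPotential f₀ u₁ u₂ u' F t x|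
          ≤ D / 2 * Real.exp (l * t) ∧
        |nextField f₀ u₁ u₂ u E t x - nextField f₀ u₁ u₂ u' F t x| ≤ D / 2 * Real.exp (l * t) := by
  obtain ⟨Λ, hΛ, hf₀⟩ := hd.exists_lipschitz
  have hQ := momentumBound_nonneg hd.const_pos.le hd.nonneg hT
  -- `k` bounds the source difference by the difference of the states: the first summand comes from
  -- `ρ`, the `1` from `u`. With the weight `e^{2kt}`, one integration turns `kD` into `kD/(2k) =
  -- D/2`; `k ≥ 1` is used for the second integration, in the potential.
  set k := 2 * momentumBound C P₀ T * (Λ * (T * Real.exp ((1 + L) * T))) + 1 with hk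
  have hk1 : 1 ≤ k := by
    have : 0 ≤ 2 * momentumBound C P₀ T * (Λ * (T * Real.exp ((1 + L) * T))) := by positivity
    linarith
  refine ⟨2 * k, by positivity, fun u E u' F hs hs' hlip D hD hdiff => ?_⟩
  have hsrc : ∀ t ∈ Icc 0 T, ∀ x,
      |waveSource f₀ u E t x - waveSource f₀ u' F t x| ≤ k * D * Real.exp (2 * k * t) := by
    intro t ht x
    have h1 := hs.abs_moment_sub_le hs' hd hΛ hf₀ hL (ε := D * Real.exp (2 * k * t))
      (by positivity) ht hlip (fun s hs y => ?_) (a := fun _ => 1) (c := 1) continuous_const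
      (by simp) x
    · have h2 := (hdiff t ht x).1
      have h3 : k * D * Real.exp (2 * k * t) = 2 * momentumBound C P₀ T * 1 *
          (Λ * (D * Real.exp (2 * k * t) * T * Real.exp ((1 + L) * T)))
          + D * Real.exp (2 * k * t) := by rw [hk]; ring
      rw [h3]
      unfold waveSource
      rw [abs_le] at *
      constructor <;> linarith
    · refine ((hdiff s ⟨hs.1, hs.2.trans ht.2⟩ y).2).trans ?_
      have := hs.2
      gcongr
  have hr : ∀ σ, ∀ t ∈ Icc 0 T, ∀ x,
      |riemann f₀ u₁ u₂ u E σ t x - riemann f₀ u₁ u₂ u' F σ t x| ≤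
        D / 2 * Real.exp (2 * k * t) := by
    intro σ t ht x
    have e : riemann f₀ u₁ u₂ u E σ t x - riemann f₀ u₁ u₂ u' F σ t x =
        lineIntegral σ (fun s y => waveSource f₀ u E s y - waveSource f₀ u' F s y) t x := by
      rw [lineIntegral_sub _ _ _ (hs.continuous_waveSource hd) (hs'.continuous_waveSource hd)]
      simp only [riemann]
      ring
    rw [e]
    refine (abs_lineIntegral_le (B := fun s => k * D * Real.exp (2 * k * s)) ht.1
      (by fun_prop) (fun s hs => hsrc s ⟨hs.1, hs.2.trans ht.2⟩ _)).trans
      ((integral_mul_exp_le (by positivity) (by positivity)).trans (le_of_eq ?_))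
    field_simp
  intro t ht x
  constructor
  · have l : Continuous fun s : ℝ => (s, x) := by fun_prop
    have c : ∀ {u E}, IsWeakState (momentumRate C P₀) u E → Continuous fun s =>
        (riemann f₀ u₁ u₂ u E 1 s x + riemann f₀ u₁ u₂ u E (-1) s x) / 2 := fun hs =>
      (((hs.continuous_riemann hd 1).comp l).add ((hs.continuous_riemann hd (-1)).comp l)).div_const 2
    simp only [nextPotential]
    rw [add_sub_add_left_eq_sub, ← intervalIntegral.integral_sub
      ((c hs).intervalIntegrable _ _) ((c hs').intervalIntegrable _ _)]
    have := intervalIntegral.norm_integral_le_of_norm_le (a := 0) (b := t) (μ := volume) ht.1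
      (f := fun s => (riemann f₀ u₁ u₂ u E 1 s x + riemann f₀ u₁ u₂ u E (-1) s x) / 2 -
        (riemann f₀ u₁ u₂ u' F 1 s x + riemann f₀ u₁ u₂ u' F (-1) s x) / 2)
      (g := fun s => D / 2 * Real.exp (2 * k * s))
      (MeasureTheory.ae_of_all _ fun s hs => by
        have h1 := hr 1 s ⟨hs.1.le, hs.2.trans ht.2⟩ x
        have h2 := hr (-1) s ⟨hs.1.le, hs.2.trans ht.2⟩ x
        rw [Real.norm_eq_abs]
        rw [abs_le] at *
        constructor <;> linarith)
      (by apply Continuous.intervalIntegrable; fun_prop)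
    refine this.trans ((integral_mul_exp_le (by positivity) (by positivity)).trans ?_)
    have h1 : D / 2 / (2 * k) ≤ D / 2 := div_le_self (by positivity) (by linarith)
    gcongr
  · have h1 := hr 1 t ht x
    have h2 := hr (-1) t ht x
    simp only [nextField]
    rw [abs_le] at *
    constructor <;> linarith

/-- The gradient of the next field depends continuously on the field. -/
theorem IsBoundedData.exists_riemannDeriv_sub_le (hd : IsBoundedData M C P₀ f₀ u₁ u₂) (hT : 0 ≤ T)
    (hL : 0 ≤ L) (hσ : |σ| = 1) :
    ∃ k, ∀ u E u' F, IsWeakState (momentumRate C P₀) u E →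
      IsWeakState (momentumRate C P₀) u' F →
      (∀ s ∈ Icc 0 T, ∀ y y', |E s y - E s y'| ≤ L * |y - y'|) → ∀ ε, 0 ≤ ε →
      (∀ s ∈ Icc 0 T, ∀ y, |E s y - F s y| ≤ ε) →
      ∀ t ∈ Icc 0 T, ∀ x,
        |riemannDeriv f₀ u₁ u₂ E σ t x - riemannDeriv f₀ u₁ u₂ F σ t x| ≤ k * ε := by
  obtain ⟨Λ, hΛ, hf₀⟩ := hd.exists_lipschitz
  have hC := hd.const_pos.le
  have hM := hd.bound_nonneg
  set Q := momentumBound C P₀ T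
  set R := momentumRate C P₀ T
  have hQ : 0 ≤ Q := momentumBound_nonneg hC hd.nonneg hT
  have hR : 0 ≤ R := momentumRate_nonneg hC hd.nonneg hT
  obtain ⟨c, hc⟩ := (isCompact_Icc (a := -Q) (b := Q)).exists_bound_of_continuousOn
    (continuous_coneWeight hσ).continuousOn
  obtain ⟨c', hc'⟩ := (isCompact_Icc (a := -Q) (b := Q)).exists_bound_of_continuousOn
    (continuous_coneWeightDeriv hσ).continuousOn
  have hc0 : 0 ≤ c := (norm_nonneg _).trans (hc 0 ⟨by linarith, hQ⟩)
  have hc0' : 0 ≤ c' := (norm_nonneg _).trans (hc' 0 ⟨by linarith, hQ⟩)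
  set κ := Λ * (T * Real.exp ((1 + L) * T)) with hκ
  have hκ0 : 0 ≤ κ := by positivity
  refine ⟨2 * (2 * Q * c * κ) + T * (R * (2 * Q * c' * κ) + 2 * Q * c' * M + 1),
    fun u E u' F hs hs' hlip ε hε hdiff t ht x => ?_⟩
  have hm : ∀ s ∈ Icc 0 T, ∀ y, |moment (coneWeight σ) (transport f₀ E) s y -
      moment (coneWeight σ) (transport f₀ F) s y| ≤ 2 * Q * c * κ * ε := by
    intro s hsT y
    refine (hs.abs_moment_sub_le hs' hd hΛ hf₀ hL hε hsT hlip
      (fun r hr y => hdiff r ⟨hr.1, hr.2.trans hsT.2⟩ y) (continuous_coneWeight hσ)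
      (fun v hv => hc v (abs_le.1 hv)) y).trans (le_of_eq ?_)
    rw [hκ]; ring
  have hm' : ∀ s ∈ Icc 0 T, ∀ y, |moment (coneWeightDeriv σ) (transport f₀ E) s y -
      moment (coneWeightDeriv σ) (transport f₀ F) s y| ≤ 2 * Q * c' * κ * ε := by
    intro s hsT y
    refine (hs.abs_moment_sub_le hs' hd hΛ hf₀ hL hε hsT hlip
      (fun r hr y => hdiff r ⟨hr.1, hr.2.trans hsT.2⟩ y) (continuous_coneWeightDeriv hσ)
      (fun v hv => hc' v (abs_le.1 hv)) y).trans (le_of_eq ?_)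
    rw [hκ]; ring
  have hb : ∀ s ∈ Icc 0 T, ∀ y,
      |moment (coneWeightDeriv σ) (transport f₀ F) s y| ≤ 2 * Q * c' * M := by
    intro s hsT y
    have hPs : momentumBound C P₀ s ≤ Q := monotoneOn_momentumBound hC hd.nonneg hsT.1 hT hsT.2
    refine (hs'.abs_transport_moment_le hd (continuous_coneWeightDeriv hσ) hsT.1 y
      fun v hv => hc' v (abs_le.1 (hv.trans hPs))).trans ?_
    gcongr
  have hE : ∀ s ∈ Icc 0 T, ∀ y, |E s y| ≤ R := by
    intro s hsT y
    have := hs.bound_E s y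
    rw [max_eq_left hsT.1] at this
    exact this.trans (momentumRate_mono hC hd.nonneg hsT.1 hsT.2)
  have cm := hs.continuous_moment hd (continuous_coneWeightDeriv hσ)
  have cm' := hs'.continuous_moment hd (continuous_coneWeightDeriv hσ)
  have hl := abs_lineIntegral_le (σ := σ) (x := x) (t := t)
    (g := fun s y => (E s y * moment (coneWeightDeriv σ) (transport f₀ E) s y + E s y) -
      (F s y * moment (coneWeightDeriv σ) (transport f₀ F) s y + F s y))
    (B := fun _ => (R * (2 * Q * c' * κ) + 2 * Q * c' * M + 1) * ε) ht.1 continuous_const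
    (fun s hst => by
      have hsT : s ∈ Icc 0 T := ⟨hst.1, hst.2.trans ht.2⟩
      -- The product is split so that `E` multiplies the moment difference and the field difference
      -- multiplies a moment with a known bound.
      have e : ∀ a b p q : ℝ, a * p + a - (b * q + b) = a * (p - q) + (a - b) * q + (a - b) := by
        intros; ring
      rw [e]
      refine (abs_add_le _ _).trans ?_
      have h1 := hdiff s hsT (x + σ * (t - s))
      have h2 := mul_le_mul (hE s hsT (x + σ * (t - s))) (hm' s hsT (x + σ * (t - s)))
        (abs_nonneg _) hR
      have h3 := mul_le_mul h1 (hb s hsT (x + σ * (t - s))) (abs_nonneg _) hε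
      rw [← abs_mul] at h2 h3
      refine (add_le_add ((abs_add_le _ _).trans (add_le_add h2 h3)) h1).trans (le_of_eq ?_)
      ring)
  rw [lineIntegral_sub (g := fun s y => E s y * moment (coneWeightDeriv σ) (transport f₀ E) s y
      + E s y) _ _ _ ((hs.lip.cont.mul cm).add hs.lip.cont)
      ((hs'.lip.cont.mul cm').add hs'.lip.cont), intervalIntegral.integral_const, sub_zero,
    smul_eq_mul] at hl
  have hl' := hl.trans (mul_le_mul_of_nonneg_right ht.2 (by positivity))
  have h5 := hm t ht x
  have h6 := hm 0 ⟨le_rfl, hT⟩ (x + σ * t)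
  have e : (2 * (2 * Q * c * κ) + T * (R * (2 * Q * c' * κ) + 2 * Q * c' * M + 1)) * ε =
    2 * Q * c * κ * ε + 2 * Q * c * κ * ε +
      T * ((R * (2 * Q * c' * κ) + 2 * Q * c' * M + 1) * ε) := by ring
  rw [e]
  unfold riemannDeriv
  rw [abs_le] at h5 h6 hl' ⊢
  constructor <;> linarith

end Contraction

/-! ### The fixed point of the iteration -/

section Iteration

open Filter Topology

variable {M C P₀ : ℝ} {f₀ : ℝ × ℝ → ℝ} {u₁ u₂ : ℝ → ℝ}

theorem continuous_of_abs_sub_le {h : ℕ → ℝ → ℝ → ℝ} {g : ℝ → ℝ → ℝ}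
    (hc : ∀ n, Continuous fun p : ℝ × ℝ => h n p.1 p.2)
    (H : ∀ T, ∃ c : ℝ, ∀ n, ∀ t ≤ T, ∀ x, |h n t x - g t x| ≤ c / 2 ^ n) :
    Continuous fun p : ℝ × ℝ => g p.1 p.2 := by
  refine continuous_of_locally_uniform_approx_of_continuousAt fun p U hU => ?_
  obtain ⟨ε, hε, hεU⟩ := Metric.mem_uniformity_dist.1 hU
  obtain ⟨c, hc'⟩ := H (p.1 + 1)
  have hlim : Tendsto (fun n : ℕ => c / 2 ^ n) atTop (𝓝 0) := by
    simpa [div_eq_mul_inv] using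
      (tendsto_pow_atTop_nhds_zero_of_lt_one (r := (1 / 2 : ℝ)) (by norm_num) (by norm_num)).const_mul c
  obtain ⟨n, hn⟩ := (hlim.eventually_lt_const hε).exists
  have hnhds : {q : ℝ × ℝ | q.1 < p.1 + 1} ∈ 𝓝 p :=
    continuous_fst.continuousAt.eventually_lt continuousAt_const (by simp)
  refine ⟨_, hnhds, fun q => h n q.1 q.2, (hc n).continuousAt, fun q hq => hεU ?_⟩
  rw [dist_comm, Real.dist_eq]
  exact (hc' n q.1 (le_of_lt hq) q.2).trans_lt hn

/-- The Picard iteration for the potential, the field and the gradient of the field. -/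
noncomputable def picardSeq (f₀ : ℝ × ℝ → ℝ) (u₁ u₂ : ℝ → ℝ) :
    ℕ → (ℝ → ℝ → ℝ) × (ℝ → ℝ → ℝ) × (ℝ → ℝ → ℝ)
  | 0 => (fun _ _ => 0, fun _ _ => 0, fun _ _ => 0)
  | n + 1 =>
    let p := picardSeq f₀ u₁ u₂ n
    (clampTime (nextPotential f₀ u₁ u₂ p.1 p.2.1), clampTime (nextField f₀ u₁ u₂ p.1 p.2.1),
      clampTime (nextFieldDeriv f₀ u₁ u₂ p.2.1))

namespace IsBoundedData

theorem isState_picardSeq (hd : IsBoundedData M C P₀ f₀ u₁ u₂) (n : ℕ) :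
    IsState (momentumRate C P₀) (picardSeq f₀ u₁ u₂ n).1 (picardSeq f₀ u₁ u₂ n).2.1
      (picardSeq f₀ u₁ u₂ n).2.2 := by
  induction n with
  | zero =>
    have hb : ∀ t x : ℝ, |(0 : ℝ)| ≤ momentumRate C P₀ (max t 0) := fun t _ => by
      rw [abs_zero]
      exact momentumRate_nonneg hd.const_pos.le hd.nonneg (le_max_right _ _)
    exact ⟨⟨continuous_const, ⟨continuous_const, fun T => ⟨0, le_rfl, by simp [picardSeq]⟩⟩, hb, hb⟩,
      continuous_const, fun t x => hasDerivAt_const _ _, fun t x => hasDerivAt_const _ _⟩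
  | succ n ih => exact ih.next hd

/-- Independence of `n` is the purpose: `exists_riemannDeriv_bound` uses the bounds of a weak state,
and no Lipschitz constant of the previous field. -/
theorem exists_picardSeq_lip (hd : IsBoundedData M C P₀ f₀ u₁ u₂) (T : ℝ) :
    ∃ L, 0 ≤ L ∧ ∀ n, ∀ t ≤ T, ∀ x y,
      |(picardSeq f₀ u₁ u₂ n).2.1 t x - (picardSeq f₀ u₁ u₂ n).2.1 t y| ≤ L * |x - y| := by
  obtain ⟨L, hL, h⟩ := hd.exists_riemannDeriv_bound (σ := 1) (by simp) (max T 0)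
  obtain ⟨L', hL', h'⟩ := hd.exists_riemannDeriv_bound (σ := -1) (by simp) (max T 0)
  refine ⟨L + L', by positivity, fun n t ht x y => ?_⟩
  have hs := hd.isState_picardSeq n
  refine Convex.norm_image_sub_le_of_norm_hasDerivWithin_le
    (f := (picardSeq f₀ u₁ u₂ n).2.1 t) (f' := (picardSeq f₀ u₁ u₂ n).2.2 t) (C := L + L')
    (s := univ) (x := y) (y := x) (fun z _ => (hs.deriv_E t z).hasDerivWithinAt) (fun z _ => ?_)
    convex_univ (mem_univ _) (mem_univ _)
  cases n with
  | zero => simp only [picardSeq, norm_zero]; positivity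
  | succ n =>
    have hn := hd.isState_picardSeq n
    have hm : max t 0 ∈ Icc 0 (max T 0) := ⟨le_max_right _ _, max_le_max ht le_rfl⟩
    have k := h _ _ hn.toIsWeakState _ hm z
    have k' := h' _ _ hn.toIsWeakState _ hm z
    simp only [picardSeq, clampTime, nextFieldDeriv, Real.norm_eq_abs]
    rw [abs_le] at *
    constructor <;> linarith

/-- All iterates are frozen at negative times, which reduces estimates for `t ≤ T` to `t ∈ [0, max T
0]`. -/
theorem picardSeq_max (f₀ : ℝ × ℝ → ℝ) (u₁ u₂ : ℝ → ℝ) (n : ℕ) (t x : ℝ) :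
    (picardSeq f₀ u₁ u₂ n).1 t x = (picardSeq f₀ u₁ u₂ n).1 (max t 0) x ∧
      (picardSeq f₀ u₁ u₂ n).2.1 t x = (picardSeq f₀ u₁ u₂ n).2.1 (max t 0) x := by
  cases n <;> simp [picardSeq, clampTime]

/-- The contraction iterated from the trivial bound `momentumRate` on the first difference. The
shape `c / 2 / 2 ^ n` is that of the geometric Cauchy criterion used next. -/
theorem exists_picardSeq_sub_le (hd : IsBoundedData M C P₀ f₀ u₁ u₂) (T : ℝ) :
    ∃ c, ∀ n, ∀ t ≤ T, ∀ x,
      |(picardSeq f₀ u₁ u₂ n).1 t x - (picardSeq f₀ u₁ u₂ (n + 1)).1 t x| ≤ c / 2 / 2 ^ n ∧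
      |(picardSeq f₀ u₁ u₂ n).2.1 t x - (picardSeq f₀ u₁ u₂ (n + 1)).2.1 t x| ≤ c / 2 / 2 ^ n := by
  set S := max T 0 with hS
  have hS0 : 0 ≤ S := le_max_right _ _
  obtain ⟨L, hL, hlip⟩ := hd.exists_picardSeq_lip S
  obtain ⟨l, hl, hcon⟩ := hd.exists_contraction hS0 hL
  set D := momentumRate C P₀ S with hD
  have hD0 : 0 ≤ D := momentumRate_nonneg hd.const_pos.le hd.nonneg hS0
  have key : ∀ n, ∀ t ∈ Icc 0 S, ∀ x,
      |(picardSeq f₀ u₁ u₂ n).1 t x - (picardSeq f₀ u₁ u₂ (n + 1)).1 t x|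
        ≤ D / 2 ^ n * Real.exp (l * t) ∧
      |(picardSeq f₀ u₁ u₂ n).2.1 t x - (picardSeq f₀ u₁ u₂ (n + 1)).2.1 t x|
        ≤ D / 2 ^ n * Real.exp (l * t) := by
    intro n
    induction n with
    | zero =>
      intro t ht x
      have h1 := hd.isState_picardSeq 1
      have hR : momentumRate C P₀ (max t 0) ≤ D * Real.exp (l * t) := by
        rw [max_eq_left ht.1]
        refine (momentumRate_mono hd.const_pos.le hd.nonneg ht.1 ht.2).trans ?_
        exact le_mul_of_one_le_right hD0 (Real.one_le_exp (mul_nonneg hl.le ht.1))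
      have e : picardSeq f₀ u₁ u₂ 0 = (fun _ _ => 0, fun _ _ => 0, fun _ _ => 0) := rfl
      rw [e]
      simp only [zero_sub, abs_neg, pow_zero, div_one, zero_add]
      exact ⟨(h1.bound_u t x).trans hR, (h1.bound_E t x).trans hR⟩
    | succ n ih =>
      intro t ht x
      have := hcon _ _ _ _ (hd.isState_picardSeq n).toIsWeakState
        (hd.isState_picardSeq (n + 1)).toIsWeakState (fun s hs y y' => hlip n s hs.2 y y')
        (D / 2 ^ n) (by positivity) ih t ht x
      have e : D / 2 ^ n / 2 = D / 2 ^ (n + 1) := by rw [pow_succ]; field_simp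
      rw [e] at this
      conv_lhs => simp only [picardSeq, clampTime_of_nonneg ht.1]
      simp only [picardSeq, clampTime_of_nonneg ht.1] at this ⊢
      exact this
  refine ⟨2 * (D * Real.exp (l * S)), fun n t ht x => ?_⟩
  have hm : max t 0 ∈ Icc 0 S := ⟨le_max_right _ _, max_le_max ht le_rfl⟩
  have hb : D / 2 ^ n * Real.exp (l * max t 0) ≤ 2 * (D * Real.exp (l * S)) / 2 / 2 ^ n := by
    have e : 2 * (D * Real.exp (l * S)) / 2 / 2 ^ n = D / 2 ^ n * Real.exp (l * S) := by field_simp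
    rw [e]
    have := hm.2
    gcongr
  rw [(picardSeq_max f₀ u₁ u₂ n t x).1, (picardSeq_max f₀ u₁ u₂ n t x).2,
    (picardSeq_max f₀ u₁ u₂ (n + 1) t x).1, (picardSeq_max f₀ u₁ u₂ (n + 1) t x).2]
  exact ⟨(key n _ hm x).1.trans hb, (key n _ hm x).2.trans hb⟩

theorem exists_limit (hd : IsBoundedData M C P₀ f₀ u₁ u₂) :
    ∃ u E : ℝ → ℝ → ℝ, ∀ T, ∃ c, 0 ≤ c ∧ ∀ n, ∀ t ≤ T, ∀ x,
      |(picardSeq f₀ u₁ u₂ n).1 t x - u t x| ≤ c / 2 ^ n ∧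
      |(picardSeq f₀ u₁ u₂ n).2.1 t x - E t x| ≤ c / 2 ^ n := by
  have hu : ∀ t x, ∃ a, Tendsto (fun n => (picardSeq f₀ u₁ u₂ n).1 t x) atTop (𝓝 a) := by
    intro t x
    obtain ⟨c, hc⟩ := hd.exists_picardSeq_sub_le t
    exact cauchySeq_tendsto_of_complete
      (cauchySeq_of_le_geometric_two (C := c) fun n => (hc n t le_rfl x).1)
  have hE : ∀ t x, ∃ a, Tendsto (fun n => (picardSeq f₀ u₁ u₂ n).2.1 t x) atTop (𝓝 a) := by
    intro t x
    obtain ⟨c, hc⟩ := hd.exists_picardSeq_sub_le t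
    exact cauchySeq_tendsto_of_complete
      (cauchySeq_of_le_geometric_two (C := c) fun n => (hc n t le_rfl x).2)
  choose u hu using hu
  choose E hE using hE
  refine ⟨u, E, fun T => ?_⟩
  obtain ⟨c, hc⟩ := hd.exists_picardSeq_sub_le T
  refine ⟨c, ?_, fun n t ht x => ⟨?_, ?_⟩⟩
  · have := (abs_nonneg _).trans (hc 0 T le_rfl 0).1
    have : 0 ≤ c / 2 := by simpa using this
    linarith
  · exact dist_le_of_le_geometric_two_of_tendsto (fun n => (hc n t ht x).1) (hu t x) n
  · exact dist_le_of_le_geometric_two_of_tendsto (fun n => (hc n t ht x).2) (hE t x) n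

theorem _root_.tendsto_of_abs_sub_le {h : ℕ → ℝ} {a c : ℝ} (H : ∀ n, |h n - a| ≤ c / 2 ^ n) :
    Tendsto h atTop (𝓝 a) := by
  have hlim : Tendsto (fun n : ℕ => c / 2 ^ n) atTop (𝓝 0) := by
    simpa [div_eq_mul_inv] using
      (tendsto_pow_atTop_nhds_zero_of_lt_one (r := (1 / 2 : ℝ)) (by norm_num) (by norm_num)).const_mul c
  exact tendsto_iff_dist_tendsto_zero.2 (squeeze_zero (fun _ => dist_nonneg) H hlim)

theorem _root_.tendstoUniformly_of_abs_sub_le {h : ℕ → ℝ → ℝ} {a : ℝ → ℝ} {c : ℝ}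
    (H : ∀ n x, |h n x - a x| ≤ c / 2 ^ n) : TendstoUniformly h a atTop := by
  have hlim : Tendsto (fun n : ℕ => c / 2 ^ n) atTop (𝓝 0) := by
    simpa [div_eq_mul_inv] using
      (tendsto_pow_atTop_nhds_zero_of_lt_one (r := (1 / 2 : ℝ)) (by norm_num) (by norm_num)).const_mul c
  rw [Metric.tendstoUniformly_iff]
  intro ε hε
  filter_upwards [hlim.eventually_lt_const hε] with n hn x
  rw [dist_comm]
  exact (H n x).trans_lt hn

/-- The iteration has a differentiable fixed point. -/
theorem exists_fixedPoint (hd : IsBoundedData M C P₀ f₀ u₁ u₂) :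
    ∃ u E E' : ℝ → ℝ → ℝ, IsState (momentumRate C P₀) u E E' ∧
      ∀ t, 0 ≤ t → ∀ x, nextPotential f₀ u₁ u₂ u E t x = u t x ∧
        nextField f₀ u₁ u₂ u E t x = E t x := by
  obtain ⟨u, E, hlim⟩ := hd.exists_limit
  have hsn := hd.isState_picardSeq
  have hu : ∀ t x, Tendsto (fun n => (picardSeq f₀ u₁ u₂ n).1 t x) atTop (𝓝 (u t x)) := by
    intro t x
    obtain ⟨c, -, hc⟩ := hlim t
    exact tendsto_of_abs_sub_le fun n => (hc n t le_rfl x).1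
  have hE : ∀ t x, Tendsto (fun n => (picardSeq f₀ u₁ u₂ n).2.1 t x) atTop (𝓝 (E t x)) := by
    intro t x
    obtain ⟨c, -, hc⟩ := hlim t
    exact tendsto_of_abs_sub_le fun n => (hc n t le_rfl x).2
  have cE : Continuous fun p : ℝ × ℝ => E p.1 p.2 := by
    refine continuous_of_abs_sub_le (fun n => (hsn n).lip.cont) fun T => ?_
    obtain ⟨c, -, hc⟩ := hlim T
    exact ⟨c, fun n t ht x => (hc n t ht x).2⟩
  have cu : Continuous fun p : ℝ × ℝ => u p.1 p.2 := by
    refine continuous_of_abs_sub_le (fun n => (hsn n).cont_u) fun T => ?_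
    obtain ⟨c, -, hc⟩ := hlim T
    exact ⟨c, fun n t ht x => (hc n t ht x).1⟩
  -- The uniform Lipschitz constant and the bounds survive pointwise limits; differentiability of
  -- the field is not yet available.
  have hw : IsWeakState (momentumRate C P₀) u E := by
    refine ⟨cu, ⟨cE, fun T => ?_⟩, fun t x => ?_, fun t x => ?_⟩
    · obtain ⟨L, hL, h⟩ := hd.exists_picardSeq_lip T
      exact ⟨L, hL, fun t ht x y => le_of_tendsto' ((hE t x).sub (hE t y)).abs
        fun n => h n t ht.2 x y⟩
    · exact le_of_tendsto' (hu t x).abs fun n => (hsn n).bound_u t x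
    · exact le_of_tendsto' (hE t x).abs fun n => (hsn n).bound_E t x
  have hfix : ∀ t, 0 ≤ t → ∀ x, nextPotential f₀ u₁ u₂ u E t x = u t x ∧
      nextField f₀ u₁ u₂ u E t x = E t x := by
    intro t ht x
    obtain ⟨L, hL, hlip⟩ := hd.exists_picardSeq_lip t
    obtain ⟨l, hl, hcon⟩ := hd.exists_contraction ht hL
    obtain ⟨c, hc0, hc⟩ := hlim t
    -- The contraction estimate compares the step from the `n`-th iterate with the step from the
    -- limit. The former is the next iterate, so it converges both to the limit and to its image.
    have key := fun n => hcon _ _ _ _ (hsn n).toIsWeakState hw (fun s hs y y' => hlip n s hs.2 y y')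
      (c / 2 ^ n) (by positivity) (fun s hs y => by
        have h1 : c / 2 ^ n ≤ c / 2 ^ n * Real.exp (l * s) :=
          le_mul_of_one_le_right (by positivity) (Real.one_le_exp (mul_nonneg hl.le hs.1))
        exact ⟨((hc n s hs.2 y).1).trans h1, ((hc n s hs.2 y).2).trans h1⟩) t ⟨ht, le_rfl⟩ x
    have e : ∀ n : ℕ, c / 2 ^ n / 2 * Real.exp (l * t) = (c / 2 * Real.exp (l * t)) / 2 ^ n := by
      intro n; field_simp
    simp only [e] at key
    have t1 := tendsto_of_abs_sub_le fun n => (key n).1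
    have t2 := tendsto_of_abs_sub_le fun n => (key n).2
    have s1 := (hu t x).comp (tendsto_add_atTop_nat 1)
    have s2 := (hE t x).comp (tendsto_add_atTop_nat 1)
    simp only [Function.comp_def, picardSeq, clampTime_of_nonneg ht] at s1 s2
    exact ⟨tendsto_nhds_unique t1 s1, tendsto_nhds_unique t2 s2⟩
  refine ⟨u, E, clampTime (nextFieldDeriv f₀ u₁ u₂ E), ⟨hw, ?_, fun t x => ?_, fun t x => ?_⟩, hfix⟩
  · exact continuous_clampTime (((hw.continuous_riemannDeriv hd (by simp)).sub
      (hw.continuous_riemannDeriv hd (by simp))).div_const 2)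
  · obtain ⟨c, -, hc⟩ := hlim t
    exact hasDerivAt_of_tendstoUniformly (f := fun n => (picardSeq f₀ u₁ u₂ n).1 t)
      (f' := fun n => (picardSeq f₀ u₁ u₂ n).2.1 t) (l := atTop)
      (tendstoUniformly_of_abs_sub_le fun n x => (hc n t le_rfl x).2)
      (Eventually.of_forall fun n x => (hsn n).deriv_u t x) (fun x => hu t x) x
  · set S := max t 0 with hS
    have hS0 : 0 ≤ S := le_max_right _ _
    obtain ⟨L, hL, hlip⟩ := hd.exists_picardSeq_lip S
    obtain ⟨c, hc0, hc⟩ := hlim S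
    obtain ⟨k₁, h₁⟩ := hd.exists_riemannDeriv_sub_le (σ := 1) hS0 hL (by simp)
    obtain ⟨k₂, h₂⟩ := hd.exists_riemannDeriv_sub_le (σ := -1) hS0 hL (by simp)
    -- The gradient of iterate `n + 1` is `nextFieldDeriv` of iterate `n`. It converges uniformly in
    -- `x` to `nextFieldDeriv` of the limit field, which therefore is its derivative.
    refine hasDerivAt_of_tendstoUniformly (f := fun n => (picardSeq f₀ u₁ u₂ (n + 1)).2.1 t)
      (f' := fun n => (picardSeq f₀ u₁ u₂ (n + 1)).2.2 t) (l := atTop)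
      (tendstoUniformly_of_abs_sub_le (c := (k₁ + k₂) * c) fun n x => ?_)
      (Eventually.of_forall fun n x => (hsn (n + 1)).deriv_E t x)
      (fun x => (hE t x).comp (tendsto_add_atTop_nat 1)) x
    have b₁ := h₁ _ _ _ _ (hsn n).toIsWeakState hw (fun s hs y y' => hlip n s hs.2 y y')
      (c / 2 ^ n) (by positivity) (fun s hs y => (hc n s hs.2 y).2) S ⟨hS0, le_rfl⟩ x
    have b₂ := h₂ _ _ _ _ (hsn n).toIsWeakState hw (fun s hs y y' => hlip n s hs.2 y y')
      (c / 2 ^ n) (by positivity) (fun s hs y => (hc n s hs.2 y).2) S ⟨hS0, le_rfl⟩ x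
    have e : (k₁ + k₂) * c / 2 ^ n = k₁ * (c / 2 ^ n) + k₂ * (c / 2 ^ n) := by ring
    rw [e]
    simp only [picardSeq, clampTime, nextFieldDeriv, ← hS]
    rw [abs_le] at *
    have d1 := abs_nonneg (riemannDeriv f₀ u₁ u₂ (picardSeq f₀ u₁ u₂ n).2.1 1 S x -
      riemannDeriv f₀ u₁ u₂ E 1 S x)
    constructor <;> linarith

end IsBoundedData

end Iteration

/-! ### The solution given by the fixed point -/

section Solution

theorem hasFDerivAt_of_partial_deriv {f f₁ f₂ : ℝ → ℝ → ℝ}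
    (h₁ : ∀ t x, HasDerivAt (fun s => f s x) (f₁ t x) t)
    (h₂ : ∀ t x, HasDerivAt (f t) (f₂ t x) x)
    (c₁ : Continuous fun p : ℝ × ℝ => f₁ p.1 p.2)
    (c₂ : Continuous fun p : ℝ × ℝ => f₂ p.1 p.2) (p : ℝ × ℝ) :
    HasFDerivAt (fun p : ℝ × ℝ => f p.1 p.2)
      (f₁ p.1 p.2 • ContinuousLinearMap.fst ℝ ℝ ℝ + f₂ p.1 p.2 • ContinuousLinearMap.snd ℝ ℝ ℝ) p := by
  have key := ((contDiff_one_of_partial_deriv h₁ h₂ c₁ c₂).differentiable one_ne_zero p).hasFDerivAt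
  refine key.congr_fderiv ?_
  have e1 : fderiv ℝ (fun p : ℝ × ℝ => f p.1 p.2) p (1, 0) = f₁ p.1 p.2 := by
    have := key.comp_hasDerivAt p.1 ((hasDerivAt_id p.1).prodMk (hasDerivAt_const p.1 p.2))
    exact this.unique (h₁ p.1 p.2)
  have e2 : fderiv ℝ (fun p : ℝ × ℝ => f p.1 p.2) p (0, 1) = f₂ p.1 p.2 := by
    have := key.comp_hasDerivAt p.2 ((hasDerivAt_const p.2 p.1).prodMk (hasDerivAt_id p.2))
    exact this.unique (h₂ p.1 p.2)
  ext
  · simpa using e1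
  · simpa using e2

theorem contDiff_two_of_partial_deriv {f f₁ f₂ : ℝ → ℝ → ℝ}
    (h₁ : ∀ t x, HasDerivAt (fun s => f s x) (f₁ t x) t)
    (h₂ : ∀ t x, HasDerivAt (f t) (f₂ t x) x)
    (c₁ : ContDiff ℝ 1 fun p : ℝ × ℝ => f₁ p.1 p.2)
    (c₂ : ContDiff ℝ 1 fun p : ℝ × ℝ => f₂ p.1 p.2) :
    ContDiff ℝ 2 fun p : ℝ × ℝ => f p.1 p.2 := by
  have key := hasFDerivAt_of_partial_deriv h₁ h₂ c₁.continuous c₂.continuous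
  rw [show (2 : WithTop ℕ∞) = 1 + 1 by norm_num, contDiff_succ_iff_fderiv]
  refine ⟨fun p => (key p).differentiableAt, by simp, ?_⟩
  rw [funext fun p => (key p).fderiv]
  exact (c₁.smul contDiff_const).add (c₂.smul contDiff_const)

theorem HasDerivAt.derivWithin_Ici {h : ℝ → ℝ} {h' t : ℝ} (hh : HasDerivAt h h' t) (ht : 0 ≤ t) :
    derivWithin h (Ici 0) t = h' :=
  hh.hasDerivWithinAt.derivWithin (uniqueDiffOn_Ici 0 t ht)

theorem iteratedDerivWithin_two_Ici {h h' : ℝ → ℝ} {h'' t : ℝ} (h₁ : ∀ s, HasDerivAt h (h' s) s)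
    (h₂ : HasDerivAt h' h'' t) (ht : 0 ≤ t) : iteratedDerivWithin 2 h (Ici 0) t = h'' := by
  rw [iteratedDerivWithin_succ, ← h₂.derivWithin_Ici ht]
  refine derivWithin_congr (fun s hs => ?_) ?_ <;>
  · rw [iteratedDerivWithin_one, (h₁ _).derivWithin_Ici]
    assumption

variable {M C P₀ : ℝ} {f₀ : ℝ × ℝ → ℝ} {u₁ u₂ : ℝ → ℝ} {u E E' : ℝ → ℝ → ℝ}

theorem IsLipField.transport_zero (hE : IsLipField E) (x v : ℝ) :
    transport f₀ E 0 x v = f₀ (x, v) := by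
  rw [transport, hE.charFlow_self]

/-- The first derivatives of the potential are half the sum and half the difference of the Riemann
invariants, whose own derivatives involve only the continuous functions `riemannDeriv` and
`waveSource`. -/
theorem IsState.contDiff_nextPotential (hs : IsState (momentumRate C P₀) u E E')
    (hd : IsBoundedData M C P₀ f₀ u₁ u₂) :
    ContDiff ℝ 2 fun p : ℝ × ℝ => nextPotential f₀ u₁ u₂ u E p.1 p.2 := by
  have c1 := hs.continuous_riemannDeriv hd (σ := 1) (by simp)
  have c2 := hs.continuous_riemannDeriv hd (σ := -1) (by simp)
  have cr : ∀ σ : ℝ, |σ| = 1 →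
      ContDiff ℝ 1 fun p : ℝ × ℝ => riemann f₀ u₁ u₂ u E σ p.1 p.2 := fun σ hσ =>
    contDiff_one_of_partial_deriv (hs.hasDerivAt_riemann_left hd hσ)
      (hs.hasDerivAt_riemann_right hd hσ)
      ((continuous_const.mul (hs.continuous_riemannDeriv hd hσ)).add (hs.continuous_waveSource hd))
      (hs.continuous_riemannDeriv hd hσ)
  exact contDiff_two_of_partial_deriv (hs.hasDerivAt_nextPotential_left hd)
    (hs.hasDerivAt_nextPotential_right hd)
    (((cr 1 (by simp)).add (cr (-1) (by simp))).div_const 2)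
    (((cr 1 (by simp)).sub (cr (-1) (by simp))).div_const 2)

/-- A fixed point of the iteration is a global classical solution. -/
theorem IsState.isGlobalVKGSolution (hs : IsState (momentumRate C P₀) u E E')
    (hd : IsBoundedData M C P₀ f₀ u₁ u₂)
    (hfix : ∀ t, 0 ≤ t → ∀ x, nextPotential f₀ u₁ u₂ u E t x = u t x ∧
      nextField f₀ u₁ u₂ u E t x = E t x) :
    IsGlobalVKGSolution f₀ u₁ u₂ (fun p => transport f₀ E p.1 p.2.1 p.2.2)
      (fun p => nextPotential f₀ u₁ u₂ u E p.1 p.2) := by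
  obtain ⟨fx, fv, cfx, cfv, hx, hv, ht, cf⟩ :=
    hs.lip.exists_transport_deriv hs.deriv_E hs.cont_E' hd.contDiff_f
  -- The solution is represented by `nextPotential`, which is `C²` across `t = 0`; it agrees with
  -- `u` for `t ≥ 0`, and `u` itself is only known to be a state.
  refine ⟨cf.contDiffOn, (hs.contDiff_nextPotential hd).contDiffOn, fun t ht0 x v => ?_,
    fun t ht0 x => ?_, fun t ht0 x => ?_, fun x v => hs.lip.transport_zero x v, fun x => ?_,
    fun x => ?_⟩
  · rw [(ht t x v).derivWithin_Ici ht0, (hx t x v).deriv,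
      (hs.hasDerivAt_nextPotential_right hd t x).deriv, (hv t x v).deriv, (hfix t ht0 x).2]
    ring
  · refine ((hs.continuous_transport hd).comp (show Continuous fun v : ℝ => (t, x, v) by
      fun_prop)).integrable_of_hasCompactSupport (HasCompactSupport.intro
        (isCompact_Icc (a := -momentumBound C P₀ t) (b := momentumBound C P₀ t)) fun v hv => ?_)
    refine hs.transport_eq_zero hd ht0 x v (not_lt.1 fun h => hv ?_)
    exact abs_le.1 h.le
  · have h2 : HasDerivAt
        (fun s => (riemann f₀ u₁ u₂ u E 1 s x + riemann f₀ u₁ u₂ u E (-1) s x) / 2)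
        (nextFieldDeriv f₀ u₁ u₂ E t x + waveSource f₀ u E t x) t := by
      refine (((hs.hasDerivAt_riemann_left hd (σ := 1) (by simp) t x).add
        (hs.hasDerivAt_riemann_left hd (σ := -1) (by simp) t x)).div_const 2).congr_deriv ?_
      rw [nextFieldDeriv]
      ring
    rw [iteratedDerivWithin_two_Ici (fun s => hs.hasDerivAt_nextPotential_left hd s x) h2 ht0,
      iteratedDeriv_succ, iteratedDeriv_one,
      funext fun y => (hs.hasDerivAt_nextPotential_right hd t y).deriv,
      (hs.hasDerivAt_nextField_right hd t x).deriv, (hfix t ht0 x).1, waveSource]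
    simp only [moment, one_mul]
    ring
  · simp [nextPotential]
  · rw [(hs.hasDerivAt_nextPotential_left hd 0 x).derivWithin_Ici le_rfl]
    simp only [riemann, lineIntegral, mul_zero, add_zero, intervalIntegral.integral_same]
    ring

theorem IsWeakState.transport_eq_zero_of_position (hs : IsWeakState (momentumRate C P₀) u E)
    (hd : IsBoundedData M C P₀ f₀ u₁ u₂) {R₀ t : ℝ}
    (hR : ∀ x v, f₀ (x, v) ≠ 0 → |x| ≤ R₀) (ht : 0 ≤ t) (x v : ℝ) (hx : R₀ + t ≤ |x|) :
    transport f₀ E t x v = 0 := by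
  refine (hs.lip.isTransported f₀ t x v).eq_zero_of_position ht (fun y w hy => ?_) hx
  by_contra hne
  -- On the boundary `|y| = R₀` the hypothesis permits `f₀ ≠ 0`. But then `f₀ ≠ 0` also slightly
  -- further out, by continuity, which it forbids.
  have hev' : ∀ᶠ r in nhds (0 : ℝ), f₀ (y + r, w) ≠ 0 :=
    (hd.contDiff_f.continuous.comp (show Continuous fun r : ℝ => (y + r, w) by
      fun_prop)).continuousAt.eventually_ne (by simpa using hne)
  obtain ⟨ε, hε, h⟩ := Metric.eventually_nhds_iff.1 hev'
  have e : |ε / 2| = ε / 2 := abs_of_pos (by positivity)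
  rcases le_total 0 y with h0 | h0
  · have := hR _ _ (h (y := ε / 2) (by rw [dist_zero_right, Real.norm_eq_abs, e]; linarith))
    rw [abs_of_nonneg (by positivity)] at this
    rw [abs_of_nonneg h0] at hy
    linarith
  · have := hR _ _ (h (y := -(ε / 2)) (by rw [dist_zero_right, norm_neg, Real.norm_eq_abs, e]; linarith))
    rw [abs_of_nonpos (by linarith)] at this
    rw [abs_of_nonpos h0] at hy
    linarith

end Solution

/-! ### Functions on a half-space -/

section HalfSpace

open Filter Topology

theorem halfSpace_mem_nhds {F : Type*} [TopologicalSpace F] {t : ℝ} (ht : 0 < t) (x : F) :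
    Ici (0 : ℝ) ×ˢ (univ : Set F) ∈ 𝓝 (t, x) :=
  prod_mem_nhds (Ici_mem_nhds ht) univ_mem

theorem ContinuousOn.comp_curve {F G : Type*} [TopologicalSpace F] [TopologicalSpace G]
    {φ : ℝ × F → G} (h : ContinuousOn φ (Ici (0 : ℝ) ×ˢ univ)) {t : ℝ} {b : ℝ → F}
    (hb : Continuous b) : ContinuousOn (fun s => φ (s, b s)) (Icc 0 t) :=
  h.comp (continuous_id.prodMk hb).continuousOn fun _ hs => ⟨hs.1, mem_univ _⟩

variable {F : Type*} [NormedAddCommGroup F] [NormedSpace ℝ F] {φ : ℝ × F → ℝ}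

theorem uniqueDiffOn_halfSpace : UniqueDiffOn ℝ (Ici (0 : ℝ) ×ˢ (univ : Set F)) :=
  (uniqueDiffOn_Ici 0).prod uniqueDiffOn_univ

theorem DifferentiableOn.hasDerivWithinAt_halfSpace
    (h : DifferentiableOn ℝ φ (Ici (0 : ℝ) ×ˢ univ)) {t : ℝ} (ht : 0 ≤ t) (x : F) :
    HasDerivWithinAt (fun s => φ (s, x)) (fderivWithin ℝ φ (Ici (0 : ℝ) ×ˢ univ) (t, x) (1, 0))
      (Ici 0) t :=
  (h (t, x) ⟨ht, mem_univ _⟩).hasFDerivWithinAt.comp_hasDerivWithinAt t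
    ((hasDerivWithinAt_id t (Ici 0)).prodMk (hasDerivWithinAt_const t (Ici 0) x))
    (show MapsTo (fun s : ℝ => (s, x)) (Ici 0) (Ici 0 ×ˢ univ) from fun _ hs => ⟨hs, mem_univ _⟩)

theorem DifferentiableOn.hasDerivAt_slice
    (h : DifferentiableOn ℝ φ (Ici (0 : ℝ) ×ˢ univ)) {t y : ℝ} (ht : 0 ≤ t) {b : ℝ → F} {b' : F}
    (hb : HasDerivAt b b' y) :
    HasDerivAt (fun y => φ (t, b y)) (fderivWithin ℝ φ (Ici (0 : ℝ) ×ˢ univ) (t, b y) (0, b')) y := by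
  rw [← hasDerivWithinAt_univ] at hb ⊢
  exact (h (t, b y) ⟨ht, mem_univ _⟩).hasFDerivWithinAt.comp_hasDerivWithinAt y
    ((hasDerivWithinAt_const y univ t).prodMk hb)
    (show MapsTo (fun y => (t, b y)) univ (Ici 0 ×ˢ univ) from fun _ _ => ⟨ht, mem_univ _⟩)

theorem DifferentiableOn.hasDerivAt_curve
    (h : DifferentiableOn ℝ φ (Ici (0 : ℝ) ×ˢ univ)) {t : ℝ} (ht : 0 < t) {b : ℝ → F} {b' : F}
    (hb : HasDerivAt b b' t) :
    HasDerivAt (fun s => φ (s, b s)) (fderivWithin ℝ φ (Ici (0 : ℝ) ×ˢ univ) (t, b t) (1, b')) t :=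
  ((h (t, b t) ⟨ht.le, mem_univ _⟩).hasFDerivWithinAt.hasFDerivAt
    (halfSpace_mem_nhds ht _)).comp_hasDerivAt t ((hasDerivAt_id t).prodMk hb)

/-- Symmetry of the second derivatives in the interior. -/
theorem ContDiffOn.fderivWithin_fderivWithin_comm (h : ContDiffOn ℝ 2 φ (Ici (0 : ℝ) ×ˢ univ))
    {t : ℝ} (ht : 0 < t) (x : F) (a b : ℝ × F) :
    fderivWithin ℝ (fun p => fderivWithin ℝ φ (Ici (0 : ℝ) ×ˢ univ) p a) (Ici (0 : ℝ) ×ˢ univ)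
        (t, x) b =
      fderivWithin ℝ (fun p => fderivWithin ℝ φ (Ici (0 : ℝ) ×ˢ univ) p b) (Ici (0 : ℝ) ×ˢ univ)
        (t, x) a := by
  have hn := halfSpace_mem_nhds (F := F) ht x
  have hs : IsSymmSndFDerivAt ℝ φ (t, x) :=
    (h.contDiffAt hn).isSymmSndFDerivAt (by simp)
  have hev : fderivWithin ℝ φ (Ici (0 : ℝ) ×ˢ univ) =ᶠ[𝓝 (t, x)] fderiv ℝ φ := by
    filter_upwards [eventually_mem_nhds_iff.2 hn] with p hp
    exact fderivWithin_of_mem_nhds hp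
  have hd : DifferentiableAt ℝ (fderiv ℝ φ) (t, x) :=
    ((h.contDiffAt hn).fderiv_right (m := 1) (by norm_num)).differentiableAt one_ne_zero
  have key : ∀ a b : ℝ × F, fderivWithin ℝ (fun p => fderivWithin ℝ φ (Ici (0 : ℝ) ×ˢ univ) p a)
      (Ici (0 : ℝ) ×ˢ univ) (t, x) b = fderiv ℝ (fderiv ℝ φ) (t, x) b a := by
    intro a b
    have hev' : (fun p => fderivWithin ℝ φ (Ici (0 : ℝ) ×ˢ univ) p a) =ᶠ[𝓝 (t, x)]
        fun p => fderiv ℝ φ p a := hev.mono fun p hp => by simp only [hp]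
    rw [fderivWithin_of_mem_nhds hn, hev'.fderiv_eq,
      (hd.hasFDerivAt.clm_apply (hasFDerivAt_const a (t, x))).fderiv]
    simp
  rw [key, key]
  exact hs b a

/-- A classical solution has two-sided time derivatives only for `t > 0`; at the ends continuity
suffices. -/
theorem sub_eq_integral_of_hasDerivAt_Ioo {h h' : ℝ → ℝ} {t : ℝ} (ht : 0 ≤ t)
    (hc : ContinuousOn h (Icc 0 t)) (hd : ∀ s ∈ Ioo 0 t, HasDerivAt h (h' s) s)
    (hc' : ContinuousOn h' (Icc 0 t)) : h t = h 0 + ∫ s in (0 : ℝ)..t, h' s := by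
  rw [intervalIntegral.integral_eq_sub_of_hasDerivAt_of_le ht hc hd
    (hc'.intervalIntegrable_of_Icc ht)]
  ring

end HalfSpace

/-! ### Representation of arbitrary solutions -/

section Representation

variable {f₀ : ℝ × ℝ → ℝ} {u₁ u₂ : ℝ → ℝ} {g : ℝ × ℝ × ℝ → ℝ} {w : ℝ × ℝ → ℝ}

/-- The force field of a potential. -/
noncomputable def fieldOf (w : ℝ × ℝ → ℝ) (t x : ℝ) : ℝ := deriv (fun y => w (t, y)) x

/-- The time derivative of a potential. -/
noncomputable def speedOf (w : ℝ × ℝ → ℝ) (p : ℝ × ℝ) : ℝ :=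
  fderivWithin ℝ w (Ici (0 : ℝ) ×ˢ univ) p (1, 0)

theorem DifferentiableOn.fderivWithin_eq_fieldOf (h : DifferentiableOn ℝ w (Ici (0 : ℝ) ×ˢ univ))
    {p : ℝ × ℝ} (hp : p ∈ Ici (0 : ℝ) ×ˢ univ) :
    fderivWithin ℝ w (Ici (0 : ℝ) ×ˢ univ) p (0, 1) = fieldOf w p.1 p.2 :=
  ((h.hasDerivAt_slice hp.1 (hasDerivAt_id p.2)).deriv).symm

theorem ContDiffOn.fieldOf (h : ContDiffOn ℝ 2 w (Ici (0 : ℝ) ×ˢ univ)) :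
    ContDiffOn ℝ 1 (fun p : ℝ × ℝ => fieldOf w p.1 p.2) (Ici (0 : ℝ) ×ˢ univ) := by
  have hd := h.fderivWithin (m := 1) uniqueDiffOn_halfSpace (by norm_num)
  exact (hd.clm_apply contDiffOn_const).congr fun p hp =>
    ((h.differentiableOn (by norm_num)).fderivWithin_eq_fieldOf hp).symm

theorem ContDiffOn.speedOf (h : ContDiffOn ℝ 2 w (Ici (0 : ℝ) ×ˢ univ)) :
    ContDiffOn ℝ 1 (speedOf w) (Ici (0 : ℝ) ×ˢ univ) :=
  (h.fderivWithin (m := 1) uniqueDiffOn_halfSpace (by norm_num)).clm_apply contDiffOn_const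

namespace IsGlobalVKGSolution

/-- The source of the wave equation. -/
theorem source_eq (h : IsGlobalVKGSolution f₀ u₁ u₂ g w) {t : ℝ} (ht : 0 ≤ t) (x : ℝ) :
    fderivWithin ℝ (speedOf w) (Ici (0 : ℝ) ×ˢ univ) (t, x) (1, 0)
      - fderivWithin ℝ (fun p : ℝ × ℝ => fieldOf w p.1 p.2) (Ici (0 : ℝ) ×ˢ univ) (t, x) (0, 1)
      = -(∫ v, g (t, x, v)) - w (t, x) := by
  have hw := h.contDiffOn_u.differentiableOn (by norm_num)
  have h1 := h.kleinGordon t ht x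
  have e1 : iteratedDerivWithin 2 (fun s => w (s, x)) (Ici 0) t =
      fderivWithin ℝ (speedOf w) (Ici (0 : ℝ) ×ˢ univ) (t, x) (1, 0) := by
    rw [iteratedDerivWithin_succ]
    have hs := (h.contDiffOn_u.speedOf.differentiableOn one_ne_zero).hasDerivWithinAt_halfSpace ht x
    rw [← hs.derivWithin (uniqueDiffOn_Ici 0 t ht)]
    refine derivWithin_congr (fun s hs => ?_) ?_ <;>
    · rw [iteratedDerivWithin_one]
      exact (hw.hasDerivWithinAt_halfSpace (by assumption) x).derivWithin
        (uniqueDiffOn_Ici 0 _ (by assumption))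
  have e2 : iteratedDeriv 2 (fun y => w (t, y)) x =
      fderivWithin ℝ (fun p : ℝ × ℝ => fieldOf w p.1 p.2) (Ici (0 : ℝ) ×ˢ univ) (t, x) (0, 1) := by
    rw [iteratedDeriv_succ, iteratedDeriv_one]
    exact ((h.contDiffOn_u.fieldOf.differentiableOn one_ne_zero).hasDerivAt_slice ht
      (hasDerivAt_id x)).deriv
  rw [e1, e2] at h1
  linarith

/-- The definition of a solution asks only that `f(t, x, ·)` be integrable, which does not by itself
make `ρ` continuous. The Klein–Gordon equation does, expressing the source by second derivatives of
the potential. -/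
theorem continuousOn_source (h : IsGlobalVKGSolution f₀ u₁ u₂ g w) :
    ContinuousOn (fun p : ℝ × ℝ => -(∫ v, g (p.1, p.2, v)) - w p) (Ici (0 : ℝ) ×ˢ univ) := by
  have c : ∀ {φ : ℝ × ℝ → ℝ}, ContDiffOn ℝ 1 φ (Ici (0 : ℝ) ×ˢ univ) → ∀ a,
      ContinuousOn (fun p => fderivWithin ℝ φ (Ici (0 : ℝ) ×ˢ univ) p a) (Ici (0 : ℝ) ×ˢ univ) :=
    fun hφ a => (hφ.continuousOn_fderivWithin uniqueDiffOn_halfSpace le_rfl).clm_apply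
      continuousOn_const
  exact ((c h.contDiffOn_u.speedOf (1, 0)).sub (c h.contDiffOn_u.fieldOf (0, 1))).congr
    fun p hp => (h.source_eq hp.1 p.2).symm

/-- The Riemann invariants are obtained by integrating the source along the characteristic lines of
the wave operator. -/
theorem riemann_eq (h : IsGlobalVKGSolution f₀ u₁ u₂ g w) {σ : ℝ} (hσ : σ ^ 2 = 1) {t : ℝ}
    (ht : 0 ≤ t) (x : ℝ) :
    speedOf w (t, x) + σ * fieldOf w t x =
      u₂ (x + σ * t) + σ * deriv u₁ (x + σ * t) +
        lineIntegral σ (fun s y => -(∫ v, g (s, y, v)) - w (s, y)) t x := by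
  have hw := h.contDiffOn_u.differentiableOn (by norm_num)
  have dV := h.contDiffOn_u.speedOf.differentiableOn one_ne_zero
  have dE := h.contDiffOn_u.fieldOf.differentiableOn one_ne_zero
  have cb : Continuous fun s : ℝ => x + σ * (t - s) := by fun_prop
  have key := sub_eq_integral_of_hasDerivAt_Ioo
    (h := fun s => speedOf w (s, x + σ * (t - s)) + σ * fieldOf w s (x + σ * (t - s)))
    (h' := fun s => -(∫ v, g (s, x + σ * (t - s), v)) - w (s, x + σ * (t - s))) ht
    ((h.contDiffOn_u.speedOf.continuousOn.comp_curve cb).add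
      (continuousOn_const.mul (h.contDiffOn_u.fieldOf.continuousOn.comp_curve cb)))
    (fun s hs => ?_) (h.continuousOn_source.comp_curve cb)
  · have e1 : speedOf w (0, x + σ * t) = u₂ (x + σ * t) := by
      rw [← h.init_dtu]
      exact ((hw.hasDerivWithinAt_halfSpace le_rfl _).derivWithin
        (uniqueDiffOn_Ici 0 0 self_mem_Ici)).symm
    have e2 : fieldOf w 0 (x + σ * t) = deriv u₁ (x + σ * t) := by
      simp only [fieldOf, h.init_u]
    simp only [sub_self, mul_zero, add_zero, sub_zero, e1, e2] at key
    exact key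
  · have hb : HasDerivAt (fun s : ℝ => x + σ * (t - s)) (-σ) s := by
      simpa using (((hasDerivAt_id s).const_sub t).const_mul σ).const_add x
    refine ((dV.hasDerivAt_curve hs.1 hb).add
      ((dE.hasDerivAt_curve hs.1 hb).const_mul σ)).congr_deriv ?_
    set y := x + σ * (t - s)
    -- Equality of mixed derivatives cancels the cross terms of `(∂ₜ - σ∂ₓ)(∂ₜ + σ∂ₓ)`, and `σ² = 1`
    -- then leaves the wave operator.
    have hsym : fderivWithin ℝ (fun p : ℝ × ℝ => fieldOf w p.1 p.2) (Ici (0 : ℝ) ×ˢ univ)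
        (s, y) (1, 0) = fderivWithin ℝ (speedOf w) (Ici (0 : ℝ) ×ˢ univ) (s, y) (0, 1) := by
      rw [← fderivWithin_congr (fun p hp => hw.fderivWithin_eq_fieldOf hp)
        (hw.fderivWithin_eq_fieldOf (p := (s, y)) ⟨hs.1.le, mem_univ _⟩)]
      exact h.contDiffOn_u.fderivWithin_fderivWithin_comm hs.1 y _ _
    have hsplit : ((1, -σ) : ℝ × ℝ) = (1, 0) + (-σ) • (0, 1) := by simp
    rw [← h.source_eq hs.1.le, hsplit, map_add, map_smul, map_add, map_smul, hsym, smul_eq_mul,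
      smul_eq_mul]
    linear_combination (-fderivWithin ℝ (fun p : ℝ × ℝ => fieldOf w p.1 p.2)
      (Ici (0 : ℝ) ×ˢ univ) (s, y) (0, 1)) * hσ

theorem potential_eq (h : IsGlobalVKGSolution f₀ u₁ u₂ g w) {t : ℝ} (ht : 0 ≤ t) (x : ℝ) :
    w (t, x) = u₁ x + ∫ s in (0 : ℝ)..t, speedOf w (s, x) := by
  rw [← h.init_u x]
  exact sub_eq_integral_of_hasDerivAt_Ioo (h := fun s => w (s, x)) ht
    (h.contDiffOn_u.continuousOn.comp_curve continuous_const)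
    (fun s hs => (h.contDiffOn_u.differentiableOn (by norm_num)).hasDerivAt_curve hs.1
      (hasDerivAt_const s x))
    (h.contDiffOn_u.speedOf.continuousOn.comp_curve continuous_const)

/-- The density is constant along the characteristics of the field. -/
theorem isTransported (h : IsGlobalVKGSolution f₀ u₁ u₂ g w) {E : ℝ → ℝ → ℝ} (hE : IsLipField E)
    {t x : ℝ} (ht : 0 ≤ t) (hEw : ∀ s ∈ Icc 0 t, ∀ y, |y - x| ≤ t - s → E s y = fieldOf w s y)
    (v : ℝ) : IsTransported f₀ E (fun t x v => g (t, x, v)) t x v := by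
  have hc : IsCharOn E t (charFlow E t (x, v)) := fun s _ => hE.hasDerivAt_charFlow _ _ s
  refine ⟨charFlow E t (x, v), hE.charFlow_self _ _, hc, ?_⟩
  -- The characteristic of `E` stays in the backward cone of `(t, x)`, where `E` is the true field.
  have hx := fun s hs => hc.abs_fst_sub_le (s := s) hs
  have ht' := hE.charFlow_self t (x, v)
  rw [ht'] at hx
  generalize charFlow E t (x, v) = γ at *
  have cγ : ContinuousOn γ (Icc 0 t) := fun s hs => (hc s hs).continuousAt.continuousWithinAt
  have dg := h.contDiffOn_f.differentiableOn one_ne_zero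
  have key := sub_eq_integral_of_hasDerivAt_Ioo (h := fun s => g (s, γ s)) (h' := fun _ => 0) ht
    (h.contDiffOn_f.continuousOn.comp (continuousOn_id.prodMk cγ) fun s hs => ⟨hs.1, mem_univ _⟩)
    (fun s hs => ?_) continuousOn_const
  · have e0 := h.init_f (γ 0).1 (γ 0).2
    simp only [ht', intervalIntegral.integral_zero, add_zero] at key
    exact key.trans e0
  · have hs' : s ∈ Icc 0 t := ⟨hs.1.le, hs.2.le⟩
    have hv := h.vlasov s hs.1.le (γ s).1 (γ s).2
    have d1 := (dg.hasDerivWithinAt_halfSpace hs.1.le ((γ s).1, (γ s).2)).derivWithin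
      (uniqueDiffOn_Ici 0 s hs.1.le)
    have d2 := (dg.hasDerivAt_slice hs.1.le ((hasDerivAt_id (γ s).1).prodMk
      (hasDerivAt_const (γ s).1 (γ s).2))).deriv
    have d3 := (dg.hasDerivAt_slice hs.1.le ((hasDerivAt_const (γ s).2 (γ s).1).prodMk
      (hasDerivAt_id (γ s).2))).deriv
    simp only [id] at d2 d3
    rw [d1, d2, d3] at hv
    refine (dg.hasDerivAt_curve hs.1 (hc s hs')).congr_deriv ?_
    -- In this decomposition of the velocity of the curve in space-time, the derivative of the
    -- density is the left side of the Vlasov equation.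
    have hsplit : ((1, charField E s (γ s)) : ℝ × ℝ × ℝ) =
        (1, 0) + relVelocity (γ s).2 • (0, (1, 0)) - fieldOf w s (γ s).1 • (0, (0, 1)) := by
      simp [charField, hEw s hs' _ (hx s hs')]
    rw [hsplit, map_sub, map_add, map_smul, map_smul, smul_eq_mul, smul_eq_mul]
    exact hv

end IsGlobalVKGSolution

end Representation

/-! ### Uniqueness -/

section Uniqueness

open Filter Topology

variable {M C P₀ : ℝ} {f₀ : ℝ × ℝ → ℝ} {u₁ u₂ : ℝ → ℝ} {f g : ℝ × ℝ × ℝ → ℝ} {u w : ℝ × ℝ → ℝ}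

/-- The gain `1 / l` from integrating the weight `e^{ls}` is the source of the contraction. -/
theorem abs_integral_sub_integral_le {p q : ℝ → ℝ} {c l t : ℝ} (ht : 0 ≤ t)
    (hp : ContinuousOn p (Icc 0 t)) (hq : ContinuousOn q (Icc 0 t)) (hc : 0 ≤ c) (hl : 0 < l)
    (h : ∀ s ∈ Icc 0 t, |p s - q s| ≤ c * Real.exp (l * s)) :
    |(∫ s in (0 : ℝ)..t, p s) - ∫ s in (0 : ℝ)..t, q s| ≤ c / l * Real.exp (l * t) := by
  rw [← intervalIntegral.integral_sub (hp.intervalIntegrable_of_Icc ht)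
    (hq.intervalIntegrable_of_Icc ht)]
  refine (intervalIntegral.norm_integral_le_of_norm_le (f := fun s => p s - q s)
    (g := fun s => c * Real.exp (l * s)) ht
    (ae_of_all _ fun s hs => h s ⟨hs.1.le, hs.2⟩) ?_).trans (integral_mul_exp_le hc hl)
  apply Continuous.intervalIntegrable
  fun_prop

theorem clamp_mem_Icc {R : ℝ} (hR : 0 ≤ R) (t : ℝ) : max 0 (min R t) ∈ Icc 0 R :=
  ⟨le_max_left _ _, max_le hR (min_le_left _ _)⟩

namespace IsGlobalVKGSolution

/-- The density of a solution is, on a compact light cone, transported by a field that is Lipschitz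
in space. -/
theorem exists_isLipField (h : IsGlobalVKGSolution f₀ u₁ u₂ g w) {Q₀ R : ℝ} (hQ₀ : 0 ≤ Q₀)
    (hf₀ : ∀ x v, Q₀ ≤ |v| → f₀ (x, v) = 0) (hR : 0 ≤ R) :
    ∃ (E : ℝ → ℝ → ℝ) (L Q : ℝ), 0 ≤ L ∧ 0 ≤ Q ∧
      (∀ s y y', |E s y - E s y'| ≤ L * |y - y'|) ∧
      (∀ s ∈ Icc 0 R, ∀ y, |y| ≤ R → E s y = fieldOf w s y) ∧
      ∀ t ∈ Icc 0 R, ∀ x, |x| ≤ R - t → ∀ v,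
        IsTransported f₀ E (fun t x v => g (t, x, v)) t x v ∧ (Q ≤ |v| → g (t, x, v) = 0) := by
  have hE := h.contDiffOn_u.fieldOf
  have hsub : Icc 0 R ×ˢ Icc (-R) R ⊆ Ici (0 : ℝ) ×ˢ univ := fun p hp => ⟨hp.1.1, mem_univ _⟩
  have hK := (isCompact_Icc (a := 0) (b := R)).prod (isCompact_Icc (a := -R) (b := R))
  obtain ⟨K, hKb⟩ := hK.exists_bound_of_continuousOn (hE.continuousOn.mono hsub)
  obtain ⟨L, hLb⟩ := hK.exists_bound_of_continuousOn
    (((hE.continuousOn_fderivWithin uniqueDiffOn_halfSpace le_rfl).clm_apply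
      (continuousOn_const (c := ((0, 1) : ℝ × ℝ)))).mono hsub)
  have h0 : ((0, 0) : ℝ × ℝ) ∈ Icc 0 R ×ˢ Icc (-R) R :=
    ⟨⟨le_rfl, hR⟩, ⟨neg_nonpos.2 hR, hR⟩⟩
  have hK0 : 0 ≤ K := (norm_nonneg _).trans (hKb _ h0)
  have hL0 : 0 ≤ L := (norm_nonneg _).trans (hLb _ h0)
  -- An arbitrary solution has no known global bounds. Freezing its field outside the box `[0, R] ×
  -- [-R, R]` gives a bounded, globally Lipschitz field that is unchanged on the cone `|x| ≤ R - t`.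
  set E : ℝ → ℝ → ℝ := fun t x => fieldOf w (max 0 (min R t)) (max (-R) (min R x)) with hEdef
  have hlip : ∀ s y y', |E s y - E s y'| ≤ L * |y - y'| := by
    intro s y y'
    have hs := clamp_mem_Icc hR s
    refine (Convex.norm_image_sub_le_of_norm_hasDerivWithin_le
      (f := fieldOf w (max 0 (min R s))) (s := Icc (-R) R) (C := L)
      (fun z _ => ((hE.differentiableOn one_ne_zero).hasDerivAt_slice hs.1
        (hasDerivAt_id z)).hasDerivWithinAt)
      (fun z hz => hLb (_, z) ⟨hs, hz⟩) (convex_Icc _ _) (abs_le.1 (abs_clamp_le hR y'))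
      (abs_le.1 (abs_clamp_le hR y))).trans ?_
    exact mul_le_mul_of_nonneg_left (abs_clamp_sub_clamp_le _ _ _) hL0
  have hLip : IsLipField E := by
    refine ⟨?_, fun T => ⟨L, hL0, fun t _ => hlip t⟩⟩
    exact hE.continuousOn.comp_continuous (f := fun p : ℝ × ℝ =>
      (max 0 (min R p.1), max (-R) (min R p.2))) (by fun_prop)
      fun p => ⟨(clamp_mem_Icc hR p.1).1, mem_univ _⟩
  have heq : ∀ s ∈ Icc 0 R, ∀ y, |y| ≤ R → E s y = fieldOf w s y := by
    intro s hs y hy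
    simp only [hEdef]
    rw [clamp_eq_self hy, min_eq_right hs.2, max_eq_right hs.1]
  have htr : ∀ t ∈ Icc 0 R, ∀ x, |x| ≤ R - t → ∀ v,
      IsTransported f₀ E (fun t x v => g (t, x, v)) t x v := fun t ht x hx v =>
    h.isTransported hLip ht.1 (fun s hs y hy => heq s ⟨hs.1, hs.2.trans ht.2⟩ y (by
      have := abs_sub_abs_le_abs_sub y x
      linarith [hs.1])) v
  refine ⟨E, L, Q₀ + K * R, hL0, by positivity, hlip, heq,
    fun t ht x hx v => ⟨htr t ht x hx v, fun hv => ?_⟩⟩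
  refine (htr t ht x hx v).eq_zero_of_velocity ht.1 (B := fun s => Q₀ + K * s) (B' := fun _ => K)
    (fun s => by simpa using ((hasDerivAt_id s).const_mul K).const_add Q₀)
    (fun s _ y _ => hKb (_, _) ⟨clamp_mem_Icc hR s, abs_le.1 (abs_clamp_le hR y)⟩)
    (by simpa using hf₀) (le_trans ?_ hv)
  have := mul_le_mul_of_nonneg_left ht.2 hK0
  linarith

theorem continuous_velocity (h : IsGlobalVKGSolution f₀ u₁ u₂ g w) {t : ℝ} (ht : 0 ≤ t) (x : ℝ) :
    Continuous fun v => g (t, x, v) :=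
  h.contDiffOn_f.continuousOn.comp_continuous (by fun_prop) fun _ => ⟨ht, mem_univ _⟩

/-- The difference of two solutions contracts on a light cone. -/
theorem exists_contraction (h : IsGlobalVKGSolution f₀ u₁ u₂ g w)
    (h' : IsGlobalVKGSolution f₀ u₁ u₂ f u) (hd : IsBoundedData M C P₀ f₀ u₁ u₂) {R : ℝ}
    (hR : 0 ≤ R) :
    ∃ l, 0 < l ∧ ∀ D, 0 ≤ D →
      (∀ t ∈ Icc 0 R, ∀ x, |x| ≤ R - t → |w (t, x) - u (t, x)| ≤ D * Real.exp (l * t) ∧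
        |fieldOf w t x - fieldOf u t x| ≤ D * Real.exp (l * t)) →
      ∀ t ∈ Icc 0 R, ∀ x, |x| ≤ R - t → |w (t, x) - u (t, x)| ≤ D / 2 * Real.exp (l * t) ∧
        |fieldOf w t x - fieldOf u t x| ≤ D / 2 * Real.exp (l * t) := by
  obtain ⟨Λ, hΛ, hf₀⟩ := hd.exists_lipschitz
  have hQ₀ : 0 ≤ momentumBound C P₀ 0 := momentumBound_nonneg hd.const_pos.le hd.nonneg le_rfl
  obtain ⟨E, L, Q, hL, hQ, hlip, heq, htr⟩ := h.exists_isLipField hQ₀ hd.f_eq_zero hR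
  obtain ⟨E', L', Q', -, hQ', -, heq', htr'⟩ := h'.exists_isLipField hQ₀ hd.f_eq_zero hR
  -- Chosen as in the contraction of the iteration, with the common velocity cutoff `Q + Q'` of the
  -- two densities.
  set k := 2 * (Q + Q') * (Λ * (R * Real.exp ((1 + L) * R))) + 1 with hk
  have hk1 : 1 ≤ k := by
    have : 0 ≤ 2 * (Q + Q') * (Λ * (R * Real.exp ((1 + L) * R))) := by positivity
    linarith
  refine ⟨2 * k, by positivity, fun D hD hdiff => ?_⟩
  have hhalf : k * D / (2 * k) = D / 2 := by field_simp
  have hkD : 0 ≤ k * D := by positivity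
  have hdens : ∀ t ∈ Icc 0 R, ∀ x, |x| ≤ R - t → ∀ v, |g (t, x, v) - f (t, x, v)| ≤
      Λ * (D * Real.exp (2 * k * t) * R * Real.exp ((1 + L) * R)) := by
    intro t ht x hx v
    refine ((htr t ht x hx v).1.abs_sub_le (htr' t ht x hx v).1 ht.1 hΛ hf₀ hL
      (ε := D * Real.exp (2 * k * t)) (by positivity) (fun s _ y y' _ _ => hlip s y y')
      (fun s hs y hy => ?_)).trans ?_
    · have hsR : s ∈ Icc 0 R := ⟨hs.1, hs.2.trans ht.2⟩
      -- The backward cone of a point of the cone lies in the cone, so the hypothesis on the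
      -- differences applies along characteristics.
      have hy' : |y| ≤ R - s := by linarith [abs_sub_abs_le_abs_sub y x]
      rw [heq s hsR y (by linarith [hs.1]), heq' s hsR y (by linarith [hs.1])]
      refine (hdiff s hsR y hy').2.trans ?_
      have := hs.2
      gcongr
    · have := ht.2
      gcongr
  have hsrc : ∀ t ∈ Icc 0 R, ∀ x, |x| ≤ R - t →
      |(-(∫ v, g (t, x, v)) - w (t, x)) - (-(∫ v, f (t, x, v)) - u (t, x))| ≤
        k * D * Real.exp (2 * k * t) := by
    intro t ht x hx
    have h1 := _root_.abs_moment_sub_le (f := fun t x v => g (t, x, v))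
      (g := fun t x v => f (t, x, v)) (a := fun _ => 1) (c := 1) (Q := Q + Q') (by positivity)
      (fun v hv => (htr t ht x hx v).2 (by linarith)) (fun v hv => (htr' t ht x hx v).2 (by linarith))
      (h.continuous_velocity ht.1 x) (h'.continuous_velocity ht.1 x) continuous_const (by simp)
      (hdens t ht x hx)
    simp only [moment, one_mul] at h1
    have h2 := (hdiff t ht x hx).1
    have h3 : k * D * Real.exp (2 * k * t) = 2 * (Q + Q') * 1 *
        (Λ * (D * Real.exp (2 * k * t) * R * Real.exp ((1 + L) * R)))
        + D * Real.exp (2 * k * t) := by rw [hk]; ring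
    rw [h3]
    rw [abs_le] at *
    constructor <;> linarith
  have hr : ∀ σ : ℝ, σ ^ 2 = 1 → ∀ t ∈ Icc 0 R, ∀ x, |x| ≤ R - t →
      |(speedOf w (t, x) + σ * fieldOf w t x) - (speedOf u (t, x) + σ * fieldOf u t x)| ≤
        D / 2 * Real.exp (2 * k * t) := by
    intro σ hσ t ht x hx
    have cb : Continuous fun s : ℝ => x + σ * (t - s) := by fun_prop
    rw [h.riemann_eq hσ ht.1, h'.riemann_eq hσ ht.1, add_sub_add_left_eq_sub, ← hhalf]
    refine abs_integral_sub_integral_le ht.1 (h.continuousOn_source.comp_curve cb)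
      (h'.continuousOn_source.comp_curve cb) hkD (by positivity) fun s hs => ?_
    refine hsrc s ⟨hs.1, hs.2.trans ht.2⟩ _ ((abs_add_le _ _).trans ?_)
    have hσ' : |σ| = 1 := by
      rcases mul_self_eq_one_iff.1 ((sq σ).symm.trans hσ) with rfl | rfl <;> simp
    rw [abs_mul, hσ', one_mul, abs_of_nonneg (sub_nonneg.2 hs.2)]
    linarith
  have h1 := hr 1 (by norm_num)
  have h2 := hr (-1) (by norm_num)
  intro t ht x hx
  constructor
  · rw [h.potential_eq ht.1, h'.potential_eq ht.1, add_sub_add_left_eq_sub, ← hhalf]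
    refine abs_integral_sub_integral_le ht.1
      (h.contDiffOn_u.speedOf.continuousOn.comp_curve continuous_const)
      (h'.contDiffOn_u.speedOf.continuousOn.comp_curve continuous_const) hkD (by positivity)
      fun s hs => ?_
    have hs' : s ∈ Icc 0 R := ⟨hs.1, hs.2.trans ht.2⟩
    have k1 := h1 s hs' x (by linarith [hs.2])
    have k2 := h2 s hs' x (by linarith [hs.2])
    have k3 : D / 2 * Real.exp (2 * k * s) ≤ k * D * Real.exp (2 * k * s) := by
      refine mul_le_mul_of_nonneg_right ?_ (Real.exp_nonneg _)
      nlinarith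
    rw [abs_le] at *
    constructor <;> linarith
  · have k1 := h1 t ht x hx
    have k2 := h2 t ht x hx
    rw [abs_le] at *
    constructor <;> linarith

/-- On the compact cone the differences of potentials and fields are finite, and the contraction
halves the bound arbitrarily often. -/
theorem eq_on_cone (h : IsGlobalVKGSolution f₀ u₁ u₂ g w)
    (h' : IsGlobalVKGSolution f₀ u₁ u₂ f u) (hd : IsBoundedData M C P₀ f₀ u₁ u₂) {R : ℝ}
    (hR : 0 ≤ R) : ∀ t ∈ Icc 0 R, ∀ x, |x| ≤ R - t →
      w (t, x) = u (t, x) ∧ fieldOf w t x = fieldOf u t x := by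
  obtain ⟨l, hl, hcon⟩ := h.exists_contraction h' hd hR
  have hsub : Icc 0 R ×ˢ Icc (-R) R ⊆ Ici (0 : ℝ) ×ˢ univ := fun p hp => ⟨hp.1.1, mem_univ _⟩
  have hK := (isCompact_Icc (a := 0) (b := R)).prod (isCompact_Icc (a := -R) (b := R))
  obtain ⟨D₁, hD₁⟩ := hK.exists_bound_of_continuousOn
    ((h.contDiffOn_u.continuousOn.sub h'.contDiffOn_u.continuousOn).mono hsub)
  obtain ⟨D₂, hD₂⟩ := hK.exists_bound_of_continuousOn
    ((h.contDiffOn_u.fieldOf.continuousOn.sub h'.contDiffOn_u.fieldOf.continuousOn).mono hsub)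
  set D := max 0 (max D₁ D₂) with hDdef
  have hD : 0 ≤ D := le_max_left _ _
  have key : ∀ n : ℕ, ∀ t ∈ Icc 0 R, ∀ x, |x| ≤ R - t →
      |w (t, x) - u (t, x)| ≤ D / 2 ^ n * Real.exp (l * t) ∧
        |fieldOf w t x - fieldOf u t x| ≤ D / 2 ^ n * Real.exp (l * t) := by
    intro n
    induction n with
    | zero =>
      intro t ht x hx
      have hp : (t, x) ∈ Icc 0 R ×ˢ Icc (-R) R := ⟨ht, abs_le.1 (by linarith [ht.1])⟩
      have he : D ≤ D / 2 ^ 0 * Real.exp (l * t) := by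
        rw [pow_zero, div_one]
        exact le_mul_of_one_le_right hD (Real.one_le_exp (mul_nonneg hl.le ht.1))
      exact ⟨((hD₁ _ hp).trans ((le_max_left _ _).trans (le_max_right _ _))).trans he,
        ((hD₂ _ hp).trans ((le_max_right _ _).trans (le_max_right _ _))).trans he⟩
    | succ n ih =>
      have := hcon (D / 2 ^ n) (by positivity) ih
      rwa [div_div, ← pow_succ] at this
  intro t ht x hx
  replace key := fun n => key n t ht x hx
  have e : ∀ n : ℕ, D / 2 ^ n * Real.exp (l * t) = D * Real.exp (l * t) / 2 ^ n := by
    intro n; ring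
  simp only [e] at key
  exact ⟨tendsto_nhds_unique tendsto_const_nhds
      (tendsto_of_abs_sub_le fun n => (key n).1),
    tendsto_nhds_unique tendsto_const_nhds
      (tendsto_of_abs_sub_le fun n => (key n).2)⟩

/-- Two global classical solutions with the same data coincide. -/
theorem eqOn (h : IsGlobalVKGSolution f₀ u₁ u₂ g w)
    (h' : IsGlobalVKGSolution f₀ u₁ u₂ f u) (hd : IsBoundedData M C P₀ f₀ u₁ u₂) :
    EqOn g f (Ici (0 : ℝ) ×ˢ univ) ∧ EqOn w u (Ici (0 : ℝ) ×ˢ univ) := by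
  constructor
  · rintro ⟨t, x, v⟩ ⟨ht, -⟩
    have ht : 0 ≤ t := ht
    -- The cone of height `t + |x|` is the smallest one of the family to contain `(t, x)`. On it the
    -- two fields agree, so the densities are compared with `ε = 0`.
    have hR : 0 ≤ t + |x| := by positivity
    have hmem : t ∈ Icc 0 (t + |x|) := ⟨ht, by linarith [abs_nonneg x]⟩
    have hx : |x| ≤ t + |x| - t := by linarith
    have hQ₀ : 0 ≤ momentumBound C P₀ 0 := momentumBound_nonneg hd.const_pos.le hd.nonneg le_rfl
    obtain ⟨Λ, hΛ, hf₀⟩ := hd.exists_lipschitz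
    obtain ⟨E, L, Q, hL, -, hlip, heq, htr⟩ := h.exists_isLipField hQ₀ hd.f_eq_zero hR
    obtain ⟨E', L', Q', -, -, -, heq', htr'⟩ := h'.exists_isLipField hQ₀ hd.f_eq_zero hR
    have := (htr t hmem x hx v).1.abs_sub_le (htr' t hmem x hx v).1 ht hΛ hf₀ hL (ε := 0) le_rfl
      (fun s _ y y' _ _ => hlip s y y') (fun s hs y hy => ?_)
    · simp only [zero_mul, mul_zero, abs_nonpos_iff] at this
      exact sub_eq_zero.1 this
    · have hsR : s ∈ Icc 0 (t + |x|) := ⟨hs.1, hs.2.trans hmem.2⟩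
      have hy' : |y| ≤ t + |x| - s := by linarith [abs_sub_abs_le_abs_sub y x]
      rw [heq s hsR y (by linarith [hs.1]), heq' s hsR y (by linarith [hs.1]),
        (h.eq_on_cone h' hd hR s hsR y hy').2, sub_self, abs_zero]
  · rintro ⟨t, x⟩ ⟨ht, -⟩
    have ht : 0 ≤ t := ht
    exact (h.eq_on_cone h' hd (R := t + |x|) (by positivity) t
      ⟨ht, by linarith [abs_nonneg x]⟩ x (by linarith)).1

end IsGlobalVKGSolution

end Uniqueness

/-! ### The global existence theorem -/

section Main

variable {M : ℝ} {f₀ : ℝ × ℝ → ℝ} {u₁ u₂ : ℝ → ℝ}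

/-- The solution is constructed once, with the least momentum bound `P₀` of the datum; every other
admissible bound is larger, and monotonicity in `P₀` covers it. For `f₀ = 0` the supremum is that of
the empty set, namely `0`, whereas negative bounds are admissible too, hence the restriction. -/
theorem IsVKGData.exists_isBoundedData (h : IsVKGData M f₀ u₁ u₂) :
    ∃ P₀, IsBoundedData M (4 * |M| + 2) P₀ f₀ u₁ u₂ ∧
      ∀ P₁, (∀ x v, f₀ (x, v) ≠ 0 → |v| ≤ P₁) → (∃ z, f₀ z ≠ 0) → P₀ ≤ P₁ := by
  have hM : |M| = M := abs_of_nonneg ((abs_nonneg _).trans (h.sup_f_le 0))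
  set S : Set ℝ := {r | ∃ x v, f₀ (x, v) ≠ 0 ∧ r = |v|} with hS
  have hbdd : BddAbove S := by
    obtain ⟨K, hK⟩ := h.compactSupport_f.isCompact.isBounded.exists_norm_le
    refine ⟨K, ?_⟩
    rintro r ⟨x, v, hne, rfl⟩
    exact (norm_snd_le (x, v)).trans (hK _ (subset_tsupport _ hne))
  refine ⟨sSup S, ⟨h, by rw [hM], Real.sSup_nonneg ?_, fun x v hne => le_csSup hbdd ⟨x, v, hne, rfl⟩⟩,
    fun P₁ hP₁ hne => csSup_le ?_ ?_⟩
  · rintro r ⟨x, v, -, rfl⟩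
    exact abs_nonneg v
  · obtain ⟨⟨x, v⟩, hz⟩ := hne
    exact ⟨|v|, x, v, hz, rfl⟩
  · rintro r ⟨x, v, hz, rfl⟩
    exact hP₁ x v hz

end Main

theorem theorem4p1 (M : ℝ) :
    ∃ C : ℝ, 0 < C ∧
      ∀ (f₀ : ℝ × ℝ → ℝ) (u₁ u₂ : ℝ → ℝ), IsVKGData M f₀ u₁ u₂ →
        ∃ (f : ℝ × ℝ × ℝ → ℝ) (u : ℝ × ℝ → ℝ),
          IsGlobalVKGSolution f₀ u₁ u₂ f u ∧
          (∀ (g : ℝ × ℝ × ℝ → ℝ) (w : ℝ × ℝ → ℝ), IsGlobalVKGSolution f₀ u₁ u₂ g w →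
            EqOn g f (Ici (0 : ℝ) ×ˢ univ) ∧ EqOn w u (Ici (0 : ℝ) ×ˢ univ)) ∧
          ((∀ z, 0 ≤ f₀ z) → ∀ t ≥ 0, ∀ x v, 0 ≤ f (t, x, v)) ∧
          ∀ R₀ P₀ : ℝ, (∀ x v, f₀ (x, v) ≠ 0 → |x| ≤ R₀ ∧ |v| ≤ P₀) →
            ∃ P : ℝ → ℝ, SolvesMomentumEquation C P₀ P ∧
              (∀ Q : ℝ → ℝ, SolvesMomentumEquation C P₀ Q → EqOn Q P (Ici 0)) ∧
              ∀ t ≥ 0, ∀ x v, R₀ + t ≤ |x| ∨ P t ≤ |v| → f (t, x, v) = 0 := by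
  -- Data exist only for `M ≥ 0`; the modulus keeps the constant positive for every `M`.
  refine ⟨4 * |M| + 2, by positivity, fun f₀ u₁ u₂ hdata => ?_⟩
  obtain ⟨P₁, hd, hmin⟩ := hdata.exists_isBoundedData
  obtain ⟨u, E, E', hs, hfix⟩ := hd.exists_fixedPoint
  have hsol := hs.isGlobalVKGSolution hd hfix
  refine ⟨_, _, hsol, fun g w h => h.eqOn hsol hd, fun hpos t _ x v => hpos _,
    fun R₀ P₀ hsupp => ⟨momentumBound (4 * |M| + 2) P₀, solvesMomentumEquation_momentumBound _ _,
      fun Q hQ => SolvesMomentumEquation.eqOn (by positivity)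
        (solvesMomentumEquation_momentumBound _ _) hQ, fun t ht x v hxv => ?_⟩⟩
  -- If `f₀` vanishes identically, the given `P₀` may lie below the one used in the construction,
  -- but then the transported density is zero.
  by_cases hne : ∃ z, f₀ z ≠ 0
  · rcases hxv with hx | hv
    · exact hs.transport_eq_zero_of_position hd (fun x v h => (hsupp x v h).1) ht x v hx
    · exact hs.transport_eq_zero hd ht x v ((momentumBound_mono
        (hmin P₀ (fun x v h => (hsupp x v h).2) hne)).trans hv)
  · push Not at hne
    exact hne _
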